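/- Let $\alpha,\beta,\gamma>0$ be constants, let $\tilde u\in\mathbb R$ and let $f\in C^2(\mathbb R)$ be real-valued. Write $L^2=L^2(\mathbb R)$ and $H^k=H^k(\mathbb R)$ for the usual Lebesgue and Sobolev spaces of real-valued functions. Assume that $u_0:\mathbb R\to\mathbb R$ satisfies $u_0-\tilde u\in L^2$ and $\partial_xu_0\in H^2$ (weak derivative). Then the Cauchy problem $$\partial_tu+\partial_x\big(f(u)\big)-\alpha\,\partial_t\partial_x^2u-\beta\,\partial_x^2u+\gamma\,\partial_x^4u=0\quad(t>0,\ x\in\mathbb R),\qquad u(0,x)=u_0(x),$$ has a unique global in time solution $u$ satisfying $$u-\tilde u\in C^0\big([0,\infty);H^3\big),\qquad \partial_xu\in L^2\big(0,\infty;H^3\big),\qquad \partial_tu\in L^2\big(0,\infty;H^2\big).$$ Here derivatives are taken in the weak sense, the equation holds for almost every $t>0$ and $x\in\mathbb R$, the initial condition holds for almost every $x$, $u(t,\cdot)$ denotes, for each $t\ge0$, the continuous representative, and uniqueness is meant among solutions in this class. Moreover $u(t,\cdot)\in C^2(\mathbb R)$ for every $t\ge0$, and $$\lim_{t\to\infty}\Big(\sup_{x\in\mathbb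 R}|u(t,x)-\tilde u|+\sup_{x\in\mathbb R}|\partial_xu(t,x)|+\sup_{x\in\mathbb R}|\partial_x^2u(t,x)|\Big)=0.$$ -/

import Mathlib

open MeasureTheory Set Filter Topology
open scoped ENNReal ContDiff

noncomputable section

namespace BBMB

/-- The Lebesgue space `L²(ℝ)` of real-valued functions. -/
abbrev L2 : Type := Lp ℝ 2 (volume : Measure ℝ)

/-- `g'` is the weak (distributional) derivative on `ℝ` of the function `g`. -/
structure IsWeakDeriv (g g' : ℝ → ℝ) : Prop where
  locInt : LocallyIntegrable g volume
  locInt_deriv : LocallyIntegrable g' volume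
  integral_eq : ∀ ψ : ℝ → ℝ, ContDiff ℝ ∞ ψ → HasCompactSupport ψ →
    ∫ x, g x * deriv ψ x = -∫ x, g' x * ψ x

theorem IsWeakDeriv.congr {g g' h h' : ℝ → ℝ} (H : IsWeakDeriv g g')
    (e : g =ᵐ[volume] h) (e' : g' =ᵐ[volume] h') : IsWeakDeriv h h' := by
  refine ⟨H.locInt.congr e, H.locInt_deriv.congr e', fun ψ hψ hc => ?_⟩
  have h1 : ∫ x, h x * deriv ψ x = ∫ x, g x * deriv ψ x :=
    integral_congr_ae (by filter_upwards [e] with x hx; rw [hx])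
  have h2 : ∫ x, h' x * ψ x = ∫ x, g' x * ψ x :=
    integral_congr_ae (by filter_upwards [e'] with x hx; rw [hx])
  rw [h1, h2, H.integral_eq ψ hψ hc]

theorem IsWeakDeriv.zero : IsWeakDeriv (fun _ => 0) (fun _ => 0) :=
  ⟨locallyIntegrable_const 0, locallyIntegrable_const 0, fun ψ _ _ => by simp⟩

theorem IsWeakDeriv.smul {g g' : ℝ → ℝ} (c : ℝ) (H : IsWeakDeriv g g') :
    IsWeakDeriv (c • g) (c • g') := by
  refine ⟨H.locInt.smul c, H.locInt_deriv.smul c, fun ψ hψ hc => ?_⟩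
  simp only [Pi.smul_apply, smul_eq_mul, mul_assoc, integral_const_mul,
    H.integral_eq ψ hψ hc, mul_neg]

theorem IsWeakDeriv.add {g g' h h' : ℝ → ℝ} (H : IsWeakDeriv g g') (K : IsWeakDeriv h h') :
    IsWeakDeriv (g + h) (g' + h') := by
  refine ⟨H.locInt.add K.locInt, H.locInt_deriv.add K.locInt_deriv, fun ψ hψ hc => ?_⟩
  have hd : Continuous (deriv ψ) := hψ.continuous_deriv (by simp)
  have i1 := H.locInt.integrable_smul_right_of_hasCompactSupport hd hc.deriv
  have i2 := K.locInt.integrable_smul_right_of_hasCompactSupport hd hc.deriv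
  have i3 := H.locInt_deriv.integrable_smul_right_of_hasCompactSupport hψ.continuous hc
  have i4 := K.locInt_deriv.integrable_smul_right_of_hasCompactSupport hψ.continuous hc
  simp only [smul_eq_mul] at i1 i2 i3 i4
  simp only [Pi.add_apply, add_mul]
  rw [integral_add i1 i2, integral_add i3 i4, H.integral_eq ψ hψ hc, K.integral_eq ψ hψ hc]
  ring

/-- The Sobolev space `H^k(ℝ)`. An element is recorded together with its weak derivatives: it is
a tuple `v = (v₀, v₁, …, v_k)` of elements of `L²(ℝ)` in which each `v_{j+1}` is the weak
derivative of `v_j`, so that `v_j = ∂ₓʲ v₀`. The norm is the one inherited from the `ℓ²`-product,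
`‖v‖² = ∑_{j ≤ k} ‖∂ₓʲ v₀‖²_{L²}`. -/
def SobolevH (k : ℕ) : Submodule ℝ (PiLp 2 (fun _ : Fin (k + 1) => L2)) where
  carrier := {v | ∀ j : Fin k, IsWeakDeriv (v j.castSucc : L2) (v j.succ : L2)}
  zero_mem' := fun _ => IsWeakDeriv.zero.congr
    (Lp.coeFn_zero ℝ 2 (volume : Measure ℝ)).symm (Lp.coeFn_zero ℝ 2 (volume : Measure ℝ)).symm
  add_mem' := fun {a b} ha hb j => ((ha j).add (hb j)).congr
    (Lp.coeFn_add (a j.castSucc) (b j.castSucc)).symm (Lp.coeFn_add (a j.succ) (b j.succ)).symm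
  smul_mem' := fun c {a} ha j => ((ha j).smul c).congr
    (Lp.coeFn_smul c (a j.castSucc)).symm (Lp.coeFn_smul c (a j.succ)).symm

/-- The `j`-th weak derivative `∂ₓʲ v ∈ L²(ℝ)` of `v ∈ H^k(ℝ)`, for `j ≤ k`; in particular
`dx v 0` is the function `v` itself. -/
def dx {k : ℕ} (v : SobolevH k) (j : Fin (k + 1)) : L2 :=
  (v : PiLp 2 (fun _ : Fin (k + 1) => L2)) j

/-- `v` is the weak derivative of `φ` on the time interval `(0, ∞)`, both being functions of time
with values in `L²(ℝ)`. -/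
def IsTimeDeriv (φ v : ℝ → L2) : Prop :=
  ∀ η : ℝ → ℝ, ContDiff ℝ ∞ η → HasCompactSupport η → tsupport η ⊆ Ioi 0 →
    ∫ t in Ioi (0 : ℝ), deriv η t • φ t = -∫ t in Ioi (0 : ℝ), η t • v t

/-- `u(t,x)` (`t ≥ 0`) is a global in time solution of the Cauchy problem
`∂ₜu + ∂ₓ(f(u)) - α ∂ₜ∂ₓ²u - β ∂ₓ²u + γ ∂ₓ⁴u = 0`, `u(0,·) = u₀`, with
`u - c ∈ C⁰([0,∞); H³)`, `∂ₓu ∈ L²(0,∞; H³)` and `∂ₜu ∈ L²(0,∞; H²)`; here `φ`, `ux` and `ut`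
are the functions `u - c`, `∂ₓu` and `∂ₜu = ∂ₜ(u - c)` of time with values in these spaces. -/
structure IsSolutionWith (α β γ : ℝ) (f : ℝ → ℝ) (c : ℝ) (u₀ : ℝ → ℝ) (u : ℝ → ℝ → ℝ)
    (φ : ℝ → SobolevH 3) (ux : ℝ → SobolevH 3) (ut : ℝ → SobolevH 2) : Prop where
  /-- For each `t ≥ 0`, `u(t,·)` is the continuous representative of its class. -/
  continuous_space : ∀ t, 0 ≤ t → Continuous (u t)
  dev_eq : ∀ t, 0 ≤ t → ∀ᵐ x : ℝ, dx (φ t) 0 x = u t x - c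
  dev_continuous : ContinuousOn φ (Ici 0)
  ux_eq : ∀ᵐ t ∂(volume.restrict (Ioi (0 : ℝ))), IsWeakDeriv (u t) (dx (ux t) 0)
  ux_memLp : MemLp ux 2 (volume.restrict (Ioi (0 : ℝ)))
  ut_eq : IsTimeDeriv (fun t => dx (φ t) 0) (fun t => dx (ut t) 0)
  ut_memLp : MemLp ut 2 (volume.restrict (Ioi (0 : ℝ)))
  initial : ∀ᵐ x : ℝ, u 0 x = u₀ x
  /-- The equation, for almost every `t > 0` and `x`. Since `u(t,·)` is continuous and
  `u(t,·) - c ∈ H³`, the function `f(u(t,·))` is continuously differentiable. -/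
  equation : ∀ᵐ t ∂(volume.restrict (Ioi (0 : ℝ))), ∀ᵐ x : ℝ,
    dx (ut t) 0 x + deriv (fun y => f (u t y)) x - α * dx (ut t) 2 x
      - β * dx (ux t) 1 x + γ * dx (ux t) 3 x = 0

/-- `u(t,x)` (`t ≥ 0`) is a global in time solution of the Cauchy problem in the class
`u - c ∈ C⁰([0,∞); H³)`, `∂ₓu ∈ L²(0,∞; H³)`, `∂ₜu ∈ L²(0,∞; H²)`. -/
def IsGlobalSolution (α β γ : ℝ) (f : ℝ → ℝ) (c : ℝ) (u₀ : ℝ → ℝ) (u : ℝ → ℝ → ℝ) : Prop :=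
  ∃ (φ : ℝ → SobolevH 3) (ux : ℝ → SobolevH 3) (ut : ℝ → SobolevH 2),
    IsSolutionWith α β γ f c u₀ u φ ux ut

end BBMB

end

/-! The equation is rewritten as a dissipative semilinear equation. With `φ = u - c`,
`K = (1 - α ∂ₓ²)⁻¹` and `κ = γ / α` it reads
`∂ₜφ = κ ∂ₓ²φ + (β - κ) K ∂ₓ²φ - K ∂ₓ(f(c + φ) - f(c))`. The second and the third term are Lipschitz
in `L²(ℝ)` once the flux is replaced by a globally Lipschitz function `g` that agrees with
`f(c + ·) - f(c)` on a bounded interval (`exists_truncation`). As `∂ₓ²` is dissipative, Yosida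
approximation by ordinary differential equations gives a global solution (`exists_semilinear`); here
only the resolvents of `∂ₓ²` are needed, which the Lax-Milgram theorem provides.

All further information comes from energy estimates. Testing the equation for `∂ₓᵏφ` with `∂ₓᵏφ`
yields `½ d/dt (‖∂ₓᵏφ‖² + α ‖∂ₓᵏ⁺¹φ‖²) + β ‖∂ₓᵏ⁺¹φ‖² + γ ‖∂ₓᵏ⁺²φ‖² = -(∂ₓᵏ⁺¹ g(φ), ∂ₓᵏφ)`
(`IsEvolution.energy_identity`, for a solution smoothed by resolvents). Such an identity holds also
for the difference of two smoothings of a solution, and so it propagates the regularity `H³` of the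
initial value (`IsEvolution.exists_tendsto_smo`, `exists_strong`). For `k = 0` the right-hand side
vanishes, since `g(φ) ∂ₓφ` is the derivative of a function of `φ` (`inner_compLp_eq_zero`). Hence
`‖φ‖² + α ‖∂ₓφ‖²` does not increase; by the Sobolev inequality `sup |φ|² ≤ 2 ‖φ‖ ‖∂ₓφ‖` it bounds
`φ` independently of the truncation, so that a suitable truncation is invisible. Moreover `∂ₓφ` and
`∂ₓ²φ` are in `L²((0, ∞) × ℝ)`; as `‖∂ₓg(φ)‖ ≤ C ‖∂ₓφ‖`, the identities for `k = 1` and `k = 2` put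
`∂ₓ³φ` and `∂ₓ⁴φ` there too and bound `‖∂ₓ³φ‖` uniformly in time. The energy for `k = 1` is
integrable in time together with its derivative and therefore tends to zero
(`IsStrongEvolution.tendsto_energy_one`), and Sobolev inequalities turn this into the uniform decay
of `u - c`, `∂ₓu` and `∂ₓ²u`.

For uniqueness, any two solutions of the given class are bounded on bounded time intervals, hence
solve the equation with one common truncated flux, and by the lemma of du Bois-Reymond they solve it
in integrated form (`IsSolutionWith.isStrongEvolution`). The energy identity for `k = 0` applies to
their difference, and Gronwall's inequality concludes (`IsStrongEvolution.eqOn`). -/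

namespace BBMB

/-! ### The lemma of du Bois-Reymond and weak derivatives on the line -/

theorem integrable_smul_of_tsupport_subset {E : Type*} [NormedAddCommGroup E] [NormedSpace ℝ E]
    {s : Set ℝ} {g : ℝ → E} (hg : LocallyIntegrableOn g s volume) {χ : ℝ → ℝ}
    (hχ : Continuous χ) (hc : HasCompactSupport χ) (hs : tsupport χ ⊆ s) :
    Integrable (fun x => χ x • g x) := by
  have h1 : IntegrableOn (fun x => χ x • g x) (tsupport χ) :=
    IntegrableOn.continuousOn_smul (hg.integrableOn_compact_subset hs hc) hχ.continuousOn hc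
  refine (integrableOn_iff_integrable_of_support_subset ?_).1 h1
  intro x hx
  apply subset_tsupport χ
  intro h
  exact hx (by simp [h])

/-- A test function of mean zero supported in an open interval is the derivative of a test function
supported in the same interval. -/
theorem exists_primitive_test {s : Set ℝ} (hc : s.OrdConnected) {ψ : ℝ → ℝ}
    (hψ : ContDiff ℝ ∞ ψ) (hcs : HasCompactSupport ψ) (hs : tsupport ψ ⊆ s) (h0 : ∫ x, ψ x = 0) :
    ∃ η : ℝ → ℝ, ContDiff ℝ ∞ η ∧ HasCompactSupport η ∧ tsupport η ⊆ s ∧ deriv η = ψ := by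
  rcases (tsupport ψ).eq_empty_or_nonempty with he | hne
  · have hz : ψ = 0 := by
      ext x
      by_contra hx
      have := subset_tsupport ψ hx
      simp [he] at this
    exact ⟨fun _ => 0, contDiff_const, HasCompactSupport.zero, by simp [tsupport],
      by simp [hz]; rfl⟩
  have ha := hcs.isCompact.sInf_mem hne
  have hb := hcs.isCompact.sSup_mem hne
  set a := sInf (tsupport ψ) with hadef
  set b := sSup (tsupport ψ) with hbdef
  have hab : Icc a b ⊆ s := hc.out (hs ha) (hs hb)
  have hout : ∀ x, x ∉ Icc a b → ψ x = 0 := by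
    intro x hx
    by_contra h
    have hm := subset_tsupport ψ (Function.mem_support.2 h)
    exact hx ⟨csInf_le hcs.isCompact.bddBelow hm, le_csSup hcs.isCompact.bddAbove hm⟩
  have hd : ∀ x, HasDerivAt (fun x => ∫ t in a..x, ψ t) (ψ x) x := fun x =>
    intervalIntegral.integral_hasDerivAt_right (hψ.continuous.intervalIntegrable _ _)
      hψ.continuous.aestronglyMeasurable.stronglyMeasurableAtFilter hψ.continuous.continuousAt
  have hder : deriv (fun x => ∫ t in a..x, ψ t) = ψ := funext fun x => (hd x).deriv
  have hsupp : Function.support (fun x => ∫ t in a..x, ψ t) ⊆ Icc a b := by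
    intro x hx
    by_contra hxn
    apply hx
    rcases lt_or_ge x a with hxa | hxa
    · refine (intervalIntegral.integral_congr_ae (g := fun _ => 0) ?_).trans (by simp)
      have : ∀ᵐ t : ℝ, t ≠ a := by simp [ae_iff, measure_singleton]
      filter_upwards [this] with t hta ht
      rw [uIoc_of_ge hxa.le] at ht
      exact hout t fun h => hta (le_antisymm ht.2 h.1)
    · have hxb : b < x := by
        by_contra h
        exact hxn ⟨hxa, not_lt.1 h⟩
      show ∫ t in a..x, ψ t = 0
      rw [intervalIntegral.integral_of_le hxa, ← integral_Icc_eq_integral_Ioc,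
        setIntegral_eq_integral_of_forall_compl_eq_zero, h0]
      intro t ht
      exact hout t fun h => ht ⟨h.1, h.2.trans hxb.le⟩
  have hts : tsupport (fun x => ∫ t in a..x, ψ t) ⊆ Icc a b := closure_minimal hsupp isClosed_Icc
  refine ⟨fun x => ∫ t in a..x, ψ t, ?_, isCompact_Icc.of_isClosed_subset isClosed_closure hts,
    hts.trans hab, hder⟩
  rw [contDiff_infty_iff_deriv, hder]
  exact ⟨fun x => (hd x).differentiableAt, hψ⟩

theorem exists_test_integral_one {s : Set ℝ} (hs : IsOpen s) (hne : s.Nonempty) :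
    ∃ ρ : ℝ → ℝ, ContDiff ℝ ∞ ρ ∧ HasCompactSupport ρ ∧ tsupport ρ ⊆ s ∧ ∫ x, ρ x = 1 := by
  obtain ⟨x, hx⟩ := hne
  obtain ⟨r, hr, hrs⟩ := Metric.isOpen_iff.1 hs x hx
  let b : ContDiffBump x := ⟨r / 4, r / 2, by positivity, by linarith⟩
  refine ⟨b.normed volume, b.contDiff_normed, b.hasCompactSupport_normed, ?_, b.integral_normed⟩
  rw [b.tsupport_normed_eq]
  refine (Metric.closedBall_subset_ball ?_).trans hrs
  show r / 2 < r
  linarith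

/-- The lemma of du Bois-Reymond: a function with vanishing weak derivative on an open interval is
almost everywhere constant there. -/
theorem ae_const_of_integral_deriv_smul_eq_zero {E : Type*} [NormedAddCommGroup E]
    [NormedSpace ℝ E] [CompleteSpace E] {s : Set ℝ} (hs : IsOpen s) (hc : s.OrdConnected)
    {g : ℝ → E} (hg : LocallyIntegrableOn g s volume)
    (h : ∀ η : ℝ → ℝ, ContDiff ℝ ∞ η → HasCompactSupport η → tsupport η ⊆ s →
      ∫ x, deriv η x • g x = 0) :
    ∃ C : E, ∀ᵐ x, x ∈ s → g x = C := by
  rcases s.eq_empty_or_nonempty with he | hne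
  · exact ⟨0, by simp [he]⟩
  obtain ⟨ρ, hρ, hρc, hρs, hρ1⟩ := exists_test_integral_one hs hne
  refine ⟨∫ x, ρ x • g x, ?_⟩
  have hgc : LocallyIntegrableOn (fun x => g x - ∫ x, ρ x • g x) s volume :=
    hg.sub ((locallyIntegrable_const _).locallyIntegrableOn s)
  have := hs.ae_eq_zero_of_integral_contDiff_smul_eq_zero hgc ?_
  · filter_upwards [this] with x hx hxs
    exact sub_eq_zero.1 (hx hxs)
  intro χ hχ hχc hχs
  set m := ∫ x, χ x with hm
  have hsub : tsupport (fun x => χ x - m * ρ x) ⊆ s := by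
    refine (tsupport_sub χ (fun x => m * ρ x)).trans (union_subset hχs ?_)
    exact (tsupport_mul_subset_right).trans hρs
  have hcs : HasCompactSupport (fun x => χ x - m * ρ x) := hχc.sub hρc.mul_left
  have iχ : Integrable χ := hχ.continuous.integrable_of_hasCompactSupport hχc
  have iρ : Integrable ρ := hρ.continuous.integrable_of_hasCompactSupport hρc
  obtain ⟨η, h1, h2, h3, h4⟩ := exists_primitive_test hc (ψ := fun x => χ x - m * ρ x)
    (hχ.sub (contDiff_const.mul hρ)) hcs hsub (by
      rw [integral_sub iχ (iρ.const_mul m), integral_const_mul, hρ1]; simp [hm])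
  have h5 := h η h1 h2 h3
  have i1 := integrable_smul_of_tsupport_subset hg hχ.continuous hχc hχs
  have i2 := integrable_smul_of_tsupport_subset hg hρ.continuous hρc hρs
  simp only [h4, sub_smul, mul_smul] at h5
  rw [integral_sub i1 (g := fun x => m • ρ x • g x) (i2.smul m), integral_smul,
    sub_eq_zero] at h5
  simp only [smul_sub]
  rw [integral_sub i1 (iχ.smul_const _), integral_smul_const, h5, ← hm, sub_self]

/-- `G` is an antiderivative of the locally integrable function `g`; equivalently, `G` is locally
absolutely continuous with derivative `g` almost everywhere. -/
structure IsPrimitive (G g : ℝ → ℝ) : Prop where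
  locInt : LocallyIntegrable g volume
  sub_eq : ∀ a b, G b - G a = ∫ x in a..b, g x

namespace IsPrimitive

variable {G g H h : ℝ → ℝ}

theorem intervalIntegrable (hG : IsPrimitive G g) (a b : ℝ) : IntervalIntegrable g volume a b :=
  (hG.locInt.integrableOn_isCompact isCompact_uIcc).intervalIntegrable

theorem eq_add (hG : IsPrimitive G g) (a : ℝ) : G = fun x => G a + ∫ t in a..x, g t := by
  ext x
  linarith [hG.sub_eq a x]

theorem ac (hG : IsPrimitive G g) (a b : ℝ) : AbsolutelyContinuousOnInterval G a b := by
  have h1 := ((hG.intervalIntegrable a b).absolutelyContinuousOnInterval_intervalIntegral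
    (c := a) left_mem_uIcc)
  have h2 : AbsolutelyContinuousOnInterval (fun _ : ℝ => G a) a b :=
    (LipschitzWith.const (G a)).lipschitzOnWith.absolutelyContinuousOnInterval
  rw [hG.eq_add a]
  exact h2.add h1

theorem continuous (hG : IsPrimitive G g) : Continuous G := by
  rw [hG.eq_add 0]
  exact continuous_const.add
    (intervalIntegral.continuous_primitive (fun a b => hG.intervalIntegrable a b) 0)

theorem ae_hasDerivAt (hG : IsPrimitive G g) : ∀ᵐ x, HasDerivAt G (g x) x := by
  filter_upwards [LocallyIntegrable.ae_hasDerivAt_integral hG.locInt] with x hx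
  rw [hG.eq_add 0]
  exact (hx 0).const_add (G 0)

theorem of_ac (hG : ∀ a b, AbsolutelyContinuousOnInterval G a b) (hg : LocallyIntegrable g volume)
    (hd : ∀ᵐ x, HasDerivAt G (g x) x) : IsPrimitive G g := by
  refine ⟨hg, fun a b => ?_⟩
  rw [← (hG a b).integral_deriv_eq_sub]
  refine intervalIntegral.integral_congr_ae ?_
  filter_upwards [hd] with x hx _
  exact hx.deriv

theorem mul (hG : IsPrimitive G g) (hH : IsPrimitive H h) :
    IsPrimitive (fun x => G x * H x) (fun x => g x * H x + G x * h x) := by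
  refine of_ac (fun a b => (hG.ac a b).fun_mul (hH.ac a b)) ?_ ?_
  · refine LocallyIntegrable.add ?_ ?_
    · have := hG.locInt.locallyIntegrableOn univ |>.mul_continuousOn hH.continuous.continuousOn
        isOpen_univ.isLocallyClosed
      exact locallyIntegrableOn_univ.1 this
    · have := hH.locInt.locallyIntegrableOn univ |>.continuousOn_mul hG.continuous.continuousOn
        isOpen_univ.isLocallyClosed
      exact locallyIntegrableOn_univ.1 this
  · filter_upwards [hG.ae_hasDerivAt, hH.ae_hasDerivAt] with x h1 h2
    exact h1.mul h2

theorem _root_.LipschitzOnWith.comp_absolutelyContinuousOnInterval {φ : ℝ → ℝ} {G : ℝ → ℝ}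
    {K : NNReal} {a b : ℝ} (hφ : LipschitzOnWith K φ (G '' uIcc a b))
    (hG : AbsolutelyContinuousOnInterval G a b) :
    AbsolutelyContinuousOnInterval (fun x => φ (G x)) a b := by
  rw [absolutelyContinuousOnInterval_iff] at hG ⊢
  intro ε hε
  obtain ⟨δ, hδ, hI⟩ := hG (ε / (K + 1)) (by positivity)
  refine ⟨δ, hδ, fun E hE hlt => ?_⟩
  have h1 := hI E hE hlt
  calc ∑ i ∈ Finset.range E.1, dist (φ (G (E.2 i).1)) (φ (G (E.2 i).2))
      ≤ ∑ i ∈ Finset.range E.1, K * dist (G (E.2 i).1) (G (E.2 i).2) := by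
        refine Finset.sum_le_sum fun i hi => ?_
        exact hφ.dist_le_mul _ (mem_image_of_mem _ (hE.1 i hi).1) _
          (mem_image_of_mem _ (hE.1 i hi).2)
    _ = K * ∑ i ∈ Finset.range E.1, dist (G (E.2 i).1) (G (E.2 i).2) :=
        (Finset.mul_sum _ _ _).symm
    _ ≤ (K + 1) * ∑ i ∈ Finset.range E.1, dist (G (E.2 i).1) (G (E.2 i).2) := by
        have : 0 ≤ ∑ i ∈ Finset.range E.1, dist (G (E.2 i).1) (G (E.2 i).2) :=
          Finset.sum_nonneg fun _ _ => dist_nonneg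
        nlinarith
    _ < (K + 1) * (ε / (K + 1)) := by
        have : (0 : ℝ) < K + 1 := by positivity
        exact mul_lt_mul_of_pos_left h1 this
    _ = ε := by
        have : (K + 1 : ℝ) ≠ 0 := by positivity
        field_simp

theorem comp {φ : ℝ → ℝ} (hφ : ContDiff ℝ 1 φ) (hG : IsPrimitive G g) :
    IsPrimitive (fun x => φ (G x)) (fun x => deriv φ (G x) * g x) := by
  refine of_ac (fun a b => ?_) ?_ ?_
  · obtain ⟨R, hR⟩ := (isCompact_uIcc.image (hG.continuous) : IsCompact (G '' uIcc a b)).isBounded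
      |>.subset_closedBall (0 : ℝ)
    obtain ⟨K, hK⟩ := hφ.contDiffOn.exists_lipschitzOnWith (by decide)
      (convex_closedBall (0 : ℝ) R) (isCompact_closedBall (0 : ℝ) R)
    exact (hK.mono hR).comp_absolutelyContinuousOnInterval (hG.ac a b)
  · have hc : Continuous fun x => deriv φ (G x) := (hφ.continuous_deriv le_rfl).comp hG.continuous
    have := hG.locInt.locallyIntegrableOn univ |>.continuousOn_mul hc.continuousOn
      isOpen_univ.isLocallyClosed
    exact locallyIntegrableOn_univ.1 this
  · filter_upwards [hG.ae_hasDerivAt] with x hx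
    exact ((hφ.differentiable (by decide) (G x)).hasDerivAt).comp x hx

theorem of_contDiff (hG : ContDiff ℝ 1 G) : IsPrimitive G (deriv G) := by
  refine of_ac (fun a b => hG.contDiffOn.absolutelyContinuousOnInterval) ?_ ?_
  · exact (hG.continuous_deriv le_rfl).locallyIntegrable
  · exact Eventually.of_forall fun x => (hG.differentiable (by decide) x).hasDerivAt

/-- If `G` and `G'` are integrable then `G` vanishes at infinity. -/
theorem tendsto_zero_atTop (hG : IsPrimitive G g) (iG : Integrable G) (ig : Integrable g) :
    Tendsto G atTop (𝓝 0) := by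
  have h1 : Tendsto G atTop (𝓝 (G 0 + ∫ x in Ioi 0, g x)) := by
    rw [hG.eq_add 0]
    have := intervalIntegral_tendsto_integral_Ioi 0 ig.integrableOn tendsto_id
    simpa using this.const_add (G 0)
  have : G 0 + ∫ x in Ioi 0, g x = 0 := by
    have h2 : IntegrableAtFilter G atTop := ⟨univ, univ_mem, iG.integrableOn⟩
    exact h2.eq_zero_of_tendsto (fun s hs => by
      obtain ⟨b, hb⟩ := mem_atTop_sets.1 hs
      have : volume (Ici b) = ⊤ := by simp
      exact top_le_iff.1 (this ▸ measure_mono hb)) h1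
  rwa [this] at h1

theorem tendsto_zero_atBot (hG : IsPrimitive G g) (iG : Integrable G) (ig : Integrable g) :
    Tendsto G atBot (𝓝 0) := by
  have h1 : Tendsto G atBot (𝓝 (G 0 - ∫ x in Iic 0, g x)) := by
    have := intervalIntegral_tendsto_integral_Iic 0 ig.integrableOn tendsto_id
    refine (this.const_sub (G 0)).congr fun x => ?_
    simp only [id]
    linarith [hG.sub_eq x 0]
  have : G 0 - ∫ x in Iic 0, g x = 0 := by
    have h2 : IntegrableAtFilter G atBot := ⟨univ, univ_mem, iG.integrableOn⟩
    exact h2.eq_zero_of_tendsto (fun s hs => by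
      obtain ⟨b, hb⟩ := mem_atBot_sets.1 hs
      have : volume (Iic b) = ⊤ := by simp
      exact top_le_iff.1 (this ▸ measure_mono hb)) h1
  rwa [this] at h1

theorem integral_eq_zero (hG : IsPrimitive G g) (iG : Integrable G) (ig : Integrable g) :
    ∫ x, g x = 0 := by
  have h := intervalIntegral_tendsto_integral ig tendsto_neg_atTop_atBot tendsto_id
  have h2 : Tendsto (fun x => G x - G (-x)) atTop (𝓝 (0 - 0)) :=
    (hG.tendsto_zero_atTop iG ig).sub
      ((hG.tendsto_zero_atBot iG ig).comp tendsto_neg_atTop_atBot)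
  rw [sub_zero] at h2
  refine tendsto_nhds_unique (h.congr fun x => ?_) h2
  simp [hG.sub_eq]

theorem eq_integral_Iic (hG : IsPrimitive G g) (iG : Integrable G) (ig : Integrable g) (x : ℝ) :
    G x = ∫ t in Iic x, g t := by
  have h := intervalIntegral_tendsto_integral_Iic x ig.integrableOn tendsto_id
  have h2 := (hG.tendsto_zero_atBot iG ig).const_sub (G x)
  rw [sub_zero] at h2
  refine tendsto_nhds_unique h2 (h.congr fun y => ?_)
  simp [hG.sub_eq]

theorem isWeakDeriv (hG : IsPrimitive G g) : IsWeakDeriv G g := by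
  refine ⟨hG.continuous.locallyIntegrable, hG.locInt, fun ψ hψ hc => ?_⟩
  have hd : Continuous (deriv ψ) := hψ.continuous_deriv (by simp)
  have hp := hG.mul (of_contDiff (hψ.of_le (by simp)))
  have i1 := hG.continuous.locallyIntegrable.integrable_smul_right_of_hasCompactSupport
    (μ := volume) hd hc.deriv
  have i2 := hG.locInt.integrable_smul_right_of_hasCompactSupport hψ.continuous hc
  have i3 := hG.continuous.locallyIntegrable.integrable_smul_right_of_hasCompactSupport
    (μ := volume) hψ.continuous hc
  simp only [smul_eq_mul] at i1 i2 i3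
  have := hp.integral_eq_zero i3 (i2.add i1)
  rw [integral_add i2 i1] at this
  linarith

end IsPrimitive

theorem IsWeakDeriv.exists_isPrimitive {g g' : ℝ → ℝ} (h : IsWeakDeriv g g') :
    ∃ G, IsPrimitive G g' ∧ g =ᵐ[volume] G := by
  have hP : IsPrimitive (fun x => ∫ t in (0 : ℝ)..x, g' t) g' := by
    refine ⟨h.locInt_deriv, fun a b => ?_⟩
    have hi : ∀ a b, IntervalIntegrable g' volume a b := fun a b =>
      (h.locInt_deriv.integrableOn_isCompact isCompact_uIcc).intervalIntegrable
    exact intervalIntegral.integral_interval_sub_left (hi 0 b) (hi 0 a)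
  have hc := ae_const_of_integral_deriv_smul_eq_zero isOpen_univ ordConnected_univ
    (g := fun x => g x - ∫ t in (0 : ℝ)..x, g' t)
    ((h.locInt.sub hP.continuous.locallyIntegrable).locallyIntegrableOn _) ?_
  · obtain ⟨C, hC⟩ := hc
    refine ⟨fun x => C + ∫ t in (0 : ℝ)..x, g' t, ⟨h.locInt_deriv, fun a b => ?_⟩, ?_⟩
    · rw [← hP.sub_eq a b]; ring
    · filter_upwards [hC] with x hx
      linarith [hx (mem_univ x)]
  · intro η hη hηc _
    have hd : Continuous (deriv η) := hη.continuous_deriv (by simp)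
    have i1 := h.locInt.integrable_smul_right_of_hasCompactSupport hd hηc.deriv
    have i2 := hP.continuous.locallyIntegrable.integrable_smul_right_of_hasCompactSupport
      (μ := volume) hd hηc.deriv
    simp only [smul_eq_mul] at i1 i2
    have e : ∀ x, deriv η x • (g x - ∫ t in (0 : ℝ)..x, g' t)
        = g x * deriv η x - (∫ t in (0 : ℝ)..x, g' t) * deriv η x := fun x => by
      rw [smul_eq_mul]; ring
    simp only [e]
    rw [integral_sub i1 i2, h.integral_eq η hη hηc, hP.isWeakDeriv.integral_eq η hη hηc, sub_self]

theorem IsWeakDeriv.ae_unique {g g' h' : ℝ → ℝ} (H : IsWeakDeriv g g') (H' : IsWeakDeriv g h') :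
    g' =ᵐ[volume] h' := by
  have := ae_eq_zero_of_integral_contDiff_smul_eq_zero (H.locInt_deriv.sub H'.locInt_deriv) ?_
  · filter_upwards [this] with x hx
    exact sub_eq_zero.1 hx
  · intro ψ hψ hc
    have i3 := H.locInt_deriv.integrable_smul_right_of_hasCompactSupport hψ.continuous hc
    have i4 := H'.locInt_deriv.integrable_smul_right_of_hasCompactSupport hψ.continuous hc
    simp only [smul_eq_mul] at i3 i4
    simp only [smul_eq_mul, Pi.sub_apply, mul_comm (ψ _), sub_mul]
    rw [integral_sub i3 i4]
    linarith [H.integral_eq ψ hψ hc, H'.integral_eq ψ hψ hc]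

/-! ### Weak derivatives of square integrable functions -/

/-- `w ∈ L²(ℝ)` is the weak derivative of `v ∈ L²(ℝ)`; this is the graph of the closed,
skew-adjoint operator `∂ₓ`. -/
abbrev HasDx (v w : L2) : Prop := IsWeakDeriv v w

theorem locallyIntegrable_coe (v : L2) : LocallyIntegrable v volume :=
  (Lp.memLp v).locallyIntegrable (by norm_num)

theorem integrable_mul_coe (v w : L2) : Integrable (fun x => v x * w x) :=
  (Lp.memLp v).integrable_mul (Lp.memLp w)

theorem inner_eq_integral (v w : L2) : inner ℝ v w = ∫ x, v x * w x := by
  rw [L2.inner_def]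
  exact integral_congr_ae (Eventually.of_forall fun x => by simp [mul_comm])

theorem integral_abs_mul_le (v w : L2) : ∫ x, |v x * w x| ≤ ‖v‖ * ‖w‖ := by
  have h : ∫ x, |v x * w x| = inner ℝ |v| |w| := by
    rw [inner_eq_integral]
    refine integral_congr_ae ?_
    filter_upwards [Lp.coeFn_abs v, Lp.coeFn_abs w] with x h1 h2
    rw [h1, h2, abs_mul]
  rw [h]
  refine (real_inner_le_norm _ _).trans ?_
  rw [norm_abs_eq_norm, norm_abs_eq_norm]

theorem inner_toLp {v : L2} {ψ : ℝ → ℝ} (h : MemLp ψ 2 volume) :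
    inner ℝ v (h.toLp ψ) = ∫ x, v x * ψ x := by
  rw [inner_eq_integral]
  refine integral_congr_ae ?_
  filter_upwards [h.coeFn_toLp] with x hx
  rw [hx]

theorem hasDx_iff {v w : L2} : HasDx v w ↔ ∀ (ψ : ℝ → ℝ) (hψ : ContDiff ℝ ∞ ψ)
    (hc : HasCompactSupport ψ),
    inner ℝ v (((hψ.continuous_deriv (by simp)).memLp_of_hasCompactSupport
      hc.deriv : MemLp (deriv ψ) 2 volume).toLp _) =
    -inner ℝ w ((hψ.continuous.memLp_of_hasCompactSupport hc : MemLp ψ 2 volume).toLp _) := by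
  constructor
  · intro h ψ hψ hc
    rw [inner_toLp, inner_toLp, h.integral_eq ψ hψ hc]
  · intro h
    refine ⟨locallyIntegrable_coe v, locallyIntegrable_coe w, fun ψ hψ hc => ?_⟩
    have := h ψ hψ hc
    rwa [inner_toLp, inner_toLp] at this

namespace HasDx

variable {v w v' w' : L2}

theorem zero : HasDx 0 0 := hasDx_iff.2 fun ψ hψ hc => by simp

theorem add (h : HasDx v v') (k : HasDx w w') : HasDx (v + w) (v' + w') :=
  hasDx_iff.2 fun ψ hψ hc => by
    rw [inner_add_left, inner_add_left, hasDx_iff.1 h ψ hψ hc, hasDx_iff.1 k ψ hψ hc]; ring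

theorem smul (c : ℝ) (h : HasDx v v') : HasDx (c • v) (c • v') :=
  hasDx_iff.2 fun ψ hψ hc => by
    rw [real_inner_smul_left, real_inner_smul_left, hasDx_iff.1 h ψ hψ hc]; ring

theorem sub (h : HasDx v v') (k : HasDx w w') : HasDx (v - w) (v' - w') :=
  hasDx_iff.2 fun ψ hψ hc => by
    rw [inner_sub_left, inner_sub_left, hasDx_iff.1 h ψ hψ hc, hasDx_iff.1 k ψ hψ hc]; ring

theorem unique (h : HasDx v v') (k : HasDx v w') : v' = w' := Lp.ext (h.ae_unique k)

theorem of_tendsto {ι : Type*} {l : Filter ι} [l.NeBot] {f g : ι → L2}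
    (hf : Tendsto f l (𝓝 v)) (hg : Tendsto g l (𝓝 w)) (h : ∀ i, HasDx (f i) (g i)) :
    HasDx v w :=
  hasDx_iff.2 fun ψ hψ hc =>
    tendsto_nhds_unique (hf.inner tendsto_const_nhds)
      (((hg.inner tendsto_const_nhds).neg).congr fun i => (hasDx_iff.1 (h i) ψ hψ hc).symm)

theorem exists_rep (h : HasDx v v') : ∃ V, IsPrimitive V v' ∧ v =ᵐ[volume] V :=
  h.exists_isPrimitive

/-- Integration by parts: `∂ₓ` is skew-symmetric. -/
theorem inner_eq_neg (h : HasDx v v') (k : HasDx w w') : inner ℝ v' w = -inner ℝ v w' := by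
  obtain ⟨V, hV, eV⟩ := h.exists_rep
  obtain ⟨U, hU, eU⟩ := k.exists_rep
  have e1 : (fun x => v' x * w x) =ᵐ[volume] fun x => v' x * U x := by
    filter_upwards [eU] with x hx; rw [hx]
  have e2 : (fun x => v x * w' x) =ᵐ[volume] fun x => V x * w' x := by
    filter_upwards [eV] with x hx; rw [hx]
  have e3 : (fun x => v x * w x) =ᵐ[volume] fun x => V x * U x := by
    filter_upwards [eU, eV] with x hx hy; rw [hx, hy]
  have i1 := (integrable_mul_coe v' w).congr e1
  have i2 := (integrable_mul_coe v w').congr e2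
  have i3 := (integrable_mul_coe v w).congr e3
  have := (hV.mul hU).integral_eq_zero i3 (i1.add i2)
  rw [integral_add i1 i2, ← integral_congr_ae e1, ← integral_congr_ae e2] at this
  rw [inner_eq_integral, inner_eq_integral]
  linarith

end HasDx

/-- The one-dimensional Sobolev inequality `sup |v|² ≤ 2 ‖v‖ ‖v'‖`. -/
theorem IsPrimitive.sq_le {V : ℝ → ℝ} {v v' : L2} (hV : IsPrimitive V v')
    (e : v =ᵐ[volume] V) (x : ℝ) : V x ^ 2 ≤ 2 * (‖v‖ * ‖v'‖) := by
  have e1 : (fun x => v' x * v x) =ᵐ[volume] fun x => v' x * V x := by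
    filter_upwards [e] with x hx; rw [hx]
  have e3 : (fun x => v x * v x) =ᵐ[volume] fun x => V x * V x := by
    filter_upwards [e] with x hx; rw [hx]
  have i1 := (integrable_mul_coe v' v).congr e1
  have i3 := (integrable_mul_coe v v).congr e3
  have i2 : Integrable fun x => V x * v' x := i1.congr (Eventually.of_forall fun x => mul_comm _ _)
  have h := (hV.mul hV).eq_integral_Iic i3 (i1.add i2) x
  have h2 : V x * V x ≤ ∫ t, 2 * |v' t * v t| := by
    rw [h]
    calc ∫ t in Iic x, v' t * V t + V t * v' t
        ≤ ∫ t in Iic x, |v' t * V t + V t * v' t| :=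
          (le_abs_self _).trans abs_integral_le_integral_abs
      _ ≤ ∫ t, |v' t * V t + V t * v' t| :=
          setIntegral_le_integral (i1.add i2).abs (Eventually.of_forall fun _ => abs_nonneg _)
      _ = ∫ t, 2 * |v' t * v t| := by
          refine integral_congr_ae ?_
          filter_upwards [e] with t ht
          rw [ht, mul_comm (V t), ← two_mul, abs_mul]; simp
  rw [integral_const_mul] at h2
  have h3 := integral_abs_mul_le v' v
  nlinarith

/-- `∫ h(φ) φₓ = 0`, as the integrand is the derivative of a function of `φ` that vanishes at
infinity. -/
theorem HasDx.integral_comp_mul_eq_zero {v v' : L2} (hv : HasDx v v') {h : ℝ → ℝ}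
    (hh : Continuous h) {C : ℝ} (hC : ∀ s, |h s| ≤ C * |s|) : ∫ x, h (v x) * v' x = 0 := by
  obtain ⟨V, hV, e⟩ := hv.exists_rep
  have hder : ∀ s, HasDerivAt (fun s => ∫ t in (0 : ℝ)..s, h t) (h s) s := fun s =>
    intervalIntegral.integral_hasDerivAt_right (hh.intervalIntegrable _ _)
      hh.aestronglyMeasurable.stronglyMeasurableAtFilter hh.continuousAt
  have hdd : deriv (fun s => ∫ t in (0 : ℝ)..s, h t) = h := funext fun s => (hder s).deriv
  have hcd : ContDiff ℝ 1 fun s => ∫ t in (0 : ℝ)..s, h t := by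
    rw [contDiff_one_iff_deriv, hdd]
    exact ⟨fun s => (hder s).differentiableAt, hh⟩
  have hC0 : 0 ≤ C := by simpa using (abs_nonneg _).trans (hC 1)
  have hbd : ∀ s, ‖∫ t in (0 : ℝ)..s, h t‖ ≤ C * (s * s) := fun s => by
    have := intervalIntegral.norm_integral_le_of_norm_le_const (a := 0) (b := s) (f := h)
      (C := C * |s|) (fun t ht => by
        refine (hC t).trans (mul_le_mul_of_nonneg_left ?_ hC0)
        have := abs_sub_left_of_mem_uIcc (uIoc_subset_uIcc ht)
        simpa using this)
    rw [sub_zero, mul_assoc, abs_mul_abs_self] at this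
    exact this
  have hP := hV.comp hcd
  rw [hdd] at hP
  have e3 : (fun x => v x * v x) =ᵐ[volume] fun x => V x * V x := by
    filter_upwards [e] with x hx; rw [hx]
  have e1 : (fun x => v x * v' x) =ᵐ[volume] fun x => V x * v' x := by
    filter_upwards [e] with x hx; rw [hx]
  have i3 := (integrable_mul_coe v v).congr e3
  have i1 := (integrable_mul_coe v v').congr e1
  have j1 : Integrable fun x => ∫ t in (0 : ℝ)..V x, h t :=
    (i3.const_mul C).mono' hP.continuous.aestronglyMeasurable
      (Eventually.of_forall fun x => hbd (V x))
  have j2 : Integrable fun x => h (V x) * v' x := by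
    refine (i1.norm.const_mul C).mono'
      ((hh.comp hV.continuous).aestronglyMeasurable.mul (Lp.aestronglyMeasurable v'))
      (Eventually.of_forall fun x => ?_)
    rw [norm_mul, norm_mul, ← mul_assoc]
    exact mul_le_mul_of_nonneg_right (hC _) (norm_nonneg _)
  rw [← hP.integral_eq_zero j1 j2]
  refine integral_congr_ae ?_
  filter_upwards [e] with x hx
  rw [hx]

/-! ### The Sobolev spaces as Hilbert spaces -/

theorem isClosed_sobolevH (k : ℕ) :
    IsClosed (SobolevH k : Set (PiLp 2 fun _ : Fin (k + 1) => L2)) := by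
  refine IsSeqClosed.isClosed fun f v hf hv j => ?_
  have h : ∀ i, Tendsto (fun n => f n i) atTop (𝓝 (v i)) := fun i =>
    ((PiLp.continuous_apply 2 _ i).tendsto v).comp hv
  exact HasDx.of_tendsto (h _) (h _) fun n => hf n j

instance (k : ℕ) : CompleteSpace (SobolevH k) := (isClosed_sobolevH k).completeSpace_coe

theorem dx_hasDx {k : ℕ} (v : SobolevH k) (j : Fin k) : HasDx (dx v j.castSucc) (dx v j.succ) :=
  v.2 j

/-- The map `v ↦ ∂ₓʲ v` from `H^k(ℝ)` to `L²(ℝ)` as a continuous linear map. -/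
noncomputable def dxL (k : ℕ) (j : Fin (k + 1)) : SobolevH k →L[ℝ] L2 :=
  (PiLp.proj 2 (fun _ : Fin (k + 1) => L2) j).comp (SobolevH k).subtypeL

@[simp] theorem dxL_apply {k : ℕ} (j : Fin (k + 1)) (v : SobolevH k) : dxL k j v = dx v j := rfl

theorem sobolev_norm_sq {k : ℕ} (v : SobolevH k) : ‖v‖ ^ 2 = ∑ j, ‖dx v j‖ ^ 2 :=
  PiLp.norm_sq_eq_of_L2 _ (v : PiLp 2 fun _ : Fin (k + 1) => L2)

/-- The element of `H^k(ℝ)` with given derivatives. -/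
noncomputable def mkSobolev {k : ℕ} (v : Fin (k + 1) → L2)
    (h : ∀ j : Fin k, HasDx (v j.castSucc) (v j.succ)) : SobolevH k :=
  ⟨WithLp.toLp 2 v, h⟩

@[simp] theorem dx_mkSobolev {k : ℕ} (v : Fin (k + 1) → L2)
    (h : ∀ j : Fin k, HasDx (v j.castSucc) (v j.succ)) (j : Fin (k + 1)) :
    dx (mkSobolev v h) j = v j := rfl

theorem tendsto_sobolev {k : ℕ} {ι : Type*} {l : Filter ι} {f : ι → SobolevH k} {v : SobolevH k}
    (h : ∀ j, Tendsto (fun i => dx (f i) j) l (𝓝 (dx v j))) : Tendsto f l (𝓝 v) := by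
  rw [tendsto_subtype_rng]
  have : Tendsto (fun i => WithLp.ofLp (f i : PiLp 2 fun _ : Fin (k + 1) => L2)) l
      (𝓝 (WithLp.ofLp (v : PiLp 2 fun _ : Fin (k + 1) => L2))) := tendsto_pi_nhds.2 h
  exact ((PiLp.continuous_toLp 2 _).tendsto _).comp this

/-! ### The resolvents `(1 - a ∂ₓ²)⁻¹` -/

/-- The variational solution of `z - a z'' = v`, by the Lax-Milgram theorem in `H¹(ℝ)`. -/
theorem exists_resolvent {a : ℝ} (ha : 0 < a) : ∃ K DK : L2 →L[ℝ] L2, ∀ v,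
    HasDx (K v) (DK v) ∧ HasDx (DK v) (a⁻¹ • (K v - v)) := by
  let e0 := dxL 1 0
  let e1 := dxL 1 1
  let B : SobolevH 1 →L[ℝ] SobolevH 1 →L[ℝ] ℝ :=
    LinearMap.mkContinuous₂ (LinearMap.mk₂ ℝ
      (fun v w => inner ℝ (e0 v) (e0 w) + a * inner ℝ (e1 v) (e1 w))
      (fun v v' w => by simp only [map_add, inner_add_left]; ring)
      (fun c v w => by simp only [map_smul, real_inner_smul_left, smul_eq_mul]; ring)
      (fun v w w' => by simp only [map_add, inner_add_right]; ring)
      (fun c v w => by simp only [map_smul, real_inner_smul_right, smul_eq_mul]; ring))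
      (‖e0‖ * ‖e0‖ + a * (‖e1‖ * ‖e1‖)) (fun v w => by
        simp only [LinearMap.mk₂_apply]
        have h : ∀ e : SobolevH 1 →L[ℝ] L2, ‖inner ℝ (e v) (e w)‖ ≤ ‖e‖ * ‖e‖ * (‖v‖ * ‖w‖) := by
          intro e
          calc ‖inner ℝ (e v) (e w)‖ ≤ ‖e v‖ * ‖e w‖ := norm_inner_le_norm _ _
            _ ≤ (‖e‖ * ‖v‖) * (‖e‖ * ‖w‖) :=
              mul_le_mul (e.le_opNorm v) (e.le_opNorm w) (norm_nonneg _) (by positivity)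
            _ = _ := by ring
        refine (norm_add_le _ _).trans ?_
        rw [norm_mul, Real.norm_of_nonneg ha.le]
        have h0 := h e0
        have h1 := mul_le_mul_of_nonneg_left (h e1) ha.le
        linarith)
  have hB : ∀ v w, B v w = inner ℝ (e0 v) (e0 w) + a * inner ℝ (e1 v) (e1 w) := fun v w => rfl
  have hco : IsCoercive B := by
    refine ⟨min 1 a, lt_min one_pos ha, fun v => ?_⟩
    rw [hB, real_inner_self_eq_norm_sq, real_inner_self_eq_norm_sq, mul_assoc, ← sq]
    have hn := sobolev_norm_sq v
    rw [Fin.sum_univ_two] at hn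
    simp only [e0, e1, dxL_apply]
    rw [hn]
    have h1 := min_le_left 1 a
    have h2 := min_le_right 1 a
    nlinarith [sq_nonneg ‖dx v 0‖, sq_nonneg ‖dx v 1‖]
  let T : L2 →L[ℝ] SobolevH 1 :=
    (hco.continuousLinearEquivOfBilin.symm : SobolevH 1 →L[ℝ] SobolevH 1).comp
      (ContinuousLinearMap.adjoint e0)
  have hT : ∀ v w, inner ℝ (e0 (T v)) (e0 w) + a * inner ℝ (e1 (T v)) (e1 w) =
      inner ℝ v (e0 w) := by
    intro v w
    rw [← hB, ← hco.continuousLinearEquivOfBilin_apply]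
    simp only [T, ContinuousLinearMap.comp_apply, ContinuousLinearEquiv.coe_coe,
      ContinuousLinearEquiv.apply_symm_apply]
    rw [ContinuousLinearMap.adjoint_inner_left]
  refine ⟨e0.comp T, e1.comp T, fun v => ⟨dx_hasDx (T v) 0, hasDx_iff.2 fun ψ hψ hc => ?_⟩⟩
  have m0 : MemLp ψ 2 volume := hψ.continuous.memLp_of_hasCompactSupport hc
  have m1 : MemLp (deriv ψ) 2 volume :=
    (hψ.continuous_deriv (by simp)).memLp_of_hasCompactSupport hc.deriv
  have hw : HasDx (m0.toLp ψ) (m1.toLp (deriv ψ)) :=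
    (IsPrimitive.of_contDiff (hψ.of_le (by simp))).isWeakDeriv.congr m0.coeFn_toLp.symm
      m1.coeFn_toLp.symm
  have := hT v (mkSobolev ![m0.toLp ψ, m1.toLp (deriv ψ)] (fun j => by
    fin_cases j; exact hw))
  simp only [e0, e1, dxL_apply, dx_mkSobolev, Matrix.cons_val_zero, Matrix.cons_val_one] at this
  simp only [ContinuousLinearMap.comp_apply, e0, e1, dxL_apply]
  rw [real_inner_smul_left, inner_sub_left]
  field_simp
  linarith

/-- The resolvent `K = (1 - a ∂ₓ²)⁻¹` together with `∂ₓ K`. -/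
noncomputable def resPair (a : ℝ) : (L2 →L[ℝ] L2) × (L2 →L[ℝ] L2) :=
  if h : 0 < a then ((exists_resolvent h).choose, (exists_resolvent h).choose_spec.choose) else 0

/-- The resolvent `(1 - a ∂ₓ²)⁻¹` on `L²(ℝ)`, for `a > 0`. -/
noncomputable def res (a : ℝ) : L2 →L[ℝ] L2 := (resPair a).1

/-- The bounded operator `∂ₓ (1 - a ∂ₓ²)⁻¹` on `L²(ℝ)`, for `a > 0`. -/
noncomputable def dres (a : ℝ) : L2 →L[ℝ] L2 := (resPair a).2

/-- The bounded operator `∂ₓ² (1 - a ∂ₓ²)⁻¹` on `L²(ℝ)`, for `a > 0`. -/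
noncomputable def ddres (a : ℝ) : L2 →L[ℝ] L2 := a⁻¹ • (res a - 1)

theorem ddres_apply (a : ℝ) (v : L2) : ddres a v = a⁻¹ • (res a v - v) := rfl

section
variable {a : ℝ}

theorem res_hasDx (ha : 0 < a) (v : L2) : HasDx (res a v) (dres a v) := by
  simp only [res, dres, resPair, ha, dite_true]
  exact ((exists_resolvent ha).choose_spec.choose_spec v).1

theorem dres_hasDx (ha : 0 < a) (v : L2) : HasDx (dres a v) (ddres a v) := by
  simp only [res, dres, ddres_apply, resPair, ha, dite_true]
  exact ((exists_resolvent ha).choose_spec.choose_spec v).2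

theorem smul_ddres (ha : 0 < a) (v : L2) : a • ddres a v = res a v - v := by
  rw [ddres_apply, smul_smul, mul_inv_cancel₀ ha.ne', one_smul]

/-- The equation `z - a z'' = v` has at most one solution. -/
theorem eq_res (ha : 0 < a) {v z z₁ z₂ : L2} (h1 : HasDx z z₁) (h2 : HasDx z₁ z₂)
    (h : z - a • z₂ = v) : z = res a v := by
  have k1 := HasDx.sub h1 (res_hasDx ha v)
  have k2 := HasDx.sub h2 (dres_hasDx ha v)
  have e : z - res a v = a • (z₂ - ddres a v) := by
    rw [smul_sub, smul_ddres ha, ← h]; abel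
  have h3 := HasDx.inner_eq_neg k2 k1
  have h4 : inner ℝ (z - res a v) (z - res a v) ≤ 0 := by
    nth_rewrite 1 [e]
    rw [real_inner_smul_left, h3, real_inner_self_eq_norm_sq]
    nlinarith [mul_nonneg ha.le (sq_nonneg ‖z₁ - dres a v‖)]
  rw [real_inner_self_eq_norm_sq] at h4
  exact sub_eq_zero.1 (norm_eq_zero.1 (pow_eq_zero_iff (by norm_num) |>.1
    (le_antisymm h4 (sq_nonneg _))))

theorem res_comm_hasDx (ha : 0 < a) {v w : L2} (h : HasDx v w) : dres a v = res a w := by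
  refine eq_res ha (dres_hasDx ha v) (((res_hasDx ha v).sub h).smul a⁻¹) ?_
  rw [smul_smul, mul_inv_cancel₀ ha.ne', one_smul]; abel

theorem HasDx.res (ha : 0 < a) {v w : L2} (h : HasDx v w) : HasDx (res a v) (res a w) := by
  rw [← res_comm_hasDx ha h]; exact res_hasDx ha v

theorem norm_sq_res (ha : 0 < a) (v : L2) :
    ‖res a v‖ ^ 2 + a * ‖dres a v‖ ^ 2 = inner ℝ v (res a v) := by
  have h3 := (dres_hasDx ha v).inner_eq_neg (res_hasDx ha v)
  have h4 : v = res a v - a • ddres a v := by rw [smul_ddres ha]; abel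
  nth_rewrite 3 [h4]
  rw [inner_sub_left, real_inner_smul_left, h3, real_inner_self_eq_norm_sq,
    real_inner_self_eq_norm_sq]
  ring

theorem norm_res_le (ha : 0 < a) (v : L2) : ‖res a v‖ ≤ ‖v‖ := by
  have h := norm_sq_res ha v
  have h2 := real_inner_le_norm v (res a v)
  have h3 := mul_nonneg ha.le (sq_nonneg ‖dres a v‖)
  by_contra! hlt
  have : 0 < ‖res a v‖ := (norm_nonneg v).trans_lt hlt
  nlinarith

theorem mul_norm_dres_sq_le (ha : 0 < a) (v : L2) : a * ‖dres a v‖ ^ 2 ≤ ‖v‖ ^ 2 := by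
  have h := norm_sq_res ha v
  have h2 := real_inner_le_norm v (res a v)
  nlinarith [norm_res_le ha v, norm_nonneg v, sq_nonneg ‖res a v‖]

theorem inner_ddres_nonpos (ha : 0 < a) (v : L2) : inner ℝ (ddres a v) v ≤ 0 := by
  rw [ddres_apply, real_inner_smul_left, inner_sub_left, real_inner_self_eq_norm_sq]
  have h2 := real_inner_le_norm (res a v) v
  have : inner ℝ (res a v) v - ‖v‖ ^ 2 ≤ 0 := by nlinarith [norm_res_le ha v, norm_nonneg v]
  exact mul_nonpos_of_nonneg_of_nonpos (inv_nonneg.2 ha.le) this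

theorem inner_second_nonpos {v w w' : L2} (h : HasDx v w) (h' : HasDx w w') :
    inner ℝ w' v ≤ 0 := by
  rw [h'.inner_eq_neg h, real_inner_self_eq_norm_sq]
  nlinarith [sq_nonneg ‖w‖]

theorem eq_zero_of_res_eq_zero (ha : 0 < a) {v : L2} (h : res a v = 0) : v = 0 := by
  have h1 := res_hasDx ha v
  rw [h] at h1
  have h2 := h1.unique HasDx.zero
  have h3 := dres_hasDx ha v
  rw [h2] at h3
  have h4 := h3.unique HasDx.zero
  have := smul_ddres ha v
  rw [h, h4, smul_zero, zero_sub, eq_comm, neg_eq_zero] at this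
  exact this

/-- The domain `H¹(ℝ)` of `∂ₓ` is dense: its orthogonal complement is trivial already for the
range of a resolvent. -/
theorem dense_range_res (ha : 0 < a) : DenseRange (res a) := by
  have h : (LinearMap.range (res a : L2 →ₗ[ℝ] L2)).topologicalClosure = ⊤ := by
    rw [Submodule.topologicalClosure_eq_top_iff, Submodule.eq_bot_iff]
    intro v hv
    have h1 := hv (res a v) ⟨v, rfl⟩
    have h2 := norm_sq_res ha v
    rw [real_inner_comm, h1] at h2
    have h3 := mul_nonneg ha.le (sq_nonneg ‖dres a v‖)
    have h4 : ‖res a v‖ ^ 2 = 0 := le_antisymm (by linarith) (sq_nonneg _)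
    exact eq_zero_of_res_eq_zero ha (norm_eq_zero.1 (pow_eq_zero_iff (by norm_num) |>.1 h4))
  intro v
  have : v ∈ (LinearMap.range (res a : L2 →ₗ[ℝ] L2)).topologicalClosure := h ▸ Submodule.mem_top
  exact this

theorem norm_sub_res_sq_le (ha : 0 < a) {v w : L2} (h : HasDx v w) :
    ‖v - res a v‖ ^ 2 ≤ a * ‖w‖ ^ 2 := by
  have h1 : HasDx (res a v) (res a w) := h.res ha
  have h2 : dres a v = res a w := res_comm_hasDx ha h
  have h3 : v - res a v = -(a • ddres a v) := by rw [smul_ddres ha]; abel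
  have h4 : dres a w = ddres a v := by
    have := dres_hasDx ha v
    rw [h2] at this
    exact (res_hasDx ha w).unique this
  rw [h3, norm_neg, norm_smul, mul_pow, Real.norm_of_nonneg ha.le, ← h4]
  have := mul_norm_dres_sq_le ha w
  nlinarith

end

/-- The parameters `1 / (n + 1)` used for regularization. -/
noncomputable def epsSeq (n : ℕ) : ℝ := 1 / ((n : ℝ) + 1)

theorem epsSeq_pos (n : ℕ) : 0 < epsSeq n := by unfold epsSeq; positivity

theorem tendsto_epsSeq : Tendsto epsSeq atTop (𝓝 0) := tendsto_one_div_add_atTop_nhds_zero_nat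

theorem tendsto_res (v : L2) : Tendsto (fun n => res (epsSeq n) v) atTop (𝓝 v) := by
  have key : ∀ z : L2, Tendsto (fun n => ‖res 1 z - res (epsSeq n) (res 1 z)‖) atTop (𝓝 0) := by
    intro z
    have h1 : Tendsto (fun n => √(epsSeq n * ‖dres 1 z‖ ^ 2)) atTop (𝓝 0) := by
      have := (tendsto_epsSeq.mul_const (‖dres 1 z‖ ^ 2)).sqrt
      simpa using this
    refine squeeze_zero (fun _ => norm_nonneg _) (fun n => ?_) h1
    exact Real.le_sqrt_of_sq_le (norm_sub_res_sq_le (epsSeq_pos n) (res_hasDx one_pos z))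
  rw [Metric.tendsto_atTop]
  intro ε hε
  obtain ⟨z, hz⟩ := (dense_range_res one_pos).exists_dist_lt v (show 0 < ε / 3 by positivity)
  obtain ⟨N, hN⟩ := Metric.tendsto_atTop.1 (key z) (ε / 3) (by positivity)
  refine ⟨N, fun n hn => ?_⟩
  have h1 := hN n hn
  rw [Real.dist_0_eq_abs, abs_of_nonneg (norm_nonneg _)] at h1
  rw [dist_eq_norm] at hz ⊢
  have h2 := norm_res_le (epsSeq_pos n) (v - res 1 z)
  have e : res (epsSeq n) v - v = res (epsSeq n) (v - res 1 z)
      - (res 1 z - res (epsSeq n) (res 1 z)) - (v - res 1 z) := by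
    rw [map_sub]; abel
  rw [e]
  have h3 := norm_sub_le (res (epsSeq n) (v - res 1 z)
      - (res 1 z - res (epsSeq n) (res 1 z))) (v - res 1 z)
  have h4 := norm_sub_le (res (epsSeq n) (v - res 1 z)) (res 1 z - res (epsSeq n) (res 1 z))
  linarith

/-- Convergence of contractions that tend strongly to the identity, along a convergent sequence. -/
theorem tendsto_res_comp {f : ℕ → L2} {v : L2} (hf : Tendsto f atTop (𝓝 v)) :
    Tendsto (fun n => res (epsSeq n) (f n)) atTop (𝓝 v) := by
  have h1 : Tendsto (fun n => res (epsSeq n) (f n - v)) atTop (𝓝 0) := by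
    refine squeeze_zero_norm (fun n => norm_res_le (epsSeq_pos n) _) ?_
    simpa using (tendsto_sub_nhds_zero_iff.2 hf).norm
  have := h1.add (tendsto_res v)
  simpa using this

/-- A bounded family of derivatives of functions converging in `L²` forces the limit to be in
`H¹`, by weak compactness of balls. -/
theorem exists_hasDx_of_frequently_le {f g : ℕ → L2} {v : L2} (hf : Tendsto f atTop (𝓝 v))
    (h : ∀ n, HasDx (f n) (g n)) {C : ℝ} (hC : ∃ᶠ n in atTop, ‖g n‖ ≤ C) : ∃ w, HasDx v w := by
  have hne : (atTop ⊓ 𝓟 {n | ‖g n‖ ≤ C}).NeBot := by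
    rw [← frequently_mem_iff_neBot]; exact hC
  let U : Ultrafilter ℕ := @Ultrafilter.of _ _ hne
  have hU : (U : Filter ℕ) ≤ atTop ⊓ 𝓟 {n | ‖g n‖ ≤ C} := @Ultrafilter.of_le _ _ hne
  have hU1 : (U : Filter ℕ) ≤ atTop := hU.trans inf_le_left
  have hU2 : ∀ᶠ n in (U : Filter ℕ), ‖g n‖ ≤ C :=
    le_principal_iff.1 (hU.trans inf_le_right)
  have hK := WeakDual.isCompact_closedBall (𝕜 := ℝ) (E := L2) 0 C
  let T : ℕ → WeakDual ℝ L2 := fun n => StrongDual.toWeakDual (InnerProductSpace.toDual ℝ L2 (g n))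
  have hmem : ∀ᶠ n in (U : Filter ℕ),
      T n ∈ WeakDual.toStrongDual ⁻¹' Metric.closedBall (0 : StrongDual ℝ L2) C := by
    filter_upwards [hU2] with n hn
    simp only [T, mem_preimage, mem_closedBall_zero_iff]
    show ‖InnerProductSpace.toDual ℝ L2 (g n)‖ ≤ C
    rwa [LinearIsometryEquiv.norm_map]
  obtain ⟨ℓ, -, hℓ⟩ := hK.ultrafilter_le_nhds (U.map T) (le_principal_iff.2 hmem)
  have hT : Tendsto T U (𝓝 ℓ) := hℓ
  refine ⟨(InnerProductSpace.toDual ℝ L2).symm (WeakDual.toStrongDual ℓ),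
    hasDx_iff.2 fun ψ hψ hc => ?_⟩
  rw [InnerProductSpace.toDual_symm_apply]
  have h1 := ((WeakDual.eval_continuous ((hψ.continuous.memLp_of_hasCompactSupport hc :
    MemLp ψ 2 volume).toLp _)).tendsto ℓ).comp hT
  refine tendsto_nhds_unique ((hf.mono_left hU1).inner tendsto_const_nhds)
    (h1.neg.congr fun n => ?_)
  rw [hasDx_iff.1 (h n) ψ hψ hc]
  rfl

/-! ### Smoothing operators -/

/-- A family `X₀, …, X₆` of bounded operators such that `X₀` commutes with `∂ₓ`, maps into `H⁶(ℝ)`,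
and `X_j = ∂ₓʲ X₀`. Such families form a vector space; in particular differences of two of them
are again of this kind. -/
structure IsSmoothing (X : ℕ → L2 →L[ℝ] L2) : Prop where
  hasDx : ∀ j < 6, ∀ v, HasDx (X j v) (X (j + 1) v)
  comm : ∀ v w, HasDx v w → HasDx (X 0 v) (X 0 w)

namespace IsSmoothing

variable {X Y : ℕ → L2 →L[ℝ] L2}

theorem sub (hX : IsSmoothing X) (hY : IsSmoothing Y) : IsSmoothing fun j => X j - Y j :=
  ⟨fun j hj v => (hX.hasDx j hj v).sub (hY.hasDx j hj v),
    fun v w h => (hX.comm v w h).sub (hY.comm v w h)⟩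

theorem apply_dx (hX : IsSmoothing X) {v w : L2} (h : HasDx v w) {j : ℕ} (hj : j < 6) :
    X j w = X (j + 1) v := by
  induction j with
  | zero => exact (hX.comm v w h).unique (hX.hasDx 0 hj v)
  | succ j ih =>
    have h1 := hX.hasDx j (by omega) w
    rw [ih (by omega)] at h1
    exact h1.unique (hX.hasDx (j + 1) hj v)

theorem apply_dres (hX : IsSmoothing X) {a : ℝ} (ha : 0 < a) (v : L2) {j : ℕ} (hj : j < 6) :
    X j (dres a v) = X (j + 1) (res a v) := hX.apply_dx (res_hasDx ha v) hj

theorem apply_ddres (hX : IsSmoothing X) {a : ℝ} (ha : 0 < a) (v : L2) {j : ℕ} (hj : j < 5) :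
    X j (ddres a v) = X (j + 2) (res a v) := by
  rw [hX.apply_dx (dres_hasDx ha v) (by omega), hX.apply_dres ha v (by omega)]

/-- On the range of `X` the operator `1 - a ∂ₓ²` is bounded, and inverts the resolvent. -/
theorem apply_res_sub (hX : IsSmoothing X) {a : ℝ} (ha : 0 < a) (v : L2) {j : ℕ} (hj : j < 5) :
    X j (res a v) - a • X (j + 2) (res a v) = X j v := by
  rw [← hX.apply_ddres ha v hj, ← map_smul, ← map_sub, smul_ddres ha, sub_sub_cancel]

end IsSmoothing

theorem res_ddres (a : ℝ) (v : L2) : res a (ddres a v) = ddres a (res a v) := by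
  simp only [ddres_apply, map_smul, map_sub]

/-- The cube of the resolvent `(1 - a ∂ₓ²)⁻¹`, composed with the derivatives `∂ₓʲ`, `j ≤ 6`. -/
noncomputable def smoother (a : ℝ) : ℕ → L2 →L[ℝ] L2
  | 0 => res a * res a * res a
  | 1 => dres a * res a * res a
  | 2 => ddres a * res a * res a
  | 3 => dres a * ddres a * res a
  | 4 => ddres a * ddres a * res a
  | 5 => dres a * ddres a * ddres a
  | _ => ddres a * ddres a * ddres a

theorem isSmoothing_smoother {a : ℝ} (ha : 0 < a) : IsSmoothing (smoother a) where
  hasDx := by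
    intro j hj v
    interval_cases j
    · exact res_hasDx ha (res a (res a v))
    · exact dres_hasDx ha (res a (res a v))
    · have := res_hasDx ha (ddres a (res a v))
      rw [res_ddres] at this
      exact this
    · exact dres_hasDx ha (ddres a (res a v))
    · have := res_hasDx ha (ddres a (ddres a v))
      rw [res_ddres, res_ddres] at this
      exact this
    · exact dres_hasDx ha (ddres a (ddres a v))
  comm := fun v w h => ((h.res ha).res ha).res ha

/-- The approximate identity used for regularization, with its derivatives. -/
noncomputable def smo (n : ℕ) : ℕ → L2 →L[ℝ] L2 := smoother (epsSeq n)

theorem isSmoothing_smo (n : ℕ) : IsSmoothing (smo n) := isSmoothing_smoother (epsSeq_pos n)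

theorem norm_smo_le (n : ℕ) (v : L2) : ‖smo n 0 v‖ ≤ ‖v‖ :=
  (norm_res_le (epsSeq_pos n) _).trans
    ((norm_res_le (epsSeq_pos n) _).trans (norm_res_le (epsSeq_pos n) _))

theorem tendsto_smo (v : L2) : Tendsto (fun n => smo n 0 v) atTop (𝓝 v) :=
  tendsto_res_comp (tendsto_res_comp (tendsto_res v))

/-! ### The evolution equation in integrated form and its energy identities -/

/-- The right-hand side of the equation
`∂ₜ Kφ = κ ∂ₓ²Kφ + (β - κ) K∂ₓ²Kφ - K∂ₓK G`, where `K = (1 - α ∂ₓ²)⁻¹` and `κ = γ / α`. -/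
noncomputable def evolRate (α β γ : ℝ) (φ G : L2) : L2 :=
  (γ / α) • ddres α φ + (β - γ / α) • res α (ddres α φ) - res α (dres α G)

/-- `φ` solves `(1 - α ∂ₓ²) ∂ₜφ = β ∂ₓ²φ - γ ∂ₓ⁴φ - ∂ₓG` on `[0, T]`, after application of
`(1 - α ∂ₓ²)⁻²`, which makes all terms continuous with values in `L²(ℝ)`, and integration in
time. -/
structure IsEvolution (α β γ T : ℝ) (φ G : ℝ → L2) : Prop where
  continuous_fst : Continuous φ
  continuous_snd : Continuous G
  eq_integral : ∀ t ∈ Icc 0 T,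
    res α (φ t) = res α (φ 0) + ∫ s in (0 : ℝ)..t, evolRate α β γ (φ s) (G s)

namespace IsEvolution

variable {α β γ T : ℝ} {φ G ψ H : ℝ → L2}

theorem continuous_rate (h : IsEvolution α β γ T φ G) :
    Continuous fun s => evolRate α β γ (φ s) (G s) := by
  have h1 := h.continuous_fst
  have h2 := h.continuous_snd
  unfold evolRate
  fun_prop

theorem sub (h : IsEvolution α β γ T φ G) (k : IsEvolution α β γ T ψ H) :
    IsEvolution α β γ T (fun t => φ t - ψ t) (fun t => G t - H t) := by
  refine ⟨h.continuous_fst.sub k.continuous_fst, h.continuous_snd.sub k.continuous_snd, ?_⟩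
  intro t ht
  have e : ∀ s, evolRate α β γ (φ s - ψ s) (G s - H s) =
      evolRate α β γ (φ s) (G s) - evolRate α β γ (ψ s) (H s) := fun s => by
    simp only [evolRate, map_sub, smul_sub]; abel
  simp only [e]
  rw [intervalIntegral.integral_sub (h.continuous_rate.intervalIntegrable _ _)
    (k.continuous_rate.intervalIntegrable _ _), map_sub, map_sub, h.eq_integral t ht,
    k.eq_integral t ht]
  abel

variable {X : ℕ → L2 →L[ℝ] L2}

theorem hasDerivAt (hα : 0 < α) (h : IsEvolution α β γ T φ G) (hX : IsSmoothing X) {j : ℕ}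
    (hj : j < 5) {t : ℝ} (ht : t ∈ Ioo 0 T) :
    HasDerivAt (fun s => X j (φ s)) (X j (evolRate α β γ (φ t) (G t))
      - α • X (j + 2) (evolRate α β γ (φ t) (G t))) t := by
  have h1 : HasDerivAt (fun t => res α (φ 0) + ∫ s in (0 : ℝ)..t, evolRate α β γ (φ s) (G s))
      (evolRate α β γ (φ t) (G t)) t :=
    (intervalIntegral.integral_hasDerivAt_right (h.continuous_rate.intervalIntegrable _ _)
      h.continuous_rate.aestronglyMeasurable.stronglyMeasurableAtFilter
      h.continuous_rate.continuousAt).const_add _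
  have h2 : HasDerivAt (fun t => res α (φ t)) (evolRate α β γ (φ t) (G t)) t := by
    refine h1.congr_of_eventuallyEq ?_
    filter_upwards [Ioo_mem_nhds ht.1 ht.2] with s hs
    exact h.eq_integral s (Ioo_subset_Icc_self hs)
  have h3 := (X j - α • X (j + 2)).hasFDerivAt.comp_hasDerivAt t h2
  refine h3.congr_of_eventuallyEq (Eventually.of_forall fun s => ?_)
  exact (hX.apply_res_sub hα (φ s) hj).symm

/-- Applied to the smoothed rate, the operator `(1 - α ∂ₓ²)²` undoes the resolvents in it and gives
back the right-hand side `β ∂ₓ²φ - γ ∂ₓ⁴φ - ∂ₓG` of the original equation. -/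
theorem smoothing_rate (hα : 0 < α) (hX : IsSmoothing X) {k : ℕ} (hk : k < 3) (v g : L2) :
    (X k (evolRate α β γ v g) - α • X (k + 2) (evolRate α β γ v g))
      - α • (X (k + 2) (evolRate α β γ v g) - α • X (k + 2 + 2) (evolRate α β γ v g))
      = β • X (k + 2) v - γ • X (k + 4) v - X (k + 1) g := by
  -- the second-order operator `(1 - α ∂ₓ²)²` applied to each of the three terms of the rate
  have a1 : ∀ w : L2, (X k (ddres α w) - α • X (k + 2) (ddres α w))
      - α • (X (k + 2) (ddres α w) - α • X (k + 2 + 2) (ddres α w))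
      = X (k + 2) w - α • X (k + 4) w := by
    intro w
    have s1 : ∀ j < 3, X j (ddres α w) - α • X (j + 2) (ddres α w) = X (j + 2) w := by
      intro j hj
      rw [hX.apply_ddres hα w (by omega), hX.apply_ddres hα w (by omega),
        hX.apply_res_sub hα w (by omega)]
    have s2 : X (k + 2) (ddres α w) - α • X (k + 2 + 2) (ddres α w) = X (k + 4) w := by
      have e : ddres α w = α⁻¹ • (res α w - w) := rfl
      have : X (k + 2) (ddres α w) - α • X (k + 2 + 2) (ddres α w)
          = α⁻¹ • ((X (k + 2) (res α w) - α • X (k + 2 + 2) (res α w))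
            - (X (k + 2) w - α • X (k + 2 + 2) w)) := by
        rw [e]; simp only [map_smul, map_sub]; module
      rw [this, hX.apply_res_sub hα w (by omega), sub_sub_cancel, smul_smul,
        inv_mul_cancel₀ hα.ne', one_smul]
    rw [s1 k hk, s2]
  have a2 : ∀ w : L2, (X k (res α w) - α • X (k + 2) (res α w))
      - α • (X (k + 2) (res α w) - α • X (k + 2 + 2) (res α w)) = X k w - α • X (k + 2) w := by
    intro w
    rw [hX.apply_res_sub hα w (by omega), hX.apply_res_sub hα w (by omega)]
  have a3 : X k (ddres α v) - α • X (k + 2) (ddres α v) = X (k + 2) v := by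
    rw [hX.apply_ddres hα v (by omega), hX.apply_ddres hα v (by omega),
      hX.apply_res_sub hα v (by omega)]
  have a4 : X k (dres α g) - α • X (k + 2) (dres α g) = X (k + 1) g := by
    rw [hX.apply_dres hα g (by omega), hX.apply_dres hα g (by omega),
      hX.apply_res_sub hα g (by omega)]
  have e : (X k (evolRate α β γ v g) - α • X (k + 2) (evolRate α β γ v g))
      - α • (X (k + 2) (evolRate α β γ v g) - α • X (k + 2 + 2) (evolRate α β γ v g))
      = (γ / α) • ((X k (ddres α v) - α • X (k + 2) (ddres α v))
          - α • (X (k + 2) (ddres α v) - α • X (k + 2 + 2) (ddres α v)))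
        + (β - γ / α) • ((X k (res α (ddres α v)) - α • X (k + 2) (res α (ddres α v)))
          - α • (X (k + 2) (res α (ddres α v)) - α • X (k + 2 + 2) (res α (ddres α v))))
        - ((X k (res α (dres α g)) - α • X (k + 2) (res α (dres α g)))
          - α • (X (k + 2) (res α (dres α g)) - α • X (k + 2 + 2) (res α (dres α g)))) := by
    simp only [evolRate, map_sub, map_add, map_smul]; module
  rw [e, a1, a2, a2, a3, a4]
  have : γ • X (k + 4) v = (γ / α) • α • X (k + 4) v := by
    rw [smul_smul, div_mul_cancel₀ _ hα.ne']
  rw [this]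
  module

/-- The energy identity at the level of `∂ₓᵏ`, `k ≤ 2`, for the smoothed solution. -/
theorem energy_identity (hα : 0 < α) (h : IsEvolution α β γ T φ G) (hX : IsSmoothing X) {k : ℕ}
    (hk : k < 3) {t : ℝ} (ht : t ∈ Icc 0 T) :
    ‖X k (φ t)‖ ^ 2 + α * ‖X (k + 1) (φ t)‖ ^ 2 =
      ‖X k (φ 0)‖ ^ 2 + α * ‖X (k + 1) (φ 0)‖ ^ 2 -
      2 * ∫ s in (0 : ℝ)..t, (β * ‖X (k + 1) (φ s)‖ ^ 2 + γ * ‖X (k + 2) (φ s)‖ ^ 2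
        + inner ℝ (X (k + 1) (G s)) (X k (φ s))) := by
  have c1 := h.continuous_fst
  have c2 := h.continuous_snd
  have hder : ∀ s ∈ Ioo 0 t, HasDerivAt
      (fun s => ‖X k (φ s)‖ ^ 2 + α * ‖X (k + 1) (φ s)‖ ^ 2)
      (-2 * (β * ‖X (k + 1) (φ s)‖ ^ 2 + γ * ‖X (k + 2) (φ s)‖ ^ 2
        + inner ℝ (X (k + 1) (G s)) (X k (φ s)))) s := by
    intro s hs
    have hs' : s ∈ Ioo 0 T := ⟨hs.1, hs.2.trans_le ht.2⟩
    have d0 := (h.hasDerivAt hα hX (j := k) (by omega) hs').norm_sq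
    have d1 := ((h.hasDerivAt hα hX (j := k + 1) (by omega) hs').norm_sq).const_mul α
    refine (d0.add d1).congr_deriv ?_
    set N := evolRate α β γ (φ s) (G s) with hN
    have q1 : HasDx (X (k + 1) N - α • X (k + 1 + 2) N) (X (k + 2) N - α • X (k + 2 + 2) N) :=
      (hX.hasDx (k + 1) (by omega) N).sub ((hX.hasDx (k + 1 + 2) (by omega) N).smul α)
    have p0 := hX.hasDx k (by omega) (φ s)
    have p1 : HasDx (X (k + 1) (φ s)) (X (k + 2) (φ s)) := hX.hasDx (k + 1) (by omega) (φ s)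
    have p2 : HasDx (X (k + 2) (φ s)) (X (k + 3) (φ s)) := hX.hasDx (k + 2) (by omega) (φ s)
    have p3 : HasDx (X (k + 3) (φ s)) (X (k + 4) (φ s)) := hX.hasDx (k + 3) (by omega) (φ s)
    have i1 := q1.inner_eq_neg p0
    have i2 := p1.inner_eq_neg p0
    have i3 := p3.inner_eq_neg p0
    have i4 := p2.inner_eq_neg p1
    have key := congrArg (fun z => inner ℝ z (X k (φ s)))
      (smoothing_rate (β := β) (γ := γ) hα hX hk (φ s) (G s))
    simp only [← hN] at key
    rw [inner_sub_left (X k N - α • X (k + 2) N), real_inner_smul_left, i1,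
      inner_sub_left (_ - _) (X (k + 1) (G s)), inner_sub_left (β • _),
      real_inner_smul_left, real_inner_smul_left, i2, i3, i4, real_inner_self_eq_norm_sq,
      real_inner_self_eq_norm_sq] at key
    rw [real_inner_comm, real_inner_comm (X (k + 1) N - α • X (k + 1 + 2) N)]
    linarith
  have hcont : ∀ j, Continuous fun s => X j (φ s) := fun j => (X j).continuous.comp c1
  have hcont' : ∀ j, Continuous fun s => X j (G s) := fun j => (X j).continuous.comp c2
  have hc : Continuous fun s => β * ‖X (k + 1) (φ s)‖ ^ 2 + γ * ‖X (k + 2) (φ s)‖ ^ 2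
        + inner ℝ (X (k + 1) (G s)) (X k (φ s)) := by
    have := (hcont' (k + 1)).inner (𝕜 := ℝ) (hcont k)
    have := hcont (k + 1)
    have := hcont (k + 2)
    fun_prop
  have hc2 : Continuous fun s => ‖X k (φ s)‖ ^ 2 + α * ‖X (k + 1) (φ s)‖ ^ 2 := by
    have := hcont k
    have := hcont (k + 1)
    fun_prop
  have := intervalIntegral.integral_eq_sub_of_hasDerivAt_of_le ht.1 hc2.continuousOn hder
    ((hc.const_mul _).intervalIntegrable _ _)
  rw [intervalIntegral.integral_const_mul] at this
  linarith

end IsEvolution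

/-! ### Ordinary differential equations in Banach spaces -/

/-- The contraction estimate behind the weighted norm `sup exp(-l|t|) ‖φ(t)‖`. -/
theorem exp_mul_norm_integral_le {E : Type*} [NormedAddCommGroup E] [NormedSpace ℝ E]
    {g : ℝ → E} {M l : ℝ} (hM : 0 ≤ M) (hl : 0 < l) (hb : ∀ s, ‖g s‖ ≤ M * Real.exp (l * |s|))
    (t : ℝ) : Real.exp (-(l * |t|)) * ‖∫ s in (0 : ℝ)..t, g s‖ ≤ M / l := by
  have key : ∀ (g : ℝ → E), (∀ s, ‖g s‖ ≤ M * Real.exp (l * |s|)) → ∀ t, 0 ≤ t →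
      Real.exp (-(l * t)) * ‖∫ s in (0 : ℝ)..t, g s‖ ≤ M / l := by
    intro g hb t ht
    have h1 : ‖∫ s in (0 : ℝ)..t, g s‖ ≤ ∫ s in (0 : ℝ)..t, M * Real.exp (l * s) := by
      refine intervalIntegral.norm_integral_le_of_norm_le ht ?_
        (Continuous.intervalIntegrable (by fun_prop) _ _)
      refine Eventually.of_forall fun s hs => ?_
      simpa [abs_of_pos hs.1] using hb s
    have h2 : ∫ s in (0 : ℝ)..t, M * Real.exp (l * s) = M / l * Real.exp (l * t) - M / l := by
      have hd : ∀ s : ℝ,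
          HasDerivAt (fun s => M / l * Real.exp (l * s)) (M * Real.exp (l * s)) s := by
        intro s
        have := (((hasDerivAt_id s).const_mul l).exp).const_mul (M / l)
        refine this.congr_deriv ?_
        simp only [id]
        field_simp
      rw [intervalIntegral.integral_eq_sub_of_hasDerivAt (fun s _ => hd s)
        (Continuous.intervalIntegrable (by fun_prop) _ _)]
      simp
    rw [h2] at h1
    have h3 : Real.exp (-(l * t)) * Real.exp (l * t) = 1 := by rw [← Real.exp_add]; simp
    have h4 := Real.exp_pos (-(l * t))
    have h5 : 0 ≤ M / l := by positivity
    calc Real.exp (-(l * t)) * ‖∫ s in (0 : ℝ)..t, g s‖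
        ≤ Real.exp (-(l * t)) * (M / l * Real.exp (l * t) - M / l) :=
          mul_le_mul_of_nonneg_left h1 h4.le
      _ = M / l * (Real.exp (-(l * t)) * Real.exp (l * t)) - Real.exp (-(l * t)) * (M / l) := by
          ring
      _ ≤ M / l := by rw [h3]; nlinarith
  rcases le_total 0 t with ht | ht
  · rw [abs_of_nonneg ht]; exact key g hb t ht
  · have h := key (fun s => g (-s)) (fun s => by simpa using hb (-s)) (-t) (by linarith)
    rw [intervalIntegral.integral_comp_neg, neg_neg, neg_zero,
      intervalIntegral.integral_symm, norm_neg] at h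
    rwa [abs_of_nonpos ht]

/-- An autonomous differential equation with globally Lipschitz right-hand side in a Banach space
has a global solution: the Picard map is a contraction for an exponentially weighted norm. -/
theorem exists_global_ode {E : Type*} [NormedAddCommGroup E] [NormedSpace ℝ E] [CompleteSpace E]
    {V : E → E} {C : NNReal} (hV : LipschitzWith C V) (x₀ : E) :
    ∃ φ : ℝ → E, φ 0 = x₀ ∧ ∀ t, HasDerivAt φ (V (φ t)) t := by
  set l : ℝ := 2 * C + 1 with hl
  have hl0 : 0 < l := by positivity
  have hcont : ∀ y : BoundedContinuousFunction ℝ E,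
      Continuous fun s => V (Real.exp (l * |s|) • y s) := fun y =>
    hV.continuous.comp (((Real.continuous_exp.comp (by fun_prop))).smul y.continuous)
  have hgrow : ∀ (y : BoundedContinuousFunction ℝ E) (s : ℝ),
      ‖V (Real.exp (l * |s|) • y s)‖ ≤ (‖V 0‖ + C * ‖y‖) * Real.exp (l * |s|) := by
    intro y s
    have h1 : ‖V (Real.exp (l * |s|) • y s) - V 0‖ ≤ C * (Real.exp (l * |s|) * ‖y‖) := by
      refine (hV.norm_sub_le _ _).trans ?_
      rw [sub_zero, norm_smul, Real.norm_of_nonneg (Real.exp_pos _).le]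
      gcongr
      exact y.norm_coe_le_norm s
    have h2 : 1 ≤ Real.exp (l * |s|) := Real.one_le_exp (by positivity)
    have h3 := norm_le_norm_add_norm_sub' (V (Real.exp (l * |s|) • y s)) (V 0)
    have h4 := norm_nonneg (V 0)
    nlinarith
  let P : BoundedContinuousFunction ℝ E → BoundedContinuousFunction ℝ E := fun y =>
    BoundedContinuousFunction.ofNormedAddCommGroup
      (fun t => Real.exp (-(l * |t|)) • (x₀ + ∫ s in (0 : ℝ)..t, V (Real.exp (l * |s|) • y s)))
      ((Real.continuous_exp.comp (by fun_prop)).smul (continuous_const.add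
        (intervalIntegral.continuous_primitive
          (fun a b => (hcont y).intervalIntegrable a b) 0)))
      (‖x₀‖ + (‖V 0‖ + C * ‖y‖) / l) (fun t => by
        rw [norm_smul, Real.norm_of_nonneg (Real.exp_pos _).le]
        have h1 := exp_mul_norm_integral_le (by positivity) hl0 (hgrow y) t
        have h2 : Real.exp (-(l * |t|)) ≤ 1 := Real.exp_le_one_iff.2 (by
          have : 0 ≤ l * |t| := by positivity
          linarith)
        have h3 := norm_add_le x₀ (∫ s in (0 : ℝ)..t, V (Real.exp (l * |s|) • y s))
        have h4 := mul_le_mul_of_nonneg_left h3 (Real.exp_pos (-(l * |t|))).le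
        nlinarith [norm_nonneg x₀])
  have hP : ∀ y t, P y t =
      Real.exp (-(l * |t|)) • (x₀ + ∫ s in (0 : ℝ)..t, V (Real.exp (l * |s|) • y s)) :=
    fun y t => rfl
  have hcontr : ContractingWith (1 / 2) P := by
    refine ⟨by rw [← NNReal.coe_lt_coe]; norm_num, LipschitzWith.of_dist_le_mul fun y z => ?_⟩
    rw [dist_eq_norm, dist_eq_norm]
    refine (BoundedContinuousFunction.norm_le (by positivity)).2 fun t => ?_
    have e : (P y - P z) t = Real.exp (-(l * |t|)) • ∫ s in (0 : ℝ)..t,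
        (V (Real.exp (l * |s|) • y s) - V (Real.exp (l * |s|) • z s)) := by
      rw [BoundedContinuousFunction.sub_apply, hP, hP, ← smul_sub,
        intervalIntegral.integral_sub ((hcont y).intervalIntegrable _ _)
        ((hcont z).intervalIntegrable _ _)]
      congr 1
      abel
    rw [e, norm_smul, Real.norm_of_nonneg (Real.exp_pos _).le]
    refine (exp_mul_norm_integral_le (M := C * ‖y - z‖) (by positivity) hl0
      (fun s => ?_) t).trans ?_
    · refine (hV.norm_sub_le _ _).trans ?_
      rw [← smul_sub, norm_smul, Real.norm_of_nonneg (Real.exp_pos _).le]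
      have : ‖y s - z s‖ ≤ ‖y - z‖ := (y - z).norm_coe_le_norm s
      have h5 := mul_le_mul_of_nonneg_left this (Real.exp_pos (l * |s|)).le
      have h6 := mul_le_mul_of_nonneg_left h5 C.coe_nonneg
      linarith
    · rw [div_le_iff₀ hl0]
      have := norm_nonneg (y - z)
      push_cast
      rw [hl]
      nlinarith
  set y := hcontr.fixedPoint P with hy
  have hfix : ∀ t, y t =
      Real.exp (-(l * |t|)) • (x₀ + ∫ s in (0 : ℝ)..t, V (Real.exp (l * |s|) • y s)) := fun t => by
    rw [← hP, hy, (hcontr.fixedPoint_isFixedPt).eq]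
  have hφ : ∀ t, Real.exp (l * |t|) • y t =
      x₀ + ∫ s in (0 : ℝ)..t, V (Real.exp (l * |s|) • y s) := fun t => by
    rw [hfix t, smul_smul, ← Real.exp_add, add_neg_cancel, Real.exp_zero, one_smul]
  refine ⟨fun t => Real.exp (l * |t|) • y t, by simpa using hφ 0, fun t => ?_⟩
  have h1 := (intervalIntegral.integral_hasDerivAt_right ((hcont y).intervalIntegrable 0 t)
      (hcont y).aestronglyMeasurable.stronglyMeasurableAtFilter
      (hcont y).continuousAt).const_add x₀
  exact h1.congr_of_eventuallyEq (Eventually.of_forall hφ)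

/-- A form of Gronwall's inequality. -/
theorem le_exp_mul_of_deriv_le {e e' : ℝ → ℝ} {a d T : ℝ} (ha : 0 ≤ a) (hd : 0 ≤ d)
    (he : ∀ t, HasDerivAt e (e' t) t) (h : ∀ t ∈ Icc 0 T, e' t ≤ a * e t + d) {t : ℝ}
    (ht : t ∈ Icc 0 T) : e t ≤ Real.exp (a * t) * (e 0 + d * t) := by
  have hder : ∀ s, HasDerivAt (fun s => Real.exp (-(a * s)) * e s - d * s)
      (Real.exp (-(a * s)) * (e' s - a * e s) - d) s := by
    intro s
    have h1 : HasDerivAt (fun s => Real.exp (-(a * s))) (Real.exp (-(a * s)) * (-a)) s := by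
      have := ((hasDerivAt_id s).const_mul a).neg.exp
      simpa using this
    have h2 := (h1.mul (he s)).sub ((hasDerivAt_id s).const_mul d)
    refine h2.congr_deriv ?_
    ring
  have hanti : AntitoneOn (fun s => Real.exp (-(a * s)) * e s - d * s) (Icc 0 T) := by
    refine antitoneOn_of_deriv_nonpos (convex_Icc _ _)
      (fun s _ => (hder s).continuousAt.continuousWithinAt)
      (fun s _ => (hder s).differentiableAt.differentiableWithinAt) fun s hs => ?_
    rw [interior_Icc] at hs
    rw [(hder s).deriv]
    have h1 := h s (Ioo_subset_Icc_self hs)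
    have h2 : Real.exp (-(a * s)) ≤ 1 := Real.exp_le_one_iff.2 (by nlinarith [hs.1])
    have h3 := Real.exp_pos (-(a * s))
    nlinarith
  have h0 := hanti ⟨le_rfl, ht.1.trans ht.2⟩ ht ht.1
  simp only [mul_zero, neg_zero, Real.exp_zero, one_mul, sub_zero] at h0
  have h3 : Real.exp (a * t) * Real.exp (-(a * t)) = 1 := by rw [← Real.exp_add]; simp
  calc e t = Real.exp (a * t) * (Real.exp (-(a * t)) * e t) := by rw [← mul_assoc, h3, one_mul]
    _ ≤ _ := mul_le_mul_of_nonneg_left (by linarith) (Real.exp_pos _).le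

/-- A sequence of continuous functions of time, uniformly Cauchy on bounded intervals of positive
times, has a continuous limit. -/
theorem exists_continuous_limit {E : Type*} [NormedAddCommGroup E] [CompleteSpace E]
    {f : ℕ → ℝ → E} (hf : ∀ n, Continuous (f n))
    (h : ∀ T : ℝ, ∃ b : ℕ → ℝ, Tendsto b atTop (𝓝 0) ∧
      ∀ n m, ∀ t ∈ Icc 0 T, ‖f n t - f m t‖ ^ 2 ≤ b n + b m) :
    ∃ ψ : ℝ → E, Continuous ψ ∧ ∀ t, 0 ≤ t → Tendsto (fun n => f n t) atTop (𝓝 (ψ t)) := by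
  have hU : ∀ T, 0 ≤ T → UniformCauchySeqOn (fun n t => f n (max t 0)) atTop (Iic T) := by
    intro T hT
    rw [Metric.uniformCauchySeqOn_iff]
    intro ε hε
    obtain ⟨b, hb, hle⟩ := h T
    obtain ⟨N, hN⟩ := Metric.tendsto_atTop.1 hb (ε ^ 2 / 2) (by positivity)
    refine ⟨N, fun m hm n hn t ht => ?_⟩
    have h1 := hN m hm
    have h2 := hN n hn
    rw [Real.dist_0_eq_abs] at h1 h2
    have h3 := hle m n (max t 0) ⟨le_max_right _ _, max_le ht hT⟩
    rw [dist_eq_norm]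
    refine lt_of_pow_lt_pow_left₀ 2 hε.le ?_
    linarith [le_abs_self (b m), le_abs_self (b n)]
  have hlim : ∀ t, ∃ x, Tendsto (fun n => f n (max t 0)) atTop (𝓝 x) := fun t =>
    cauchySeq_tendsto_of_complete ((hU (max t 0) (le_max_right _ _)).cauchySeq (le_max_left t 0))
  choose ψ hψ using hlim
  refine ⟨ψ, ?_, fun t ht => by simpa [max_eq_left ht] using hψ t⟩
  rw [continuous_iff_continuousAt]
  intro t
  have h1 : TendstoUniformlyOn (fun n t => f n (max t 0)) ψ atTop (Iic (max t 0 + 1)) :=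
    (hU _ (by positivity)).tendstoUniformlyOn_of_tendsto fun s _ => hψ s
  have h2 := h1.continuousOn (Frequently.of_forall fun n =>
    ((hf n).comp (continuous_id.max continuous_const)).continuousOn)
  exact h2.continuousAt (Iic_mem_nhds (by linarith [le_max_left t 0]))

/-! ### Semilinear evolution equations by Yosida approximation -/

theorem res_ddres_comm {a b : ℝ} (ha : 0 < a) (hb : 0 < b) (v : L2) :
    res a (ddres b v) = ddres a (res b v) := by
  have h1 := (res_hasDx hb v).res ha
  have h2 := (dres_hasDx hb v).res ha
  rw [h1.unique (res_hasDx ha (res b v))] at h2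
  exact h2.unique (dres_hasDx ha (res b v))

/-- The basic inequality for Yosida approximations `∂ₓ² (1 - a ∂ₓ²)⁻¹` of the dissipative operator
`∂ₓ²`. -/
theorem inner_ddres_sub_le {a b : ℝ} (ha : 0 < a) (hb : 0 < b) {M : ℝ} {x y : L2}
    (hx : ‖ddres a x‖ ≤ M) (hy : ‖ddres b y‖ ≤ M) :
    inner ℝ (ddres a x - ddres b y) (x - y) ≤ 2 * M ^ 2 * (a + b) := by
  have e : x - y = (res a x - res b y) - (a • ddres a x - b • ddres b y) := by
    rw [smul_ddres ha, smul_ddres hb]; abel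
  have h1 : inner ℝ (ddres a x - ddres b y) (res a x - res b y) ≤ 0 :=
    inner_second_nonpos ((res_hasDx ha x).sub (res_hasDx hb y))
      ((dres_hasDx ha x).sub (dres_hasDx hb y))
  have hM : 0 ≤ M := (norm_nonneg _).trans hx
  have h2 : ‖ddres a x - ddres b y‖ ≤ 2 * M := (norm_sub_le _ _).trans (by linarith)
  have h3 : ‖a • ddres a x - b • ddres b y‖ ≤ (a + b) * M := by
    refine (norm_sub_le _ _).trans ?_
    rw [norm_smul, norm_smul, Real.norm_of_nonneg ha.le, Real.norm_of_nonneg hb.le]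
    nlinarith
  have h4 := (abs_le.1 (abs_real_inner_le_norm (ddres a x - ddres b y)
    (a • ddres a x - b • ddres b y))).1
  have h5 : ‖ddres a x - ddres b y‖ * ‖a • ddres a x - b • ddres b y‖ ≤ 2 * M * ((a + b) * M) :=
    mul_le_mul h2 h3 (norm_nonneg _) (by positivity)
  rw [e, inner_sub_right]
  nlinarith

theorem inner_lipschitz_le {F : L2 → L2} {C : NNReal} (hF : LipschitzWith C F) (x y : L2) :
    inner ℝ (F x - F y) (x - y) ≤ C * ‖x - y‖ ^ 2 := by
  refine (real_inner_le_norm _ _).trans ?_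
  have := hF.norm_sub_le x y
  nlinarith [norm_nonneg (x - y)]

/-- Along the flow of a one-sided Lipschitz vector field the speed grows at most exponentially. -/
theorem norm_speed_le {V : L2 → L2} {c : ℝ} (hc : 0 ≤ c)
    (hV : ∀ x y, inner ℝ (V x - V y) (x - y) ≤ c * ‖x - y‖ ^ 2) {φ : ℝ → L2}
    (hφ : ∀ t, HasDerivAt φ (V (φ t)) t) {t : ℝ} (ht : 0 ≤ t) :
    ‖V (φ t)‖ ≤ Real.exp (c * t) * ‖V (φ 0)‖ := by
  have key : ∀ h : ℝ, ‖φ (t + h) - φ t‖ ≤ Real.exp (c * t) * ‖φ (0 + h) - φ 0‖ := by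
    intro h
    have hd : ∀ s, HasDerivAt (fun s => ‖φ (s + h) - φ s‖ ^ 2)
        (2 * inner ℝ (φ (s + h) - φ s) (V (φ (s + h)) - V (φ s))) s := fun s =>
      (((hφ (s + h)).comp_add_const s h).sub (hφ s)).norm_sq
    have h1 := le_exp_mul_of_deriv_le (a := 2 * c) (d := 0) (T := t) (by positivity) le_rfl hd
      (fun s _ => by
        have := hV (φ (s + h)) (φ s)
        rw [real_inner_comm] at this
        linarith) ⟨ht, le_rfl⟩
    refine le_of_sq_le_sq ?_ (by positivity)
    rw [mul_pow, ← Real.exp_nat_mul]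
    refine h1.trans (le_of_eq ?_)
    push_cast
    ring_nf
  have l1 : Tendsto (fun h => ‖h⁻¹ • (φ (t + h) - φ t)‖) (𝓝[>] 0) (𝓝 ‖V (φ t)‖) :=
    (hφ t).tendsto_slope_zero_right.norm
  have l2 : Tendsto (fun h => Real.exp (c * t) * ‖h⁻¹ • (φ (0 + h) - φ 0)‖) (𝓝[>] 0)
      (𝓝 (Real.exp (c * t) * ‖V (φ 0)‖)) :=
    ((hφ 0).tendsto_slope_zero_right.norm).const_mul _
  refine le_of_tendsto_of_tendsto l1 l2 (Eventually.of_forall fun h => ?_)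
  simp only [norm_smul]
  have := mul_le_mul_of_nonneg_left (key h) (norm_nonneg h⁻¹)
  linarith

/-- The equation `∂ₜφ = κ ∂ₓ²φ + F(φ)` with Lipschitz `F` has a global solution for initial values
in `H²(ℝ)`; the equation holds in integrated form after application of `(1 - α ∂ₓ²)⁻¹`. -/
theorem exists_semilinear {α κ : ℝ} (hα : 0 < α) (hκ : 0 < κ) {F : L2 → L2} {C : NNReal}
    (hF : LipschitzWith C F) {v₀ v₁ v₂ : L2} (h01 : HasDx v₀ v₁) (h12 : HasDx v₁ v₂) :
    ∃ φ : ℝ → L2, Continuous φ ∧ φ 0 = v₀ ∧ ∀ t, 0 ≤ t → res α (φ t) = res α v₀ +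
      ∫ s in (0 : ℝ)..t, (κ • ddres α (φ s) + res α (F (φ s))) := by
  let V : ℕ → L2 → L2 := fun n x => κ • ddres (epsSeq n) x + F x
  have hVL : ∀ n, LipschitzWith (‖κ • ddres (epsSeq n)‖₊ + C) (V n) := fun n =>
    (κ • ddres (epsSeq n)).lipschitz.add hF
  choose φ hφ0 hφ using fun n => exists_global_ode (hVL n) v₀
  have hφc : ∀ n, Continuous (φ n) := fun n =>
    continuous_iff_continuousAt.2 fun t => (hφ n t).continuousAt
  have hone : ∀ n x y, inner ℝ (V n x - V n y) (x - y) ≤ C * ‖x - y‖ ^ 2 := by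
    intro n x y
    have e : V n x - V n y = κ • ddres (epsSeq n) (x - y) + (F x - F y) := by
      simp only [V, map_sub, smul_sub]; abel
    rw [e, inner_add_left, real_inner_smul_left]
    have h1 := inner_ddres_nonpos (epsSeq_pos n) (x - y)
    have h2 := inner_lipschitz_le hF x y
    nlinarith
  set M₀ : ℝ := κ * ‖v₂‖ + ‖F v₀‖ with hM₀
  have hM₀0 : 0 ≤ M₀ := by positivity
  -- the initial speed is bounded independently of `n` because the initial value is in `H²(ℝ)`
  have hV0 : ∀ n, ‖V n v₀‖ ≤ M₀ := by
    intro n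
    have e : ddres (epsSeq n) v₀ = res (epsSeq n) v₂ := by
      have h1 := res_comm_hasDx (epsSeq_pos n) h01
      have h2 := dres_hasDx (epsSeq_pos n) v₀
      rw [h1] at h2
      exact h2.unique (h12.res (epsSeq_pos n))
    refine (norm_add_le _ _).trans ?_
    rw [e, norm_smul, Real.norm_of_nonneg hκ.le]
    have := mul_le_mul_of_nonneg_left (norm_res_le (epsSeq_pos n) v₂) hκ.le
    linarith
  have hspeed : ∀ n T t, t ∈ Icc 0 T → ‖V n (φ n t)‖ ≤ Real.exp (C * T) * M₀ := by
    intro n T t ht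
    refine (norm_speed_le C.coe_nonneg (hone n) (hφ n) ht.1).trans ?_
    rw [hφ0]
    refine mul_le_mul ?_ (hV0 n) (norm_nonneg _) (Real.exp_pos _).le
    exact Real.exp_le_exp.2 (mul_le_mul_of_nonneg_left ht.2 C.coe_nonneg)
  have hdist : ∀ n T t, t ∈ Icc 0 T → ‖φ n t - v₀‖ ≤ Real.exp (C * T) * M₀ * T := by
    intro n T t ht
    have h1 := norm_image_sub_le_of_norm_deriv_le_segment' (a := 0) (b := t)
      (fun s _ => (hφ n s).hasDerivWithinAt) (fun s hs => hspeed n T s ⟨hs.1, hs.2.le.trans ht.2⟩)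
      t ⟨ht.1, le_rfl⟩
    rw [hφ0, sub_zero] at h1
    exact h1.trans (mul_le_mul_of_nonneg_left ht.2 (by positivity))
  let B : ℝ → ℝ := fun T => (Real.exp (C * T) * M₀ + (‖F v₀‖ + C * (Real.exp (C * T) * M₀ * T))) / κ
  have hB : ∀ n T t, t ∈ Icc 0 T → ‖ddres (epsSeq n) (φ n t)‖ ≤ B T := by
    intro n T t ht
    have h1 := hspeed n T t ht
    have h2 : ‖F (φ n t)‖ ≤ ‖F v₀‖ + C * (Real.exp (C * T) * M₀ * T) := by
      have h3 := norm_le_norm_add_norm_sub' (F (φ n t)) (F v₀)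
      have h4 := hF.norm_sub_le (φ n t) v₀
      have h5 := mul_le_mul_of_nonneg_left (hdist n T t ht) C.coe_nonneg
      linarith
    have h3 : κ • ddres (epsSeq n) (φ n t) = V n (φ n t) - F (φ n t) := by simp [V]
    have h4 : κ * ‖ddres (epsSeq n) (φ n t)‖ ≤ ‖V n (φ n t)‖ + ‖F (φ n t)‖ := by
      rw [← Real.norm_of_nonneg hκ.le, ← norm_smul, h3]
      exact norm_sub_le _ _
    rw [le_div_iff₀ hκ]
    linarith
  -- with the bound on `∂ₓ² (1 - εₙ ∂ₓ²)⁻¹ φₙ`, Gronwall's inequality shows that the approximations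
  -- form a Cauchy sequence
  obtain ⟨ψ, hψc, hψ⟩ := exists_continuous_limit hφc fun T => by
    refine ⟨fun n => Real.exp (2 * C * T) * (4 * κ * B T ^ 2 * epsSeq n * |T|), ?_, ?_⟩
    · have := ((tendsto_epsSeq.const_mul (4 * κ * B T ^ 2)).mul_const |T|).const_mul
        (Real.exp (2 * C * T))
      simpa using this
    intro n m t ht
    have hd : ∀ s, HasDerivAt (fun s => ‖φ n s - φ m s‖ ^ 2)
        (2 * inner ℝ (φ n s - φ m s) (V n (φ n s) - V m (φ m s))) s := fun s =>
      ((hφ n s).sub (hφ m s)).norm_sq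
    have he := epsSeq_pos n
    have he' := epsSeq_pos m
    have h1 := le_exp_mul_of_deriv_le (a := 2 * C)
      (d := 4 * κ * B T ^ 2 * (epsSeq n + epsSeq m)) (T := T) (by positivity) (by positivity) hd
      (fun s hs => by
        have e : V n (φ n s) - V m (φ m s) =
            κ • (ddres (epsSeq n) (φ n s) - ddres (epsSeq m) (φ m s))
              + (F (φ n s) - F (φ m s)) := by
          simp only [V, smul_sub]; abel
        have h2 := inner_ddres_sub_le (epsSeq_pos n) (epsSeq_pos m) (hB n T s hs) (hB m T s hs)
        have h3 := inner_lipschitz_le hF (φ n s) (φ m s)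
        rw [real_inner_comm, e, inner_add_left, real_inner_smul_left]
        have h4 := mul_le_mul_of_nonneg_left h2 hκ.le
        linarith) ht
    simp only [hφ0, sub_self, norm_zero] at h1
    rw [← mul_add]
    refine h1.trans ?_
    have hT : 0 ≤ T := ht.1.trans ht.2
    rw [abs_of_nonneg hT]
    refine mul_le_mul (Real.exp_le_exp.2 (mul_le_mul_of_nonneg_left ht.2 (by positivity))) ?_ ?_
      (Real.exp_pos _).le
    · have h5 : 0 ≤ 4 * κ * B T ^ 2 * (epsSeq n + epsSeq m) := by positivity
      have h6 := mul_le_mul_of_nonneg_left ht.2 h5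
      linarith
    · have := ht.1
      positivity
  have hψ0 : ψ 0 = v₀ := by
    refine tendsto_nhds_unique (hψ 0 le_rfl) ?_
    simp only [hφ0]
    exact tendsto_const_nhds
  refine ⟨ψ, hψc, hψ0, fun t ht => ?_⟩
  have hVc : ∀ n, Continuous fun s => V n (φ n s) := fun n => (hVL n).continuous.comp (hφc n)
  have hid : ∀ n, res α (φ n t) = res α v₀ + ∫ s in (0 : ℝ)..t, res α (V n (φ n s)) := by
    intro n
    rw [ContinuousLinearMap.intervalIntegral_comp_comm _ ((hVc n).intervalIntegrable _ _),
      intervalIntegral.integral_eq_sub_of_hasDerivAt (fun s _ => hφ n s)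
        ((hVc n).intervalIntegrable _ _), hφ0, map_sub]
    abel
  have hlim : Tendsto (fun n => ∫ s in (0 : ℝ)..t, res α (V n (φ n s))) atTop
      (𝓝 (∫ s in (0 : ℝ)..t, (κ • ddres α (ψ s) + res α (F (ψ s))))) := by
    refine intervalIntegral.tendsto_integral_filter_of_dominated_convergence
      (fun _ => Real.exp (C * t) * M₀) (Eventually.of_forall fun n =>
        ((res α).continuous.comp (hVc n)).aestronglyMeasurable)
      (Eventually.of_forall fun n => Eventually.of_forall fun s hs => ?_)
      intervalIntegrable_const (Eventually.of_forall fun s hs => ?_)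
    · rw [uIoc_of_le ht] at hs
      exact (norm_res_le hα _).trans (hspeed n t s ⟨hs.1.le, hs.2⟩)
    · rw [uIoc_of_le ht] at hs
      have h1 := hψ s hs.1.le
      have e : ∀ n, res α (V n (φ n s)) =
          κ • ddres α (res (epsSeq n) (φ n s)) + res α (F (φ n s)) := fun n => by
        simp only [V, map_add, map_smul, res_ddres_comm hα (epsSeq_pos n)]
      simp only [e]
      exact ((((ddres α).continuous.tendsto _).comp (tendsto_res_comp h1)).const_smul κ).add
        ((((res α).continuous.comp hF.continuous).tendsto _).comp h1)
  refine tendsto_nhds_unique (((res α).continuous.tendsto _).comp (hψ t ht)) ?_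
  simp only [Function.comp_def, hid]
  exact hlim.const_add _

/-! ### Regularity of solutions by energy estimates -/

theorem intervalIntegrable_of_bounded {f : ℝ → ℝ} {B T t : ℝ} (hf : StronglyMeasurable f)
    (hB : ∀ s ∈ Icc 0 T, ‖f s‖ ≤ B) (ht : t ∈ Icc 0 T) : IntervalIntegrable f volume 0 t := by
  refine (intervalIntegrable_const (c := B)).mono_fun' hf.aestronglyMeasurable ?_
  rw [EventuallyLE, ae_restrict_iff' measurableSet_uIoc]
  refine Eventually.of_forall fun s hs => ?_
  rw [uIoc_of_le ht.1] at hs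
  exact hB s ⟨hs.1.le, hs.2.trans ht.2⟩

theorem intervalIntegrable_norm_sq {S : ℝ → L2} {B T t : ℝ} (hS : StronglyMeasurable S)
    (hB : ∀ s ∈ Icc 0 T, ‖S s‖ ≤ B) (ht : t ∈ Icc 0 T) :
    IntervalIntegrable (fun s => ‖S s‖ ^ 2) volume 0 t :=
  intervalIntegrable_of_bounded (T := T) (B := B ^ 2) (hS.norm.pow 2) (fun s hs => by
    rw [norm_pow, norm_norm]
    exact pow_le_pow_left₀ (norm_nonneg _) (hB s hs) 2) ht

theorem tendsto_integral_smo_sub {S : ℝ → L2} {B T : ℝ} (hS : StronglyMeasurable S)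
    (hB : ∀ s ∈ Icc 0 T, ‖S s‖ ≤ B) (hT : 0 ≤ T) :
    Tendsto (fun n => ∫ s in (0 : ℝ)..T, ‖smo n 0 (S s) - S s‖ ^ 2) atTop (𝓝 0) := by
  have : Tendsto (fun n => ∫ s in (0 : ℝ)..T, ‖smo n 0 (S s) - S s‖ ^ 2) atTop
      (𝓝 (∫ s in (0 : ℝ)..T, 0)) := by
    refine intervalIntegral.tendsto_integral_filter_of_dominated_convergence
      (fun _ => (2 * B) ^ 2) (Eventually.of_forall fun n => ?_)
      (Eventually.of_forall fun n => Eventually.of_forall fun s hs => ?_)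
      intervalIntegrable_const (Eventually.of_forall fun s _ => ?_)
    · exact ((((smo n 0).continuous.comp_stronglyMeasurable hS).sub hS).norm.pow 2
        |>.aestronglyMeasurable)
    · rw [uIoc_of_le hT] at hs
      have h1 := hB s ⟨hs.1.le, hs.2⟩
      rw [norm_pow, norm_norm]
      refine pow_le_pow_left₀ (norm_nonneg _) ((norm_sub_le _ _).trans ?_) 2
      linarith [norm_smo_le n (S s)]
    · have := (tendsto_sub_nhds_zero_iff.2 (tendsto_smo (S s))).norm.pow 2
      simpa using this
  simpa using this

theorem norm_sub_sq_le {E : Type*} [SeminormedAddCommGroup E] (x y z : E) :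
    ‖x - y‖ ^ 2 ≤ 2 * ‖x - z‖ ^ 2 + 2 * ‖y - z‖ ^ 2 := by
  have h1 : ‖x - y‖ ≤ ‖x - z‖ + ‖y - z‖ := by
    have := norm_sub_le (x - z) (y - z)
    rwa [sub_sub_sub_cancel_right] at this
  nlinarith [norm_nonneg (x - y), sq_nonneg (‖x - z‖ - ‖y - z‖)]

namespace IsEvolution

variable {α β γ T : ℝ} {φ G : ℝ → L2} {X : ℕ → L2 →L[ℝ] L2}

theorem inner_source (hX : IsSmoothing X) (g v : L2) {k : ℕ} (hk : k < 6) :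
    inner ℝ (X (k + 1) g) (X k v) = -inner ℝ (X k g) (X (k + 1) v) :=
  (hX.hasDx k hk g).inner_eq_neg (hX.hasDx k hk v)

/-- Energy inequality in the case where the source term is controlled by the dissipation and by a
function `S`. -/
theorem energy_le (hα : 0 < α) (h : IsEvolution α β γ T φ G) (hX : IsSmoothing X) {k : ℕ}
    (hk : k < 3) {c B : ℝ} {S : ℝ → L2} (hS : StronglyMeasurable S)
    (hB : ∀ s ∈ Icc 0 T, ‖S s‖ ≤ B)
    (H : ∀ s, -inner ℝ (X (k + 1) (G s)) (X k (φ s)) ≤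
      β * ‖X (k + 1) (φ s)‖ ^ 2 + γ * ‖X (k + 2) (φ s)‖ ^ 2 + c * ‖X 0 (S s)‖ ^ 2)
    {t : ℝ} (ht : t ∈ Icc 0 T) :
    ‖X k (φ t)‖ ^ 2 + α * ‖X (k + 1) (φ t)‖ ^ 2 ≤
      ‖X k (φ 0)‖ ^ 2 + α * ‖X (k + 1) (φ 0)‖ ^ 2 +
        2 * (c * ∫ s in (0 : ℝ)..t, ‖X 0 (S s)‖ ^ 2) := by
  rw [h.energy_identity hα hX hk ht]
  have c1 := h.continuous_fst
  have c2 := h.continuous_snd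
  have hcont : ∀ j, Continuous fun s => X j (φ s) := fun j =>
    (X j).continuous.comp h.continuous_fst
  have hcont' : ∀ j, Continuous fun s => X j (G s) := fun j =>
    (X j).continuous.comp h.continuous_snd
  have hc : Continuous fun s => β * ‖X (k + 1) (φ s)‖ ^ 2 + γ * ‖X (k + 2) (φ s)‖ ^ 2
        + inner ℝ (X (k + 1) (G s)) (X k (φ s)) := by
    have := (hcont' (k + 1)).inner (𝕜 := ℝ) (hcont k)
    have := hcont (k + 1)
    have := hcont (k + 2)
    fun_prop
  have hi : IntervalIntegrable (fun s => ‖X 0 (S s)‖ ^ 2) volume 0 t :=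
    intervalIntegrable_norm_sq ((X 0).continuous.comp_stronglyMeasurable hS)
      (fun s hs => ((X 0).le_opNorm _).trans
        (mul_le_mul_of_nonneg_left (hB s hs) (norm_nonneg _))) ht
  have h1 : ∫ s in (0 : ℝ)..t, -(c * ‖X 0 (S s)‖ ^ 2) ≤
      ∫ s in (0 : ℝ)..t, (β * ‖X (k + 1) (φ s)‖ ^ 2 + γ * ‖X (k + 2) (φ s)‖ ^ 2
        + inner ℝ (X (k + 1) (G s)) (X k (φ s))) :=
    intervalIntegral.integral_mono_on ht.1 (hi.const_mul c).neg (hc.intervalIntegrable _ _)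
      fun s _ => by linarith [H s]
  rw [intervalIntegral.integral_neg, intervalIntegral.integral_const_mul] at h1
  linarith

/-- If the source is controlled, the smoothed functions `∂ₓᵏφ` and `∂ₓᵏ⁺¹φ` converge uniformly on
bounded time intervals, as the energy estimate applies to differences of smoothings. -/
theorem exists_tendsto_smo (hα : 0 < α) (h : ∀ T, IsEvolution α β γ T φ G) {k : ℕ} (hk : k < 3)
    {c : ℝ} (hc : 0 ≤ c) {S : ℝ → L2} (hS : StronglyMeasurable S)
    (hB : ∀ T, ∃ B, ∀ s ∈ Icc 0 T, ‖S s‖ ≤ B)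
    (H : ∀ X, IsSmoothing X → ∀ s, -inner ℝ (X (k + 1) (G s)) (X k (φ s)) ≤
      β * ‖X (k + 1) (φ s)‖ ^ 2 + γ * ‖X (k + 2) (φ s)‖ ^ 2 + c * ‖X 0 (S s)‖ ^ 2)
    {v w : L2} (hv : ∀ X, IsSmoothing X → X k (φ 0) = X 0 v)
    (hw : ∀ X, IsSmoothing X → X (k + 1) (φ 0) = X 0 w) :
    ∃ ψ χ : ℝ → L2, Continuous ψ ∧ Continuous χ ∧ ∀ t, 0 ≤ t →
      Tendsto (fun n => smo n k (φ t)) atTop (𝓝 (ψ t)) ∧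
      Tendsto (fun n => smo n (k + 1) (φ t)) atTop (𝓝 (χ t)) := by
  have hφ := (h 0).continuous_fst
  have key : ∀ T : ℝ, ∃ b : ℕ → ℝ, Tendsto b atTop (𝓝 0) ∧ ∀ n m, ∀ t ∈ Icc 0 T,
      ‖smo n k (φ t) - smo m k (φ t)‖ ^ 2 + α * ‖smo n (k + 1) (φ t) - smo m (k + 1) (φ t)‖ ^ 2
        ≤ b n + b m := by
    intro T
    by_cases hT : 0 ≤ T
    swap
    · exact ⟨fun _ => 0, tendsto_const_nhds, fun n m t ht => absurd (ht.1.trans ht.2) hT⟩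
    obtain ⟨B, hB⟩ := hB T
    refine ⟨fun n => 2 * ‖smo n 0 v - v‖ ^ 2 + α * (2 * ‖smo n 0 w - w‖ ^ 2) +
      2 * (c * (2 * ∫ s in (0 : ℝ)..T, ‖smo n 0 (S s) - S s‖ ^ 2)), ?_, fun n m t ht => ?_⟩
    · have z1 : ∀ v, Tendsto (fun n => ‖smo n 0 v - v‖ ^ 2) atTop (𝓝 0) := fun v => by
        have := (tendsto_sub_nhds_zero_iff.2 (tendsto_smo v)).norm.pow 2
        simpa using this
      have z2 := tendsto_integral_smo_sub hS hB hT
      have := (((z1 v).const_mul 2).add (((z1 w).const_mul 2).const_mul α)).add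
        (((z2.const_mul 2).const_mul c).const_mul 2)
      simpa using this
    · have hX := (isSmoothing_smo n).sub (isSmoothing_smo m)
      have h1 := (h T).energy_le hα hX hk hS hB (H _ hX) ht
      rw [hv _ hX, hw _ hX] at h1
      simp only [sub_apply] at h1
      have h2 := norm_sub_sq_le (smo n 0 v) (smo m 0 v) v
      have h3 := mul_le_mul_of_nonneg_left (norm_sub_sq_le (smo n 0 w) (smo m 0 w) w) hα.le
      have i0 : ∀ n, ∀ t ∈ Icc 0 T,
          IntervalIntegrable (fun s => ‖smo n 0 (S s) - S s‖ ^ 2) volume 0 t := fun n t ht =>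
        intervalIntegrable_norm_sq (B := 2 * B)
          (((smo n 0).continuous.comp_stronglyMeasurable hS).sub hS)
          (fun s hs => (norm_sub_le _ _).trans
            (by linarith [norm_smo_le n (S s), hB s hs])) ht
      have i1 : IntervalIntegrable (fun s => ‖smo n 0 (S s) - smo m 0 (S s)‖ ^ 2) volume 0 T :=
        intervalIntegrable_norm_sq (B := 2 * B)
          (((smo n 0).continuous.comp_stronglyMeasurable hS).sub
            ((smo m 0).continuous.comp_stronglyMeasurable hS))
          (fun s hs => (norm_sub_le _ _).trans
            (by linarith [norm_smo_le n (S s), norm_smo_le m (S s), hB s hs])) ⟨hT, le_rfl⟩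
      have h4 : ∫ s in (0 : ℝ)..t, ‖smo n 0 (S s) - smo m 0 (S s)‖ ^ 2 ≤
          ∫ s in (0 : ℝ)..T, ‖smo n 0 (S s) - smo m 0 (S s)‖ ^ 2 :=
        intervalIntegral.integral_mono_interval le_rfl ht.1 ht.2
          (Eventually.of_forall fun _ => sq_nonneg _) i1
      have h5 : ∫ s in (0 : ℝ)..T, ‖smo n 0 (S s) - smo m 0 (S s)‖ ^ 2 ≤
          ∫ s in (0 : ℝ)..T, (2 * ‖smo n 0 (S s) - S s‖ ^ 2 + 2 * ‖smo m 0 (S s) - S s‖ ^ 2) :=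
        intervalIntegral.integral_mono_on hT i1
          (((i0 n T ⟨hT, le_rfl⟩).const_mul 2).add ((i0 m T ⟨hT, le_rfl⟩).const_mul 2))
          fun s _ => norm_sub_sq_le _ _ _
      rw [intervalIntegral.integral_add ((i0 n T ⟨hT, le_rfl⟩).const_mul 2)
        ((i0 m T ⟨hT, le_rfl⟩).const_mul 2), intervalIntegral.integral_const_mul,
        intervalIntegral.integral_const_mul] at h5
      have h6 := mul_le_mul_of_nonneg_left (h4.trans h5) hc
      linarith
  obtain ⟨ψ, hψc, hψ⟩ := exists_continuous_limit (f := fun n t => smo n k (φ t))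
    (fun n => (smo n k).continuous.comp hφ) fun T => by
      obtain ⟨b, hb, hle⟩ := key T
      refine ⟨b, hb, fun n m t ht => ?_⟩
      have := hle n m t ht
      have := mul_nonneg hα.le (sq_nonneg ‖smo n (k + 1) (φ t) - smo m (k + 1) (φ t)‖)
      linarith
  obtain ⟨χ, hχc, hχ⟩ := exists_continuous_limit (f := fun n t => smo n (k + 1) (φ t))
    (fun n => (smo n (k + 1)).continuous.comp hφ) fun T => by
      obtain ⟨b, hb, hle⟩ := key T
      refine ⟨fun n => α⁻¹ * b n, by simpa using hb.const_mul α⁻¹, fun n m t ht => ?_⟩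
      have h1 := hle n m t ht
      have h2 := sq_nonneg ‖smo n k (φ t) - smo m k (φ t)‖
      rw [← mul_add, ← div_eq_inv_mul, le_div_iff₀ hα]
      linarith
  exact ⟨ψ, χ, hψc, hχc, fun t ht => ⟨hψ t ht, hχ t ht⟩⟩

/-- The energy identity for a solution with `k + 2` derivatives, by passage to the limit. -/
theorem energy_identity_limit (hα : 0 < α) (h : IsEvolution α β γ T φ G) {k : ℕ} (hk : k < 3)
    {a b c S : ℝ → L2} (hb : Continuous b) (hc : Continuous c)
    (ea : ∀ X, IsSmoothing X → ∀ s, X k (φ s) = X 0 (a s))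
    (eb : ∀ X, IsSmoothing X → ∀ s, X (k + 1) (φ s) = X 0 (b s))
    (ec : ∀ X, IsSmoothing X → ∀ s, X (k + 2) (φ s) = X 0 (c s))
    (eS : ∀ X, IsSmoothing X → ∀ s, X k (G s) = X 0 (S s))
    (hS : StronglyMeasurable S) {B : ℝ} (hB : ∀ s ∈ Icc 0 T, ‖S s‖ ≤ B)
    {t : ℝ} (ht : t ∈ Icc 0 T) :
    ‖a t‖ ^ 2 + α * ‖b t‖ ^ 2 = ‖a 0‖ ^ 2 + α * ‖b 0‖ ^ 2 -
      2 * ∫ s in (0 : ℝ)..t, (β * ‖b s‖ ^ 2 + γ * ‖c s‖ ^ 2 - inner ℝ (S s) (b s)) := by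
  have hid : ∀ n, ‖smo n 0 (a t)‖ ^ 2 + α * ‖smo n 0 (b t)‖ ^ 2 =
      ‖smo n 0 (a 0)‖ ^ 2 + α * ‖smo n 0 (b 0)‖ ^ 2 -
      2 * ∫ s in (0 : ℝ)..t, (β * ‖smo n 0 (b s)‖ ^ 2 + γ * ‖smo n 0 (c s)‖ ^ 2
        - inner ℝ (smo n 0 (S s)) (smo n 0 (b s))) := by
    intro n
    have hX := isSmoothing_smo n
    have := h.energy_identity hα hX hk ht
    have e : ∀ s, inner ℝ (smo n (k + 1) (G s)) (smo n k (φ s)) =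
        -inner ℝ (smo n k (G s)) (smo n (k + 1) (φ s)) := fun s =>
      inner_source hX _ _ (by omega)
    simp only [e] at this
    simp only [ea _ hX, eb _ hX, ec _ hX, eS _ hX, ← sub_eq_add_neg] at this
    exact this
  have hl : ∀ v, Tendsto (fun n => ‖smo n 0 v‖ ^ 2) atTop (𝓝 (‖v‖ ^ 2)) := fun v =>
    (tendsto_smo v).norm.pow 2
  have hint : Tendsto (fun n => ∫ s in (0 : ℝ)..t, (β * ‖smo n 0 (b s)‖ ^ 2
      + γ * ‖smo n 0 (c s)‖ ^ 2 - inner ℝ (smo n 0 (S s)) (smo n 0 (b s)))) atTop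
      (𝓝 (∫ s in (0 : ℝ)..t, (β * ‖b s‖ ^ 2 + γ * ‖c s‖ ^ 2 - inner ℝ (S s) (b s)))) := by
    refine intervalIntegral.tendsto_integral_filter_of_dominated_convergence
      (fun s => |β| * ‖b s‖ ^ 2 + |γ| * ‖c s‖ ^ 2 + |B| * ‖b s‖)
      (Eventually.of_forall fun n => ?_)
      (Eventually.of_forall fun n => Eventually.of_forall fun s hs => ?_)
      (Continuous.intervalIntegrable (by fun_prop) _ _) (Eventually.of_forall fun s _ => ?_)
    · have m1 : Continuous fun s => smo n 0 (b s) := (smo n 0).continuous.comp hb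
      have m2 : Continuous fun s => smo n 0 (c s) := (smo n 0).continuous.comp hc
      have m3 : StronglyMeasurable fun s => smo n 0 (S s) :=
        (smo n 0).continuous.comp_stronglyMeasurable hS
      have m4 : Continuous fun s => β * ‖smo n 0 (b s)‖ ^ 2 + γ * ‖smo n 0 (c s)‖ ^ 2 := by
        fun_prop
      exact (m4.stronglyMeasurable.sub
        (m3.inner (𝕜 := ℝ) m1.stronglyMeasurable)).aestronglyMeasurable
    · rw [uIoc_of_le ht.1] at hs
      have h1 := (hB s ⟨hs.1.le, hs.2.trans ht.2⟩).trans (le_abs_self B)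
      have h2 := norm_smo_le n (b s)
      have h3 := norm_smo_le n (c s)
      have h4 := (norm_smo_le n (S s)).trans h1
      have h5 : ‖inner ℝ (smo n 0 (S s)) (smo n 0 (b s))‖ ≤ |B| * ‖b s‖ :=
        (norm_inner_le_norm _ _).trans (mul_le_mul h4 h2 (norm_nonneg _) (abs_nonneg _))
      refine (norm_sub_le _ _).trans (add_le_add ((norm_add_le _ _).trans
        (add_le_add ?_ ?_)) h5)
      · rw [norm_mul, norm_pow, norm_norm, Real.norm_eq_abs]
        exact mul_le_mul_of_nonneg_left (pow_le_pow_left₀ (norm_nonneg _) h2 2) (abs_nonneg _)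
      · rw [norm_mul, norm_pow, norm_norm, Real.norm_eq_abs]
        exact mul_le_mul_of_nonneg_left (pow_le_pow_left₀ (norm_nonneg _) h3 2) (abs_nonneg _)
    · exact ((hl _).const_mul β |>.add ((hl _).const_mul γ)).sub
        ((tendsto_smo _).inner (tendsto_smo _))
  exact tendsto_nhds_unique ((hl _).add ((hl _).const_mul α))
    ((((hl _).add ((hl _).const_mul α)).sub (hint.const_mul 2)).congr fun n => (hid n).symm)

end IsEvolution

/-! ### The nonlinearity -/

/-- A `C¹` function agrees on a ball with a `C¹` function that is globally Lipschitz: one freezes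
the derivative outside the ball. -/
theorem exists_truncation {f : ℝ → ℝ} (hf : ContDiff ℝ 1 f) (c : ℝ) {M : ℝ} (hM : 0 ≤ M) :
    ∃ (g : ℝ → ℝ) (C : NNReal), ContDiff ℝ 1 g ∧ LipschitzWith C g ∧ g 0 = 0 ∧
      ∀ s, |s| ≤ M → g s = f (c + s) - f c := by
  have hfd : Continuous (deriv f) := hf.continuous_deriv le_rfl
  set k : ℝ → ℝ := fun s => deriv f (c + max (-M) (min s M)) with hk
  have hkc : Continuous k := by
    have : Continuous fun s : ℝ => c + max (-M) (min s M) := by fun_prop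
    exact hfd.comp this
  have hder : ∀ s, HasDerivAt (fun s => ∫ t in (0 : ℝ)..s, k t) (k s) s := fun s =>
    intervalIntegral.integral_hasDerivAt_right (hkc.intervalIntegrable _ _)
      hkc.aestronglyMeasurable.stronglyMeasurableAtFilter hkc.continuousAt
  have hdd : deriv (fun s => ∫ t in (0 : ℝ)..s, k t) = k := funext fun s => (hder s).deriv
  obtain ⟨B, hB⟩ := (isCompact_Icc (a := c - M) (b := c + M)).exists_bound_of_continuousOn
    hfd.continuousOn
  have hkB : ∀ s, ‖k s‖ ≤ B.toNNReal := fun s => by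
    refine (hB _ ⟨?_, ?_⟩).trans (Real.le_coe_toNNReal B)
    · linarith [le_max_left (-M) (min s M)]
    · linarith [max_le (by linarith : -M ≤ M) (min_le_right s M)]
  refine ⟨fun s => ∫ t in (0 : ℝ)..s, k t, B.toNNReal, ?_, ?_, by simp, fun s hs => ?_⟩
  · rw [contDiff_one_iff_deriv, hdd]
    exact ⟨fun s => (hder s).differentiableAt, hkc⟩
  · refine lipschitzWith_of_nnnorm_deriv_le (fun s => (hder s).differentiableAt) fun s => ?_
    rw [(hder s).deriv]
    exact hkB s
  · have h1 : ∫ t in (0 : ℝ)..s, k t = ∫ t in (0 : ℝ)..s, deriv f (c + t) := by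
      refine intervalIntegral.integral_congr fun t ht => ?_
      have h2 : |t| ≤ |s| := by
        have := abs_sub_left_of_mem_uIcc ht
        simpa using this
      have h3 := abs_le.1 (h2.trans hs)
      simp only [hk]
      rw [min_eq_left h3.2, max_eq_right h3.1]
    beta_reduce
    rw [h1, intervalIntegral.integral_comp_add_left (fun t => deriv f t) c, add_zero]
    exact intervalIntegral.integral_deriv_eq_sub (fun x _ => hf.differentiable (by decide) x)
      (hfd.intervalIntegrable _ _)

section
variable {g : ℝ → ℝ} {C : NNReal}

theorem abs_le_of_lipschitz (hL : LipschitzWith C g) (g0 : g 0 = 0) (s : ℝ) :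
    |g s| ≤ C * |s| := by
  have := hL.norm_sub_le s 0
  simpa [g0] using this

/-- The chain rule `∂ₓ g(v) = g'(v) ∂ₓv` in `H¹(ℝ)`, with the bound it entails. -/
theorem exists_hasDx_compLp (hg : ContDiff ℝ 1 g) (hL : LipschitzWith C g) (g0 : g 0 = 0)
    {v v' : L2} (h : HasDx v v') :
    ∃ s : L2, HasDx (hL.compLp g0 v) s ∧ ‖s‖ ≤ C * ‖v'‖ := by
  obtain ⟨V, hV, e⟩ := h.exists_rep
  have hP := hV.comp hg
  have hb : ∀ᵐ x, ‖deriv g (V x) * v' x‖ ≤ C * ‖v' x‖ := Eventually.of_forall fun x => by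
    rw [norm_mul]
    exact mul_le_mul_of_nonneg_right (norm_deriv_le_of_lipschitz hL) (norm_nonneg _)
  have hm : MemLp (fun x => deriv g (V x) * v' x) 2 volume :=
    (Lp.memLp v').of_le_mul ((((hg.continuous_deriv le_rfl).comp
      hV.continuous).aestronglyMeasurable).mul (Lp.aestronglyMeasurable v')) hb
  refine ⟨hm.toLp _, ?_, ?_⟩
  · refine hP.isWeakDeriv.congr ?_ hm.coeFn_toLp.symm
    filter_upwards [hL.coeFn_compLp g0 v, e] with x h1 h2
    rw [h1, Function.comp_apply, h2]
  · refine Lp.norm_le_mul_norm_of_ae_le_mul ?_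
    filter_upwards [hm.coeFn_toLp, hb] with x h1 h2
    rw [h1]
    exact h2

/-- The flux does not contribute to the energy balance. -/
theorem inner_compLp_eq_zero (hL : LipschitzWith C g) (g0 : g 0 = 0) {v v' : L2}
    (h : HasDx v v') : inner ℝ (hL.compLp g0 v) v' = 0 := by
  rw [inner_eq_integral, ← h.integral_comp_mul_eq_zero hL.continuous (abs_le_of_lipschitz hL g0)]
  refine integral_congr_ae ?_
  filter_upwards [hL.coeFn_compLp g0 v] with x h1
  rw [h1, Function.comp_apply]

end

/-! ### Solutions with values in `H³` and their global bounds -/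

/-- A solution `φ` of the integrated equation with source `-∂ₓG`, together with its derivatives
`φ₁, φ₂, φ₃` in `x`, continuous in time, and the derivative `S` of `G`. -/
structure IsStrongEvolution (α β γ T : ℝ) (φ φ₁ φ₂ φ₃ G S : ℝ → L2) : Prop where
  evol : IsEvolution α β γ T φ G
  cont₁ : Continuous φ₁
  cont₂ : Continuous φ₂
  cont₃ : Continuous φ₃
  hasDx₀ : ∀ t, HasDx (φ t) (φ₁ t)
  hasDx₁ : ∀ t, HasDx (φ₁ t) (φ₂ t)
  hasDx₂ : ∀ t, HasDx (φ₂ t) (φ₃ t)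
  hasDxG : ∀ t, HasDx (G t) (S t)

theorem stronglyMeasurable_of_hasDx {G S : ℝ → L2} (hG : Continuous G)
    (h : ∀ t, HasDx (G t) (S t)) : StronglyMeasurable S := by
  refine stronglyMeasurable_of_tendsto atTop (f := fun n t => smo n 1 (G t))
    (fun n => ((smo n 1).continuous.comp hG).stronglyMeasurable) ?_
  rw [tendsto_pi_nhds]
  intro t
  refine (tendsto_smo (S t)).congr fun n => ?_
  exact (isSmoothing_smo n).apply_dx (h t) (by norm_num)

namespace IsStrongEvolution

variable {α β γ T : ℝ} {φ φ₁ φ₂ φ₃ G S : ℝ → L2}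

theorem stronglyMeasurable (h : IsStrongEvolution α β γ T φ φ₁ φ₂ φ₃ G S) :
    StronglyMeasurable S := stronglyMeasurable_of_hasDx h.evol.continuous_snd h.hasDxG

theorem energy_zero (hα : 0 < α) (h : IsStrongEvolution α β γ T φ φ₁ φ₂ φ₃ G S)
    {t : ℝ} (ht : t ∈ Icc 0 T) :
    ‖φ t‖ ^ 2 + α * ‖φ₁ t‖ ^ 2 = ‖φ 0‖ ^ 2 + α * ‖φ₁ 0‖ ^ 2 -
      2 * ∫ s in (0 : ℝ)..t, (β * ‖φ₁ s‖ ^ 2 + γ * ‖φ₂ s‖ ^ 2 - inner ℝ (G s) (φ₁ s)) := by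
  obtain ⟨B, hB⟩ := (isCompact_Icc (a := (0 : ℝ)) (b := T)).exists_bound_of_continuousOn
    h.evol.continuous_snd.continuousOn
  exact h.evol.energy_identity_limit hα (k := 0) (by norm_num) h.cont₁ h.cont₂
    (fun _ _ _ => rfl) (fun X hX s => (hX.apply_dx (h.hasDx₀ s) (by norm_num)).symm)
    (fun X hX s => by
      rw [hX.apply_dx (h.hasDx₁ s) (by norm_num), hX.apply_dx (h.hasDx₀ s) (by norm_num)])
    (fun _ _ _ => rfl) h.evol.continuous_snd.stronglyMeasurable hB ht

theorem energy_one (hα : 0 < α) (h : IsStrongEvolution α β γ T φ φ₁ φ₂ φ₃ G S)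
    {B : ℝ} (hB : ∀ s ∈ Icc 0 T, ‖S s‖ ≤ B) {t : ℝ} (ht : t ∈ Icc 0 T) :
    ‖φ₁ t‖ ^ 2 + α * ‖φ₂ t‖ ^ 2 = ‖φ₁ 0‖ ^ 2 + α * ‖φ₂ 0‖ ^ 2 -
      2 * ∫ s in (0 : ℝ)..t, (β * ‖φ₂ s‖ ^ 2 + γ * ‖φ₃ s‖ ^ 2 - inner ℝ (S s) (φ₂ s)) :=
  h.evol.energy_identity_limit hα (k := 1) (by norm_num) h.cont₂ h.cont₃
    (fun X hX s => (hX.apply_dx (h.hasDx₀ s) (by norm_num)).symm)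
    (fun X hX s => by
      rw [hX.apply_dx (h.hasDx₁ s) (by norm_num), hX.apply_dx (h.hasDx₀ s) (by norm_num)])
    (fun X hX s => by
      rw [hX.apply_dx (h.hasDx₂ s) (by norm_num), hX.apply_dx (h.hasDx₁ s) (by norm_num),
        hX.apply_dx (h.hasDx₀ s) (by norm_num)])
    (fun X hX s => (hX.apply_dx (h.hasDxG s) (by norm_num)).symm)
    h.stronglyMeasurable hB ht

/-- The energy inequality at the level of `∂ₓ²φ`, for the smoothed solution; it controls four
derivatives. -/
theorem energy_two_le (hα : 0 < α) (hβ : 0 < β) (hγ : 0 < γ)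
    (h : IsStrongEvolution α β γ T φ φ₁ φ₂ φ₃ G S)
    {B : ℝ} (hB : ∀ s ∈ Icc 0 T, ‖S s‖ ≤ B) (n : ℕ) {t : ℝ} (ht : t ∈ Icc 0 T) :
    α * ‖smo n 3 (φ t)‖ ^ 2 + ∫ s in (0 : ℝ)..t, γ * ‖smo n 4 (φ s)‖ ^ 2 ≤
      ‖φ₂ 0‖ ^ 2 + α * ‖φ₃ 0‖ ^ 2 + γ⁻¹ * ∫ s in (0 : ℝ)..t, ‖S s‖ ^ 2 := by
  have hX := isSmoothing_smo n
  have hid := h.evol.energy_identity hα hX (k := 2) (by norm_num) ht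
  have c1 := h.evol.continuous_fst
  have c2 := h.evol.continuous_snd
  have hcont : ∀ j, Continuous fun s => smo n j (φ s) := fun j => (smo n j).continuous.comp c1
  have hcont' : ∀ j, Continuous fun s => smo n j (G s) := fun j => (smo n j).continuous.comp c2
  have e2 : smo n 2 (φ 0) = smo n 0 (φ₂ 0) := by
    rw [hX.apply_dx (h.hasDx₁ 0) (by norm_num), hX.apply_dx (h.hasDx₀ 0) (by norm_num)]
  have e3 : smo n 3 (φ 0) = smo n 0 (φ₃ 0) := by
    rw [hX.apply_dx (h.hasDx₂ 0) (by norm_num), hX.apply_dx (h.hasDx₁ 0) (by norm_num),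
      hX.apply_dx (h.hasDx₀ 0) (by norm_num)]
  have hsrc : ∀ s, inner ℝ (smo n 3 (G s)) (smo n 2 (φ s)) =
      inner ℝ (smo n 0 (S s)) (smo n 4 (φ s)) := fun s => by
    have i1 := IsEvolution.inner_source hX (G s) (φ s) (k := 2) (by norm_num)
    have i2 := (hX.hasDx 1 (by norm_num) (G s)).inner_eq_neg (hX.hasDx 3 (by norm_num) (φ s))
    rw [hX.apply_dx (h.hasDxG s) (by norm_num)]
    linarith
  have hc : Continuous fun s => β * ‖smo n 3 (φ s)‖ ^ 2 + γ * ‖smo n 4 (φ s)‖ ^ 2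
        + inner ℝ (smo n 3 (G s)) (smo n 2 (φ s)) := by
    have := (hcont' 3).inner (𝕜 := ℝ) (hcont 2)
    have := hcont 3
    have := hcont 4
    fun_prop
  have hc4 : Continuous fun s => γ * ‖smo n 4 (φ s)‖ ^ 2 := by
    have := hcont 4
    fun_prop
  have hS := intervalIntegrable_norm_sq h.stronglyMeasurable hB ht
  have hmono : ∫ s in (0 : ℝ)..t, (γ * ‖smo n 4 (φ s)‖ ^ 2 - γ⁻¹ * ‖S s‖ ^ 2) ≤
      ∫ s in (0 : ℝ)..t, 2 * (β * ‖smo n 3 (φ s)‖ ^ 2 + γ * ‖smo n 4 (φ s)‖ ^ 2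
        + inner ℝ (smo n 3 (G s)) (smo n 2 (φ s))) := by
    refine intervalIntegral.integral_mono_on ht.1
      ((hc4.intervalIntegrable _ _).sub (hS.const_mul _))
      ((hc.const_mul 2).intervalIntegrable _ _) fun s _ => ?_
    rw [hsrc s]
    have h1 := (abs_le.1 (abs_real_inner_le_norm (smo n 0 (S s)) (smo n 4 (φ s)))).1
    have h2 := norm_smo_le n (S s)
    have h3 : ‖smo n 0 (S s)‖ * ‖smo n 4 (φ s)‖ ≤ ‖S s‖ * ‖smo n 4 (φ s)‖ :=
      mul_le_mul_of_nonneg_right h2 (norm_nonneg _)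
    have h4 : 2 * (‖S s‖ * ‖smo n 4 (φ s)‖) ≤ γ * ‖smo n 4 (φ s)‖ ^ 2 + γ⁻¹ * ‖S s‖ ^ 2 := by
      have h5 : γ * γ⁻¹ = 1 := mul_inv_cancel₀ hγ.ne'
      have h6 : 0 ≤ γ * (‖smo n 4 (φ s)‖ - γ⁻¹ * ‖S s‖) ^ 2 := by positivity
      have h7 : γ * (‖smo n 4 (φ s)‖ - γ⁻¹ * ‖S s‖) ^ 2 = γ * ‖smo n 4 (φ s)‖ ^ 2
          - 2 * (γ * γ⁻¹) * (‖S s‖ * ‖smo n 4 (φ s)‖) + (γ * γ⁻¹) * (γ⁻¹ * ‖S s‖ ^ 2) := by ring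
      rw [h7, h5] at h6
      linarith
    have h8 : 0 ≤ β * ‖smo n 3 (φ s)‖ ^ 2 := by positivity
    linarith
  rw [intervalIntegral.integral_sub (hc4.intervalIntegrable _ _) (hS.const_mul _),
    intervalIntegral.integral_const_mul γ⁻¹, intervalIntegral.integral_const_mul 2] at hmono
  rw [e2, e3] at hid
  have n2 : ‖smo n 0 (φ₂ 0)‖ ^ 2 ≤ ‖φ₂ 0‖ ^ 2 :=
    pow_le_pow_left₀ (norm_nonneg _) (norm_smo_le n _) 2
  have n3 : α * ‖smo n 0 (φ₃ 0)‖ ^ 2 ≤ α * ‖φ₃ 0‖ ^ 2 :=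
    mul_le_mul_of_nonneg_left (pow_le_pow_left₀ (norm_nonneg _) (norm_smo_le n _) 2) hα.le
  have n4 := sq_nonneg ‖smo n 2 (φ t)‖
  linarith

end IsStrongEvolution

theorem mul_le_mul_sq_add_inv_mul_sq {a b c : ℝ} (hc : 0 < c) :
    a * b ≤ c * b ^ 2 + (4 * c)⁻¹ * a ^ 2 := by
  have h1 : 0 ≤ (2 * c * b - a) ^ 2 / (4 * c) := by positivity
  have h2 : (2 * c * b - a) ^ 2 / (4 * c) = c * b ^ 2 - a * b + (4 * c)⁻¹ * a ^ 2 := by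
    field_simp
    ring
  linarith

/-- Global solutions with values in `H³(ℝ)` for a globally Lipschitz flux. -/
theorem exists_strong {α β γ : ℝ} (hα : 0 < α) (hβ : 0 < β) (hγ : 0 < γ) {g : ℝ → ℝ}
    {C : NNReal} (hg : ContDiff ℝ 1 g) (hL : LipschitzWith C g) (g0 : g 0 = 0)
    {v₀ v₁ v₂ v₃ : L2} (h01 : HasDx v₀ v₁) (h12 : HasDx v₁ v₂) (h23 : HasDx v₂ v₃) :
    ∃ φ φ₁ φ₂ φ₃ S : ℝ → L2, φ 0 = v₀ ∧ (∀ t, ‖S t‖ ≤ C * ‖φ₁ t‖) ∧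
      ∀ T, IsStrongEvolution α β γ T φ φ₁ φ₂ φ₃ (fun t => hL.compLp g0 (φ t)) S := by
  have hF1 := ((β - γ / α) • ddres α).lipschitz
  have hF2 := (dres α).lipschitz.comp (hL.lipschitzWith_compLp g0 (p := 2) (μ := volume))
  obtain ⟨u, huc, hu0, hu⟩ := exists_semilinear (κ := γ / α) hα (by positivity) (hF1.sub hF2)
    h01 h12
  set φ : ℝ → L2 := fun t => u (max t 0) with hφ
  have hφc : Continuous φ := huc.comp (by fun_prop)
  have hφ0 : φ 0 = v₀ := by simp [hφ, hu0]
  have hmax : ∀ t, φ (max t 0) = φ t := fun t => by simp [hφ]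
  set G : ℝ → L2 := fun t => hL.compLp g0 (φ t) with hG
  have hGc : Continuous G := (hL.continuous_compLp g0).comp hφc
  have hev : ∀ T, IsEvolution α β γ T φ G := fun T => by
    refine ⟨hφc, hGc, fun t ht => ?_⟩
    have h1 := hu t ht.1
    have h2 : φ t = u t := by simp [hφ, ht.1]
    rw [h2, hφ0, h1]
    congr 1
    refine intervalIntegral.integral_congr fun s hs => ?_
    rw [uIcc_of_le ht.1] at hs
    have h3 : φ s = u s := by simp [hφ, hs.1]
    simp only [hG, evolRate, h3, map_sub, smul_apply, map_smul,
      Function.comp_apply]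
    abel
  -- the estimate for `k = 0` gives values in `H¹(ℝ)`, which suffices to differentiate the flux
  obtain ⟨ψ, χ, -, hχc, hlim⟩ := IsEvolution.exists_tendsto_smo hα hev (k := 0) (by norm_num)
    (c := (4 * β)⁻¹) (by positivity) hGc.stronglyMeasurable
    (fun T => (isCompact_Icc (a := (0 : ℝ)) (b := T)).exists_bound_of_continuousOn
      hGc.continuousOn)
    (fun X hX s => by
      rw [IsEvolution.inner_source hX _ _ (by norm_num), neg_neg]
      have h1 := real_inner_le_norm (X 0 (G s)) (X (0 + 1) (φ s))
      have h2 := mul_le_mul_sq_add_inv_mul_sq (a := ‖X 0 (G s)‖) (b := ‖X (0 + 1) (φ s)‖) hβ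
      have h3 : 0 ≤ γ * ‖X (0 + 2) (φ s)‖ ^ 2 := by positivity
      linarith) (v := v₀) (w := v₁)
    (fun X _ => by rw [hφ0]) (fun X hX => by rw [hφ0, hX.apply_dx h01 (by norm_num)])
  set φ₁ : ℝ → L2 := fun t => χ (max t 0) with hφ₁
  have hφ₁c : Continuous φ₁ := hχc.comp (by fun_prop)
  have d0 : ∀ t, HasDx (φ t) (φ₁ t) := fun t => by
    have h1 := (hlim (max t 0) (le_max_right _ _)).2
    have h2 := tendsto_smo (φ (max t 0))
    have := HasDx.of_tendsto h2 h1 fun n => (isSmoothing_smo n).hasDx 0 (by norm_num) _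
    rwa [hmax] at this
  choose S hS hSb using fun t => exists_hasDx_compLp hg hL g0 (d0 t)
  have hSm : StronglyMeasurable S := stronglyMeasurable_of_hasDx hGc hS
  -- for `k = 2`, integration by parts moves two derivatives from `∂ₓ³ g(φ)` to the other factor, so
  -- that only `∂ₓ g(φ)` is needed
  obtain ⟨ψ', χ', hψc', hχc', hlim'⟩ := IsEvolution.exists_tendsto_smo hα hev (k := 2)
    (by norm_num) (c := (4 * γ)⁻¹) (by positivity) hSm
    (fun T => by
      obtain ⟨B, hB⟩ := (isCompact_Icc (a := (0 : ℝ)) (b := T)).exists_bound_of_continuousOn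
        hφ₁c.continuousOn
      exact ⟨C * B, fun s hs => (hSb s).trans (mul_le_mul_of_nonneg_left (hB s hs) C.coe_nonneg)⟩)
    (fun X hX s => by
      have i1 := IsEvolution.inner_source hX (G s) (φ s) (k := 2) (by norm_num)
      have i2 := (hX.hasDx 1 (by norm_num) (G s)).inner_eq_neg (hX.hasDx 3 (by norm_num) (φ s))
      have h1 := (abs_le.1 (abs_real_inner_le_norm (X 1 (G s)) (X 4 (φ s)))).1
      have h2 := mul_le_mul_sq_add_inv_mul_sq (a := ‖X 1 (G s)‖) (b := ‖X 4 (φ s)‖) hγ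
      have h3 : 0 ≤ β * ‖X 3 (φ s)‖ ^ 2 := by positivity
      rw [hX.apply_dx (hS s) (by norm_num)]
      simp only [Nat.reduceAdd, zero_add] at i1 i2 ⊢
      linarith) (v := v₂) (w := v₃)
    (fun X hX => by
      rw [hφ0, hX.apply_dx h12 (by norm_num), hX.apply_dx h01 (by norm_num)])
    (fun X hX => by
      rw [hφ0, hX.apply_dx h23 (by norm_num), hX.apply_dx h12 (by norm_num),
        hX.apply_dx h01 (by norm_num)])
  have d1 : ∀ t, HasDx (φ₁ t) (ψ' (max t 0)) := fun t => by
    have h1 := (hlim' (max t 0) (le_max_right _ _)).1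
    refine HasDx.of_tendsto (tendsto_smo (φ₁ t)) h1 fun n => ?_
    rw [(isSmoothing_smo n).apply_dx (d0 t) (by norm_num), hmax]
    exact (isSmoothing_smo n).hasDx 1 (by norm_num) _
  have d2 : ∀ t, HasDx (ψ' (max t 0)) (χ' (max t 0)) := fun t => by
    have h1 := hlim' (max t 0) (le_max_right _ _)
    exact HasDx.of_tendsto h1.1 h1.2 fun n => (isSmoothing_smo n).hasDx 2 (by norm_num) _
  exact ⟨φ, φ₁, fun t => ψ' (max t 0), fun t => χ' (max t 0), S, hφ0, hSb, fun T =>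
    ⟨hev T, hφ₁c, hψc'.comp (by fun_prop), hχc'.comp (by fun_prop), d0, d1, d2, hS⟩⟩

/-! ### Square integrability in time -/

theorem memLp_of_integral_le {b : ℝ → L2} (hb : Continuous b) {M : ℝ}
    (h : ∀ t, 0 ≤ t → ∫ s in (0 : ℝ)..t, ‖b s‖ ^ 2 ≤ M) :
    MemLp b 2 (volume.restrict (Ioi (0 : ℝ))) := by
  rw [memLp_two_iff_integrable_sq_norm hb.aestronglyMeasurable]
  have hc : Continuous fun s => ‖b s‖ ^ 2 := by fun_prop
  refine integrableOn_Ioi_of_intervalIntegral_norm_bounded (μ := volume) (l := atTop)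
    (b := fun t : ℝ => t) M 0 (fun t => ?_) tendsto_id ?_
  · exact (hc.integrableOn_Icc (a := 0) (b := t)).mono_set Ioc_subset_Icc_self
  · filter_upwards [eventually_ge_atTop 0] with t ht
    have := h t ht
    simpa using this

theorem intervalIntegral_le_setIntegral {f : ℝ → ℝ} (hf : IntegrableOn f (Ioi 0))
    (h0 : ∀ s, 0 ≤ f s) {t : ℝ} (ht : 0 ≤ t) :
    ∫ s in (0 : ℝ)..t, f s ≤ ∫ s in Ioi 0, f s := by
  rw [intervalIntegral.integral_of_le ht]
  exact setIntegral_mono_set hf (Eventually.of_forall h0)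
    (Eventually.of_forall Ioc_subset_Ioi_self)

/-- A function on `(0, ∞)` that is integrable together with its derivative tends to zero. -/
theorem tendsto_zero_of_integrable {e r : ℝ → ℝ} (he : IntegrableOn e (Ioi 0))
    (hr : IntegrableOn r (Ioi 0)) (h : ∀ t, 0 ≤ t → e t = e 0 + ∫ s in (0 : ℝ)..t, r s) :
    Tendsto e atTop (𝓝 0) := by
  have h1 : Tendsto e atTop (𝓝 (e 0 + ∫ x in Ioi 0, r x)) := by
    have := (intervalIntegral_tendsto_integral_Ioi 0 hr tendsto_id).const_add (e 0)
    refine this.congr' ?_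
    filter_upwards [eventually_ge_atTop 0] with t ht
    exact (h t ht).symm
  have h2 : IntegrableAtFilter e atTop := ⟨Ioi 0, Ioi_mem_atTop 0, he⟩
  have : e 0 + ∫ x in Ioi 0, r x = 0 := h2.eq_zero_of_tendsto (fun s hs => by
      obtain ⟨b, hb⟩ := mem_atTop_sets.1 hs
      have : volume (Ici b) = ⊤ := by simp
      exact top_le_iff.1 (this ▸ measure_mono hb)) h1
  rwa [this] at h1

/-- The inclusion of the `j`-th factor of the Hilbert sum containing `H^k(ℝ)`. -/
noncomputable def factorIncl (k : ℕ) (j : Fin (k + 1)) :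
    L2 →L[ℝ] PiLp 2 (fun _ : Fin (k + 1) => L2) :=
  ((PiLp.continuousLinearEquiv 2 ℝ (fun _ : Fin (k + 1) => L2)).symm :
    (Fin (k + 1) → L2) →L[ℝ] PiLp 2 (fun _ : Fin (k + 1) => L2)).comp
    (ContinuousLinearMap.single ℝ (fun _ : Fin (k + 1) => L2) j)

theorem coe_eq_sum_factorIncl {k : ℕ} (v : SobolevH k) :
    (v : PiLp 2 (fun _ : Fin (k + 1) => L2)) = ∑ j, factorIncl k j (dx v j) := by
  have : (WithLp.ofLp (v : PiLp 2 (fun _ : Fin (k + 1) => L2))) =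
      ∑ j, Pi.single j (dx v j) := (Finset.univ_sum_single _).symm
  simp only [factorIncl, ContinuousLinearMap.comp_apply]
  rw [← map_sum]
  exact congrArg (WithLp.toLp 2) this

/-- A function with values in `H^k(ℝ)` is square integrable if all its derivatives are. -/
theorem memLp_sobolev {k : ℕ} {f : ℝ → SobolevH k} {μ : Measure ℝ}
    (h : ∀ j, MemLp (fun t => dx (f t) j) 2 μ) : MemLp f 2 μ := by
  have h1 : MemLp (fun t => (f t : PiLp 2 (fun _ : Fin (k + 1) => L2))) 2 μ := by
    simp only [coe_eq_sum_factorIncl]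
    exact memLp_finsetSum _ fun j _ => (factorIncl k j).comp_memLp' (h j)
  refine h1.of_le ?_ (Eventually.of_forall fun t => le_rfl)
  exact Topology.IsEmbedding.subtypeVal.aestronglyMeasurable_comp_iff.1 h1.aestronglyMeasurable

section
variable {α β γ : ℝ} {φ φ₁ φ₂ φ₃ G S : ℝ → L2} {C : NNReal}

/-! ### Global bounds -/

namespace IsStrongEvolution

theorem energy_zero_eq (hα : 0 < α)
    (h : ∀ T, IsStrongEvolution α β γ T φ φ₁ φ₂ φ₃ G S) (hG : ∀ t, inner ℝ (G t) (φ₁ t) = 0)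
    {t : ℝ} (ht : 0 ≤ t) :
    ‖φ t‖ ^ 2 + α * ‖φ₁ t‖ ^ 2 + 2 * ∫ s in (0 : ℝ)..t, (β * ‖φ₁ s‖ ^ 2 + γ * ‖φ₂ s‖ ^ 2) =
      ‖φ 0‖ ^ 2 + α * ‖φ₁ 0‖ ^ 2 := by
  have := (h t).energy_zero hα ⟨ht, le_rfl⟩
  simp only [hG, sub_zero] at this
  linarith

theorem integral_sq_le (hα : 0 < α) (hβ : 0 < β) (hγ : 0 < γ)
    (h : ∀ T, IsStrongEvolution α β γ T φ φ₁ φ₂ φ₃ G S) (hG : ∀ t, inner ℝ (G t) (φ₁ t) = 0)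
    {t : ℝ} (ht : 0 ≤ t) :
    β * (∫ s in (0 : ℝ)..t, ‖φ₁ s‖ ^ 2) + γ * (∫ s in (0 : ℝ)..t, ‖φ₂ s‖ ^ 2) ≤
      ‖φ 0‖ ^ 2 + α * ‖φ₁ 0‖ ^ 2 := by
  have h1 := energy_zero_eq hα h hG ht
  have c1 := (h 0).cont₁
  have c2 := (h 0).cont₂
  rw [intervalIntegral.integral_add (Continuous.intervalIntegrable (by fun_prop) _ _)
    (Continuous.intervalIntegrable (by fun_prop) _ _), intervalIntegral.integral_const_mul,
    intervalIntegral.integral_const_mul] at h1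
  have i1 : 0 ≤ ∫ s in (0 : ℝ)..t, ‖φ₁ s‖ ^ 2 :=
    intervalIntegral.integral_nonneg ht fun s _ => sq_nonneg _
  have i2 : 0 ≤ ∫ s in (0 : ℝ)..t, ‖φ₂ s‖ ^ 2 :=
    intervalIntegral.integral_nonneg ht fun s _ => sq_nonneg _
  have := mul_nonneg hβ.le i1
  have := mul_nonneg hγ.le i2
  nlinarith [sq_nonneg ‖φ t‖, mul_nonneg hα.le (sq_nonneg ‖φ₁ t‖)]

theorem memLp₁ (hα : 0 < α) (hβ : 0 < β) (hγ : 0 < γ)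
    (h : ∀ T, IsStrongEvolution α β γ T φ φ₁ φ₂ φ₃ G S) (hG : ∀ t, inner ℝ (G t) (φ₁ t) = 0) :
    MemLp φ₁ 2 (volume.restrict (Ioi (0 : ℝ))) := by
  refine memLp_of_integral_le (h 0).cont₁ (M := (‖φ 0‖ ^ 2 + α * ‖φ₁ 0‖ ^ 2) / β) fun t ht => ?_
  have h1 := integral_sq_le hα hβ hγ h hG ht
  have i2 : 0 ≤ ∫ s in (0 : ℝ)..t, ‖φ₂ s‖ ^ 2 :=
    intervalIntegral.integral_nonneg ht fun s _ => sq_nonneg _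
  rw [le_div_iff₀ hβ]
  have := mul_nonneg hγ.le i2
  linarith

theorem memLp₂ (hα : 0 < α) (hβ : 0 < β) (hγ : 0 < γ)
    (h : ∀ T, IsStrongEvolution α β γ T φ φ₁ φ₂ φ₃ G S) (hG : ∀ t, inner ℝ (G t) (φ₁ t) = 0) :
    MemLp φ₂ 2 (volume.restrict (Ioi (0 : ℝ))) := by
  refine memLp_of_integral_le (h 0).cont₂ (M := (‖φ 0‖ ^ 2 + α * ‖φ₁ 0‖ ^ 2) / γ) fun t ht => ?_
  have h1 := integral_sq_le hα hβ hγ h hG ht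
  have i1 : 0 ≤ ∫ s in (0 : ℝ)..t, ‖φ₁ s‖ ^ 2 :=
    intervalIntegral.integral_nonneg ht fun s _ => sq_nonneg _
  rw [le_div_iff₀ hγ]
  have := mul_nonneg hβ.le i1
  linarith

theorem memLpS (hα : 0 < α) (hβ : 0 < β) (hγ : 0 < γ)
    (h : ∀ T, IsStrongEvolution α β γ T φ φ₁ φ₂ φ₃ G S) (hG : ∀ t, inner ℝ (G t) (φ₁ t) = 0)
    (hS : ∀ t, ‖S t‖ ≤ C * ‖φ₁ t‖) : MemLp S 2 (volume.restrict (Ioi (0 : ℝ))) :=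
  (memLp₁ hα hβ hγ h hG).of_le_mul (h 0).stronglyMeasurable.aestronglyMeasurable
    (Eventually.of_forall hS)

theorem exists_bound_source (h : ∀ T, IsStrongEvolution α β γ T φ φ₁ φ₂ φ₃ G S)
    (hS : ∀ t, ‖S t‖ ≤ C * ‖φ₁ t‖) (T : ℝ) : ∃ B, ∀ s ∈ Icc 0 T, ‖S s‖ ≤ B := by
  obtain ⟨B, hB⟩ := (isCompact_Icc (a := (0 : ℝ)) (b := T)).exists_bound_of_continuousOn
    (h 0).cont₁.continuousOn
  exact ⟨C * B, fun s hs => (hS s).trans (mul_le_mul_of_nonneg_left (hB s hs) C.coe_nonneg)⟩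

theorem memLp₃ (hα : 0 < α) (hβ : 0 < β) (hγ : 0 < γ)
    (h : ∀ T, IsStrongEvolution α β γ T φ φ₁ φ₂ φ₃ G S) (hG : ∀ t, inner ℝ (G t) (φ₁ t) = 0)
    (hS : ∀ t, ‖S t‖ ≤ C * ‖φ₁ t‖) : MemLp φ₃ 2 (volume.restrict (Ioi (0 : ℝ))) := by
  have iS := (memLpS hα hβ hγ h hG hS).integrable_norm_pow (by norm_num)
  have i2 := (memLp₂ hα hβ hγ h hG).integrable_norm_pow (by norm_num)
  refine memLp_of_integral_le (h 0).cont₃ (M := (‖φ₁ 0‖ ^ 2 + α * ‖φ₂ 0‖ ^ 2 +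
    (∫ s in Ioi 0, ‖S s‖ ^ 2) + ∫ s in Ioi 0, ‖φ₂ s‖ ^ 2) / (2 * γ)) fun t ht => ?_
  obtain ⟨B, hB⟩ := exists_bound_source h hS t
  have hT : t ∈ Icc 0 t := ⟨ht, le_rfl⟩
  have h1 := (h t).energy_one hα hB hT
  have c2 := (h 0).cont₂
  have c3 := (h 0).cont₃
  have hSi := intervalIntegrable_norm_sq (h 0).stronglyMeasurable hB hT
  have hc2 : IntervalIntegrable (fun s => ‖φ₂ s‖ ^ 2) volume 0 t :=
    Continuous.intervalIntegrable (by fun_prop) _ _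
  have hc3 : IntervalIntegrable (fun s => ‖φ₃ s‖ ^ 2) volume 0 t :=
    Continuous.intervalIntegrable (by fun_prop) _ _
  obtain ⟨B', hB'⟩ := (isCompact_Icc (a := (0 : ℝ)) (b := t)).exists_bound_of_continuousOn
    c2.continuousOn
  have hin : IntervalIntegrable (fun s => inner ℝ (S s) (φ₂ s)) volume 0 t :=
    intervalIntegrable_of_bounded (T := t) (B := B * B')
      ((h 0).stronglyMeasurable.inner (𝕜 := ℝ) c2.stronglyMeasurable)
      (fun s hs => (norm_inner_le_norm _ _).trans
        (mul_le_mul (hB s hs) (hB' s hs) (norm_nonneg _) ((norm_nonneg _).trans (hB s hs)))) hT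
  have hmono : ∫ s in (0 : ℝ)..t, (2 * γ * ‖φ₃ s‖ ^ 2 - (‖S s‖ ^ 2 + ‖φ₂ s‖ ^ 2)) ≤
      ∫ s in (0 : ℝ)..t, 2 * (β * ‖φ₂ s‖ ^ 2 + γ * ‖φ₃ s‖ ^ 2 - inner ℝ (S s) (φ₂ s)) := by
    refine intervalIntegral.integral_mono_on ht ((hc3.const_mul _).sub (hSi.add hc2))
      ((((hc2.const_mul β).add (hc3.const_mul γ)).sub hin).const_mul 2) fun s _ => ?_
    have h2 := real_inner_le_norm (S s) (φ₂ s)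
    have h3 : 0 ≤ β * ‖φ₂ s‖ ^ 2 := by positivity
    nlinarith [sq_nonneg (‖S s‖ - ‖φ₂ s‖)]
  rw [intervalIntegral.integral_sub (hc3.const_mul _) (hSi.add hc2),
    intervalIntegral.integral_add hSi hc2,
    intervalIntegral.integral_const_mul, intervalIntegral.integral_const_mul] at hmono
  have j1 := intervalIntegral_le_setIntegral iS (fun s => sq_nonneg _) ht
  have j2 := intervalIntegral_le_setIntegral i2 (fun s => sq_nonneg _) ht
  rw [le_div_iff₀ (by positivity)]
  have n1 := sq_nonneg ‖φ₁ t‖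
  have n2 := mul_nonneg hα.le (sq_nonneg ‖φ₂ t‖)
  linarith

theorem exists_energy_two_bound (hα : 0 < α) (hβ : 0 < β) (hγ : 0 < γ)
    (h : ∀ T, IsStrongEvolution α β γ T φ φ₁ φ₂ φ₃ G S) (hG : ∀ t, inner ℝ (G t) (φ₁ t) = 0)
    (hS : ∀ t, ‖S t‖ ≤ C * ‖φ₁ t‖) : ∃ M, ∀ n t, 0 ≤ t → ‖smo n 3 (φ t)‖ ^ 2 ≤ M ∧
      ∫ s in (0 : ℝ)..t, ‖smo n 4 (φ s)‖ ^ 2 ≤ M := by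
  have iS := (memLpS hα hβ hγ h hG hS).integrable_norm_pow (by norm_num)
  set N := ‖φ₂ 0‖ ^ 2 + α * ‖φ₃ 0‖ ^ 2 + γ⁻¹ * ∫ s in Ioi 0, ‖S s‖ ^ 2 with hN
  refine ⟨max (N / α) (N / γ), fun n t ht => ?_⟩
  obtain ⟨B, hB⟩ := exists_bound_source h hS t
  have h1 := (h t).energy_two_le hα hβ hγ hB n (t := t) ⟨ht, le_rfl⟩
  have j1 := mul_le_mul_of_nonneg_left
    (intervalIntegral_le_setIntegral iS (fun s => sq_nonneg _) ht) (inv_nonneg.2 hγ.le)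
  rw [intervalIntegral.integral_const_mul] at h1
  have i2 : 0 ≤ ∫ s in (0 : ℝ)..t, ‖smo n 4 (φ s)‖ ^ 2 :=
    intervalIntegral.integral_nonneg ht fun s _ => sq_nonneg _
  have := mul_nonneg hγ.le i2
  have := mul_nonneg hα.le (sq_nonneg ‖smo n 3 (φ t)‖)
  constructor
  · refine le_max_of_le_left ?_
    rw [le_div_iff₀ hα]
    linarith
  · refine le_max_of_le_right ?_
    rw [le_div_iff₀ hγ]
    linarith

/-- The third derivative is bounded in `L²`, uniformly in time. -/
theorem exists_bound₃ (hα : 0 < α) (hβ : 0 < β) (hγ : 0 < γ)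
    (h : ∀ T, IsStrongEvolution α β γ T φ φ₁ φ₂ φ₃ G S) (hG : ∀ t, inner ℝ (G t) (φ₁ t) = 0)
    (hS : ∀ t, ‖S t‖ ≤ C * ‖φ₁ t‖) : ∃ R, ∀ t, 0 ≤ t → ‖φ₃ t‖ ^ 2 ≤ R := by
  obtain ⟨M, hM⟩ := exists_energy_two_bound hα hβ hγ h hG hS
  refine ⟨M, fun t ht => ?_⟩
  refine le_of_tendsto ((tendsto_smo (φ₃ t)).norm.pow 2) (Eventually.of_forall fun n => ?_)
  have hX := isSmoothing_smo n
  rw [hX.apply_dx ((h 0).hasDx₂ t) (by norm_num), hX.apply_dx ((h 0).hasDx₁ t) (by norm_num),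
    hX.apply_dx ((h 0).hasDx₀ t) (by norm_num)]
  exact (hM n t ht).1

/-- By Fatou's lemma and weak compactness, a fourth derivative exists for almost every time and is
square integrable in time. -/
theorem exists_fourth (hα : 0 < α) (hβ : 0 < β) (hγ : 0 < γ)
    (h : ∀ T, IsStrongEvolution α β γ T φ φ₁ φ₂ φ₃ G S) (hG : ∀ t, inner ℝ (G t) (φ₁ t) = 0)
    (hS : ∀ t, ‖S t‖ ≤ C * ‖φ₁ t‖) : ∃ φ₄ : ℝ → L2,
      MemLp φ₄ 2 (volume.restrict (Ioi (0 : ℝ))) ∧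
      ∀ᵐ t ∂(volume.restrict (Ioi (0 : ℝ))), HasDx (φ₃ t) (φ₄ t) := by
  obtain ⟨M, hM⟩ := exists_energy_two_bound hα hβ hγ h hG hS
  have hc : ∀ n, Continuous fun t => smo n 4 (φ t) := fun n =>
    (smo n 4).continuous.comp (h 0).evol.continuous_fst
  have hL : ∀ n, MemLp (fun t => smo n 4 (φ t)) 2 (volume.restrict (Ioi (0 : ℝ))) := fun n =>
    memLp_of_integral_le (hc n) fun t ht => (hM n t ht).2
  have hle : ∀ n, ∫⁻ t in Ioi (0 : ℝ), ‖smo n 4 (φ t)‖ₑ ^ 2 ≤ ENNReal.ofReal M := by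
    intro n
    have i := (hL n).integrable_norm_pow (by norm_num)
    have e : ∫⁻ t in Ioi (0 : ℝ), ‖smo n 4 (φ t)‖ₑ ^ 2 =
        ENNReal.ofReal (∫ t in Ioi (0 : ℝ), ‖smo n 4 (φ t)‖ ^ 2) := by
      rw [ofReal_integral_eq_lintegral_ofReal i (Eventually.of_forall fun _ => sq_nonneg _)]
      refine lintegral_congr fun t => ?_
      rw [ENNReal.ofReal_pow (norm_nonneg _), ofReal_norm]
    rw [e]
    refine ENNReal.ofReal_le_ofReal (le_of_tendsto
      (intervalIntegral_tendsto_integral_Ioi 0 i tendsto_id) ?_)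
    filter_upwards [eventually_ge_atTop 0] with t ht
    exact (hM n t ht).2
  have hfatou : ∫⁻ t in Ioi (0 : ℝ), liminf (fun n => ‖smo n 4 (φ t)‖ₑ ^ 2) atTop ≤
      ENNReal.ofReal M := by
    refine (lintegral_liminf_le fun n => ?_).trans ?_
    · exact (hc n).enorm.measurable.pow_const 2
    · exact (liminf_le_liminf (Eventually.of_forall hle)).trans (by simp)
  have hae : ∀ᵐ t ∂(volume.restrict (Ioi (0 : ℝ))), ∃ w, HasDx (φ₃ t) w := by
    have hm : Measurable fun t => liminf (fun n => ‖smo n 4 (φ t)‖ₑ ^ 2) atTop :=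
      Measurable.liminf fun n => (hc n).enorm.measurable.pow_const 2
    filter_upwards [ae_lt_top hm (ne_of_lt (hfatou.trans_lt ENNReal.ofReal_lt_top))] with t ht
    set K := liminf (fun n => ‖smo n 4 (φ t)‖ₑ ^ 2) atTop with hK
    have hfr : ∃ᶠ n in atTop, ‖smo n 4 (φ t)‖ₑ ^ 2 < K + 1 :=
      frequently_lt_of_liminf_lt (by isBoundedDefault)
        (ENNReal.lt_add_right ht.ne one_ne_zero)
    refine exists_hasDx_of_frequently_le (f := fun n => smo n 3 (φ t))
      (g := fun n => smo n 4 (φ t)) (C := (K + 1).toReal + 1) ?_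
      (fun n => (isSmoothing_smo n).hasDx 3 (by norm_num) _) (hfr.mono fun n hn => ?_)
    · refine (tendsto_smo (φ₃ t)).congr fun n => ?_
      have hX := isSmoothing_smo n
      rw [hX.apply_dx ((h 0).hasDx₂ t) (by norm_num), hX.apply_dx ((h 0).hasDx₁ t) (by norm_num),
        hX.apply_dx ((h 0).hasDx₀ t) (by norm_num)]
    · have hne : K + 1 ≠ ⊤ := ENNReal.add_ne_top.2 ⟨ht.ne, ENNReal.one_ne_top⟩
      have h2 := ENNReal.toReal_mono hne hn.le
      rw [ENNReal.toReal_pow, toReal_enorm] at h2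
      nlinarith [norm_nonneg (smo n 4 (φ t)), sq_nonneg (‖smo n 4 (φ t)‖ - 1)]
  have hch : ∀ t, ∃ w, (∃ w, HasDx (φ₃ t) w) → HasDx (φ₃ t) w := fun t => by
    by_cases hw : ∃ w, HasDx (φ₃ t) w
    · exact ⟨hw.choose, fun _ => hw.choose_spec⟩
    · exact ⟨0, fun hw' => absurd hw' hw⟩
  choose φ₄ hφ₄ using hch
  have hlim : ∀ᵐ t ∂(volume.restrict (Ioi (0 : ℝ))),
      Tendsto (fun n => smo n 4 (φ t)) atTop (𝓝 (φ₄ t)) := by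
    filter_upwards [hae] with t ht
    refine (tendsto_smo (φ₄ t)).congr fun n => ?_
    have hX := isSmoothing_smo n
    rw [hX.apply_dx (hφ₄ t ht) (by norm_num), hX.apply_dx ((h 0).hasDx₂ t) (by norm_num),
      hX.apply_dx ((h 0).hasDx₁ t) (by norm_num), hX.apply_dx ((h 0).hasDx₀ t) (by norm_num)]
  refine ⟨φ₄, ⟨aestronglyMeasurable_of_tendsto_ae atTop
    (fun n => (hc n).aestronglyMeasurable) hlim, ?_⟩, by
      filter_upwards [hae] with t ht using hφ₄ t ht⟩
  refine (Lp.eLpNorm_lim_le_liminf_eLpNorm (fun n => (hc n).aestronglyMeasurable) _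
    hlim).trans_lt ?_
  have hb : ∀ n, eLpNorm (fun t => smo n 4 (φ t)) 2 (volume.restrict (Ioi (0 : ℝ))) ≤
      ENNReal.ofReal M ^ (1 / (2 : ℝ)) := fun n => by
    rw [eLpNorm_eq_lintegral_rpow_enorm_toReal two_ne_zero ENNReal.ofNat_ne_top]
    refine ENNReal.rpow_le_rpow ?_ (by norm_num)
    simpa using hle n
  refine ((liminf_le_liminf (Eventually.of_forall hb)).trans (by simp) :
    _ ≤ ENNReal.ofReal M ^ (1 / (2 : ℝ))).trans_lt ?_
  exact ENNReal.rpow_lt_top_of_nonneg (by norm_num) ENNReal.ofReal_ne_top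

/-- The first two derivatives tend to zero in `L²`, because their energy and its time derivative
are integrable. -/
theorem tendsto_energy_one (hα : 0 < α) (hβ : 0 < β) (hγ : 0 < γ)
    (h : ∀ T, IsStrongEvolution α β γ T φ φ₁ φ₂ φ₃ G S) (hG : ∀ t, inner ℝ (G t) (φ₁ t) = 0)
    (hS : ∀ t, ‖S t‖ ≤ C * ‖φ₁ t‖) :
    Tendsto (fun t => ‖φ₁ t‖ ^ 2 + α * ‖φ₂ t‖ ^ 2) atTop (𝓝 0) := by
  have m1 := memLp₁ hα hβ hγ h hG
  have m2 := memLp₂ hα hβ hγ h hG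
  have m3 := memLp₃ hα hβ hγ h hG hS
  have mS := memLpS hα hβ hγ h hG hS
  have i1 := m1.integrable_norm_pow (by norm_num)
  have i2 := m2.integrable_norm_pow (by norm_num)
  have i3 := m3.integrable_norm_pow (by norm_num)
  have iS := mS.integrable_norm_pow (by norm_num)
  have iin : IntegrableOn (fun s => inner ℝ (S s) (φ₂ s)) (Ioi 0) := by
    refine (iS.add i2).mono' ((h 0).stronglyMeasurable.inner (𝕜 := ℝ)
      (h 0).cont₂.stronglyMeasurable).aestronglyMeasurable (Eventually.of_forall fun s => ?_)
    refine (norm_inner_le_norm _ _).trans ?_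
    simp only [Pi.add_apply]
    nlinarith [sq_nonneg (‖S s‖ - ‖φ₂ s‖), sq_nonneg ‖S s‖, sq_nonneg ‖φ₂ s‖]
  refine tendsto_zero_of_integrable (i1.add (i2.const_mul α))
    ((((i2.const_mul β).add (i3.const_mul γ)).sub iin).const_mul (-2)) fun t ht => ?_
  obtain ⟨B, hB⟩ := exists_bound_source h hS t
  rw [(h t).energy_one hα hB ⟨ht, le_rfl⟩]
  simp only [Pi.sub_apply, Pi.add_apply]
  rw [intervalIntegral.integral_const_mul]
  ring

end IsStrongEvolution
end

/-! ### Classical representatives -/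

theorem IsPrimitive.hasDerivAt {G g h : ℝ → ℝ} (hG : IsPrimitive G g) (e : g =ᵐ[volume] h)
    (hh : Continuous h) (x : ℝ) : HasDerivAt G (h x) x := by
  have : G = fun x => G 0 + ∫ t in (0 : ℝ)..x, h t := by
    rw [hG.eq_add 0]
    ext x
    simp only [intervalIntegral.integral_same, add_zero]
    congr 1
    refine intervalIntegral.integral_congr_ae ?_
    filter_upwards [e] with t ht _ using ht
  rw [this]
  exact (intervalIntegral.integral_hasDerivAt_right (hh.intervalIntegrable _ _)
      hh.aestronglyMeasurable.stronglyMeasurableAtFilter hh.continuousAt).const_add _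

theorem IsPrimitive.const_add {G g : ℝ → ℝ} (hG : IsPrimitive G g) (c : ℝ) :
    IsPrimitive (fun x => c + G x) g :=
  ⟨hG.locInt, fun a b => by rw [← hG.sub_eq a b]; ring⟩

/-- A continuous representative is an antiderivative of the weak derivative. -/
theorem HasDx.isPrimitive {v v' : L2} (h : HasDx v v') {V : ℝ → ℝ} (hV : Continuous V)
    (e : v =ᵐ[volume] V) : IsPrimitive V v' := by
  obtain ⟨W, hW, eW⟩ := h.exists_rep
  have : V = W := (Continuous.ae_eq_iff_eq volume hV hW.continuous).1 (e.symm.trans eW)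
  rw [this]
  exact hW

/-- The continuous representative of an element of `H³(ℝ)` is of class `C²`, with bounds from
the Sobolev inequality. -/
theorem classical_of_hasDx {v₁ v₂ v₃ : L2} (h1 : HasDx v₁ v₂)
    (h2 : HasDx v₂ v₃) {V : ℝ → ℝ} (hV : IsPrimitive V v₁) :
    ContDiff ℝ 2 V ∧ (∀ x, deriv V x ^ 2 ≤ 2 * (‖v₁‖ * ‖v₂‖)) ∧
      ∀ x, iteratedDeriv 2 V x ^ 2 ≤ 2 * (‖v₂‖ * ‖v₃‖) := by
  obtain ⟨V₁, hV₁, e₁⟩ := h1.exists_rep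
  obtain ⟨V₂, hV₂, e₂⟩ := h2.exists_rep
  have d0 := hV.hasDerivAt e₁ hV₁.continuous
  have d1 := hV₁.hasDerivAt e₂ hV₂.continuous
  have ed0 : deriv V = V₁ := funext fun x => (d0 x).deriv
  have ed1 : deriv V₁ = V₂ := funext fun x => (d1 x).deriv
  have eit : iteratedDeriv 2 V = V₂ := by
    rw [iteratedDeriv_succ, iteratedDeriv_one, ed0, ed1]
  refine ⟨?_, fun x => ?_, fun x => ?_⟩
  · rw [show (2 : WithTop ℕ∞) = 1 + 1 by norm_num, contDiff_succ_iff_deriv]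
    refine ⟨fun x => (d0 x).differentiableAt, by simp, ?_⟩
    rw [ed0, contDiff_one_iff_deriv, ed1]
    exact ⟨fun x => (d1 x).differentiableAt, hV₂.continuous⟩
  · rw [ed0]
    exact hV₁.sq_le e₁ x
  · rw [eit]
    exact hV₂.sq_le e₂ x

/-- For a function bounded by `M`, the weak derivative of the truncated flux is the classical
derivative of the flux. -/
theorem deriv_flux_ae {f g : ℝ → ℝ} {C : NNReal} (hL : LipschitzWith C g) (g0 : g 0 = 0)
    {c M : ℝ} (hfg : ∀ s, |s| ≤ M → g s = f (c + s) - f c) {v S : L2} {V : ℝ → ℝ}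
    (hV : Continuous V) (e : v =ᵐ[volume] V) (hM : ∀ x, |V x| ≤ M)
    (hS : HasDx (hL.compLp g0 v) S) : ∀ᵐ x, deriv (fun y => f (c + V y)) x = S x := by
  have e1 : (hL.compLp g0 v : L2) =ᵐ[volume] fun x => g (V x) := by
    filter_upwards [hL.coeFn_compLp g0 v, e] with x h1 h2
    rw [h1, Function.comp_apply, h2]
  have hP := hS.isPrimitive (hL.continuous.comp hV) e1
  filter_upwards [hP.ae_hasDerivAt] with x hx
  have e2 : (fun y => f (c + V y)) = fun y => g (V y) + f c := by
    ext y
    rw [hfg _ (hM y)]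
    ring
  rw [e2]
  exact (hx.add_const (f c)).deriv

/-! ### Evolutions as solutions of the Cauchy problem -/

theorem integral_deriv_smul_add {E : Type*} [NormedAddCommGroup E] [NormedSpace ℝ E]
    [CompleteSpace E] {η : ℝ → ℝ} (hη : ContDiff ℝ ∞ η) (hc : HasCompactSupport η) {N : ℝ → E}
    (hN : Continuous N) (z : E) :
    ∫ t, deriv η t • (z + ∫ s in (0 : ℝ)..t, N s) = -∫ t, η t • N t := by
  have hP : Continuous fun t => z + ∫ s in (0 : ℝ)..t, N s := continuous_const.add
    (intervalIntegral.continuous_primitive (fun a b => hN.intervalIntegrable a b) 0)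
  have hd : Continuous (deriv η) := hη.continuous_deriv (by simp)
  have hder : ∀ t, HasDerivAt (fun t => η t • (z + ∫ s in (0 : ℝ)..t, N s))
      (η t • N t + deriv η t • (z + ∫ s in (0 : ℝ)..t, N s)) t := fun t =>
    ((hη.differentiable (by simp) t).hasDerivAt).smul
      ((intervalIntegral.integral_hasDerivAt_right (hN.intervalIntegrable _ _)
        hN.aestronglyMeasurable.stronglyMeasurableAtFilter hN.continuousAt).const_add z)
  have i1 : Integrable fun t => η t • N t :=
    (hη.continuous.smul hN).integrable_of_hasCompactSupport hc.smul_right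
  have i2 : Integrable fun t => deriv η t • (z + ∫ s in (0 : ℝ)..t, N s) :=
    (hd.smul hP).integrable_of_hasCompactSupport hc.deriv.smul_right
  have i3 : Integrable fun t => η t • (z + ∫ s in (0 : ℝ)..t, N s) :=
    (hη.continuous.smul hP).integrable_of_hasCompactSupport hc.smul_right
  have := integral_eq_zero_of_hasDerivAt_of_integrable hder (i1.add i2) i3
  rw [integral_add i1 i2] at this
  exact eq_neg_of_add_eq_zero_right this

theorem integral_Ioi_smul {E : Type*} [NormedAddCommGroup E] [NormedSpace ℝ E]
    {η : ℝ → ℝ} (hs : tsupport η ⊆ Ioi 0) (N : ℝ → E) :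
    ∫ t in Ioi (0 : ℝ), η t • N t = ∫ t, η t • N t := by
  refine setIntegral_eq_integral_of_forall_compl_eq_zero fun t ht => ?_
  rw [image_eq_zero_of_notMem_tsupport fun h => ht (hs h), zero_smul]

theorem tsupport_deriv_subset' (η : ℝ → ℝ) : tsupport (deriv η) ⊆ tsupport η :=
  closure_minimal (support_deriv_subset) (isClosed_tsupport η)

theorem HasDx.ddres {a : ℝ} (ha : 0 < a) {v w : L2} (h : HasDx v w) :
    HasDx (ddres a v) (ddres a w) := ((h.res ha).sub h).smul a⁻¹

theorem dres_eq_of_hasDx {a : ℝ} (ha : 0 < a) {v w : L2} (h : HasDx v w) :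
    dres a w = ddres a v := by
  have h1 := dres_hasDx ha v
  rw [res_comm_hasDx ha h] at h1
  exact (res_hasDx ha w).unique h1

section
variable {α β γ : ℝ} {φ φ₁ φ₂ φ₃ G S : ℝ → L2} {C : NNReal}

/-- The time derivative of a solution, in a form which exhibits its integrability in time. -/
noncomputable def timeDeriv (α β γ : ℝ) (v₁ v₂ s : L2) : L2 :=
  (γ / α) • v₂ + (β - γ / α) • dres α v₁ - res α s

theorem res_timeDeriv (hα : 0 < α) {v v₁ v₂ g s : L2} (h0 : HasDx v v₁)
    (h1 : HasDx v₁ v₂) (hs : HasDx g s) :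
    res α (timeDeriv α β γ v₁ v₂ s) = evolRate α β γ v g := by
  have e1 : dres α v₁ = ddres α v := dres_eq_of_hasDx hα h0
  have e2 : res α v₂ = ddres α v := by rw [← res_comm_hasDx hα h1, e1]
  have e3 : dres α g = res α s := res_comm_hasDx hα hs
  simp only [timeDeriv, evolRate, map_add, map_sub, map_smul, e1, e2, e3]

theorem equation_timeDeriv (hα : 0 < α) {v₁ v₂ v₄ s : L2} (h1 : HasDx v₁ v₂) :
    timeDeriv α β γ v₁ v₂ s + s - α • ((γ / α) • v₄ + (β - γ / α) • ddres α v₂ - ddres α s)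
      - β • v₂ + γ • v₄ = 0 := by
  have e1 : dres α v₁ = res α v₂ := res_comm_hasDx hα h1
  have e2 : α • ((γ / α) • v₄ + (β - γ / α) • ddres α v₂ - ddres α s) =
      γ • v₄ + (β - γ / α) • (res α v₂ - v₂) - (res α s - s) := by
    rw [← smul_ddres hα v₂, ← smul_ddres hα s, smul_sub, smul_add, smul_smul,
      mul_div_cancel₀ _ hα.ne', smul_comm]
  rw [e2, timeDeriv, e1]
  module

/-- As the resolvent is injective, the smoothed equation identifies the weak time derivative. -/
theorem IsEvolution.isTimeDeriv (hα : 0 < α) (h : ∀ T, IsEvolution α β γ T φ G) {m : ℝ → L2}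
    (hm : MemLp m 2 (volume.restrict (Ioi (0 : ℝ))))
    (hmr : ∀ᵐ t ∂(volume.restrict (Ioi (0 : ℝ))), res α (m t) = evolRate α β γ (φ t) (G t)) :
    IsTimeDeriv φ m := by
  intro η hη hc hs
  have hd : Continuous (deriv η) := hη.continuous_deriv (by simp)
  have hφc := (h 0).continuous_fst
  have hNc := (h 0).continuous_rate
  have i1 : IntegrableOn (fun t => deriv η t • φ t) (Ioi 0) :=
    ((hd.smul hφc).integrable_of_hasCompactSupport hc.deriv.smul_right).integrableOn
  have i2 : IntegrableOn (fun t => η t • m t) (Ioi 0) := by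
    have : MemLp η 2 (volume.restrict (Ioi (0 : ℝ))) :=
      (hη.continuous.memLp_of_hasCompactSupport hc)
    exact memLp_one_iff_integrable.1 (hm.smul this)
  have key : res α (∫ t in Ioi (0 : ℝ), deriv η t • φ t) =
      res α (-∫ t in Ioi (0 : ℝ), η t • m t) := by
    rw [map_neg, ← ContinuousLinearMap.integral_comp_comm _ i1,
      ← ContinuousLinearMap.integral_comp_comm _ i2]
    have e : ∫ t in Ioi (0 : ℝ), res α (η t • m t) =
        ∫ t in Ioi (0 : ℝ), η t • evolRate α β γ (φ t) (G t) := by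
      refine integral_congr_ae ?_
      filter_upwards [hmr] with t ht
      rw [map_smul, ht]
    rw [e, integral_Ioi_smul hs, ← integral_deriv_smul_add hη hc hNc (res α (φ 0)),
      ← integral_Ioi_smul ((tsupport_deriv_subset' η).trans hs)]
    refine setIntegral_congr_fun measurableSet_Ioi fun t ht => ?_
    rw [map_smul, (h t).eq_integral t ⟨(mem_Ioi.1 ht).le, le_rfl⟩]
  refine sub_eq_zero.1 (eq_zero_of_res_eq_zero hα ?_)
  rw [map_sub, key, sub_self]

theorem coeFn_lp_combination (a b c : ℝ) (m s n v w : L2) :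
    ∀ᵐ x, (m + s - a • n - b • v + c • w : L2) x =
      m x + s x - a * n x - b * v x + c * w x := by
  filter_upwards [Lp.coeFn_add (m + s - a • n - b • v) (c • w),
    Lp.coeFn_sub (m + s - a • n) (b • v), Lp.coeFn_sub (m + s) (a • n), Lp.coeFn_add m s,
    Lp.coeFn_smul a n, Lp.coeFn_smul b v, Lp.coeFn_smul c w] with x h1 h2 h3 h4 h5 h6 h7
  simp only [h1, h2, h3, h4, h5, h6, h7, Pi.add_apply, Pi.sub_apply, Pi.smul_apply, smul_eq_mul]

/-- A strong evolution whose values stay in the region where the flux is not truncated is a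
global solution of the Cauchy problem. -/
theorem isGlobalSolution_of_strong (hα : 0 < α) (hβ : 0 < β) (hγ : 0 < γ) {f g : ℝ → ℝ}
    (hL : LipschitzWith C g) (g0 : g 0 = 0) {c M : ℝ}
    (hfg : ∀ s, |s| ≤ M → g s = f (c + s) - f c) {u₀ : ℝ → ℝ}
    (h : ∀ T, IsStrongEvolution α β γ T φ φ₁ φ₂ φ₃ (fun t => hL.compLp g0 (φ t)) S)
    (hS : ∀ t, ‖S t‖ ≤ C * ‖φ₁ t‖) {V : ℝ → ℝ → ℝ} (hV : ∀ t, IsPrimitive (V t) (φ₁ t))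
    (e : ∀ t, φ t =ᵐ[volume] V t) (hM : ∀ t, 0 ≤ t → ∀ x, |V t x| ≤ M)
    (h0 : ∀ᵐ x, φ 0 x = u₀ x - c) :
    IsGlobalSolution α β γ f c u₀ (fun t x => c + V t x) := by
  have hG : ∀ t, inner ℝ (hL.compLp g0 (φ t)) (φ₁ t) = 0 := fun t =>
    inner_compLp_eq_zero hL g0 ((h 0).hasDx₀ t)
  have m1 := IsStrongEvolution.memLp₁ hα hβ hγ h hG
  have m2 := IsStrongEvolution.memLp₂ hα hβ hγ h hG
  have m3 := IsStrongEvolution.memLp₃ hα hβ hγ h hG hS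
  have mS := IsStrongEvolution.memLpS hα hβ hγ h hG hS
  obtain ⟨φ₄, m4, h4⟩ := IsStrongEvolution.exists_fourth hα hβ hγ h hG hS
  have d0 := (h 0).hasDx₀
  have d1 := (h 0).hasDx₁
  have d2 := (h 0).hasDx₂
  have dG := (h 0).hasDxG
  let w0 : ℝ → L2 := fun t => timeDeriv α β γ (φ₁ t) (φ₂ t) (S t)
  let w1 : ℝ → L2 := fun t => (γ / α) • φ₃ t + (β - γ / α) • ddres α (φ₁ t) - dres α (S t)
  let w2 : ℝ → L2 := fun t => (γ / α) • φ₄ t + (β - γ / α) • ddres α (φ₂ t) - ddres α (S t)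
  have mw0 : MemLp w0 2 (volume.restrict (Ioi (0 : ℝ))) :=
    ((m2.const_smul (γ / α)).add (((dres α).comp_memLp' m1).const_smul (β - γ / α))).sub
      ((res α).comp_memLp' mS)
  have mw1 : MemLp w1 2 (volume.restrict (Ioi (0 : ℝ))) :=
    ((m3.const_smul (γ / α)).add (((ddres α).comp_memLp' m1).const_smul (β - γ / α))).sub
      ((dres α).comp_memLp' mS)
  have mw2 : MemLp w2 2 (volume.restrict (Ioi (0 : ℝ))) :=
    ((m4.const_smul (γ / α)).add (((ddres α).comp_memLp' m2).const_smul (β - γ / α))).sub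
      ((ddres α).comp_memLp' mS)
  have dw0 : ∀ t, HasDx (w0 t) (w1 t) := fun t =>
    (((d2 t).smul _).add ((dres_hasDx hα (φ₁ t)).smul _)).sub (res_hasDx hα (S t))
  have dw1 : ∀ t, HasDx (φ₃ t) (φ₄ t) → HasDx (w1 t) (w2 t) := fun t ht =>
    ((ht.smul _).add (((d1 t).ddres hα).smul _)).sub (dres_hasDx hα (S t))
  -- off a null set of times the values are irrelevant, but have to be elements of the space
  have hux : ∀ t, ∃ z : SobolevH 3, HasDx (φ₃ t) (φ₄ t) →
      ∀ j, dx z j = ![φ₁ t, φ₂ t, φ₃ t, φ₄ t] j := fun t => by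
    by_cases ht : HasDx (φ₃ t) (φ₄ t)
    · exact ⟨mkSobolev ![φ₁ t, φ₂ t, φ₃ t, φ₄ t] (fun j => by
        fin_cases j
        exacts [d1 t, d2 t, ht]), fun _ j => rfl⟩
    · exact ⟨0, fun ht' => absurd ht' ht⟩
  have hut : ∀ t, ∃ z : SobolevH 2, HasDx (φ₃ t) (φ₄ t) →
      ∀ j, dx z j = ![w0 t, w1 t, w2 t] j := fun t => by
    by_cases ht : HasDx (φ₃ t) (φ₄ t)
    · exact ⟨mkSobolev ![w0 t, w1 t, w2 t] (fun j => by
        fin_cases j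
        exacts [dw0 t, dw1 t ht]), fun _ j => rfl⟩
    · exact ⟨0, fun ht' => absurd ht' ht⟩
  choose ux hux using hux
  choose ut hut using hut
  let Φ : ℝ → SobolevH 3 := fun t => mkSobolev ![φ t, φ₁ t, φ₂ t, φ₃ t] (fun j => by
    fin_cases j
    exacts [d0 t, d1 t, d2 t])
  have hΦ : Continuous Φ := continuous_iff_continuousAt.2 fun t => tendsto_sobolev fun j => by
    fin_cases j
    exacts [(h 0).evol.continuous_fst.tendsto t, (h 0).cont₁.tendsto t, (h 0).cont₂.tendsto t,
      (h 0).cont₃.tendsto t]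
  have mux : MemLp ux 2 (volume.restrict (Ioi (0 : ℝ))) := memLp_sobolev fun j => by
    have : MemLp (fun t => ![φ₁ t, φ₂ t, φ₃ t, φ₄ t] j) 2 (volume.restrict (Ioi (0 : ℝ))) := by
      fin_cases j
      exacts [m1, m2, m3, m4]
    refine this.ae_eq ?_
    filter_upwards [h4] with t ht using (hux t ht j).symm
  have hmut : MemLp ut 2 (volume.restrict (Ioi (0 : ℝ))) := memLp_sobolev fun j => by
    have : MemLp (fun t => ![w0 t, w1 t, w2 t] j) 2 (volume.restrict (Ioi (0 : ℝ))) := by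
      fin_cases j
      exacts [mw0, mw1, mw2]
    refine this.ae_eq ?_
    filter_upwards [h4] with t ht using (hut t ht j).symm
  refine ⟨Φ, ux, ut, ?_, ?_, hΦ.continuousOn, ?_, mux, ?_, hmut, ?_, ?_⟩
  · exact fun t _ => continuous_const.add (hV t).continuous
  · intro t _
    filter_upwards [e t] with x hx
    rw [add_sub_cancel_left, ← hx]
    rfl
  · filter_upwards [h4] with t ht
    rw [hux t ht 0]
    exact ((hV t).const_add c).isWeakDeriv
  · refine IsEvolution.isTimeDeriv hα (fun T => (h T).evol)
      ((dxL 2 0).comp_memLp' hmut) ?_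
    filter_upwards [h4] with t ht
    rw [hut t ht 0]
    exact res_timeDeriv hα (d0 t) (d1 t) (dG t)
  · filter_upwards [h0, e 0] with x h1 h2
    rw [← h2, h1]
    ring
  · filter_upwards [h4, ae_restrict_mem measurableSet_Ioi] with t ht ht0
    have hS' := deriv_flux_ae hL g0 hfg (hV t).continuous (e t) (hM t (mem_Ioi.1 ht0).le) (dG t)
    rw [hut t ht 0, hut t ht 2, hux t ht 1, hux t ht 3]
    have key := equation_timeDeriv (β := β) (γ := γ) hα (v₄ := φ₄ t) (s := S t) (d1 t)
    have := coeFn_lp_combination α β γ (w0 t) (S t) (w2 t) (φ₂ t) (φ₄ t)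
    rw [key] at this
    filter_upwards [hS', this, Lp.coeFn_zero ℝ 2 (volume : Measure ℝ)] with x h1 h2 h3
    rw [h1]
    exact h2.symm.trans h3

end

/-! ### Uniqueness -/

section
variable {α β γ T : ℝ} {φ φ₁ φ₂ φ₃ G S ψ ψ₁ ψ₂ ψ₃ H S' : ℝ → L2}

theorem ddres_eq_res (hα : 0 < α) {v w z : L2} (h : HasDx v w) (k : HasDx w z) :
    ddres α v = res α z := by
  rw [← dres_eq_of_hasDx hα h, res_comm_hasDx hα k]

/-- The equation, once smoothed by the resolvent, determines the time derivative. -/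
theorem res_eq_evolRate (hα : 0 < α) {v v₁ v₂ v₃ v₄ g s m m₁ m₂ : L2} (h0 : HasDx v v₁)
    (h1 : HasDx v₁ v₂) (h2 : HasDx v₂ v₃) (h3 : HasDx v₃ v₄) (hs : HasDx g s) (hm : HasDx m m₁)
    (hm' : HasDx m₁ m₂) (heq : m + s - α • m₂ - β • v₂ + γ • v₄ = 0) :
    res α m = evolRate α β γ v g := by
  have e1 := congrArg (res α) heq
  simp only [map_add, map_sub, map_smul, map_zero] at e1
  rw [← ddres_eq_res hα hm hm', smul_ddres hα, ← ddres_eq_res hα h0 h1,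
    ← ddres_eq_res hα h2 h3] at e1
  have e2 : m = β • ddres α v - γ • ddres α v₂ - res α s := by
    rw [← sub_eq_zero, ← e1]
    module
  have e3 : res α (ddres α v₂) = α⁻¹ • (res α (ddres α v) - ddres α v) := by
    rw [res_ddres, ← ddres_eq_res hα h0 h1, ddres_apply]
  have e4 : dres α g = res α s := res_comm_hasDx hα hs
  have e5 := congrArg (res α) e2
  simp only [map_sub, map_smul, e3] at e5
  rw [e5, evolRate, e4, div_eq_mul_inv]
  module

/-- A weak time derivative that is given by the smoothed equation can be integrated, by the lemma
of du Bois-Reymond on `(0, T)`. -/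
theorem IsEvolution.of_isTimeDeriv (hφ : Continuous φ) (hG : Continuous G)
    {m : ℝ → L2} (hm : MemLp m 2 (volume.restrict (Ioi (0 : ℝ)))) (hd : IsTimeDeriv φ m)
    (hmr : ∀ᵐ t ∂(volume.restrict (Ioi (0 : ℝ))), t ≤ T →
      res α (m t) = evolRate α β γ (φ t) (G t)) : IsEvolution α β γ T φ G := by
  refine ⟨hφ, hG, fun t ht => ?_⟩
  have hN : Continuous fun s => evolRate α β γ (φ s) (G s) := by
    unfold evolRate
    fun_prop
  have hP : Continuous fun t => ∫ s in (0 : ℝ)..t, evolRate α β γ (φ s) (G s) :=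
    intervalIntegral.continuous_primitive (fun a b => hN.intervalIntegrable a b) 0
  rcases ht.1.eq_or_lt with rfl | ht0
  · simp
  have hT : 0 < T := ht0.trans_le ht.2
  have hRc : Continuous fun t => res α (φ t) := (res α).continuous.comp hφ
  obtain ⟨Z, hZ⟩ := ae_const_of_integral_deriv_smul_eq_zero (s := Ioo 0 T)
    (g := fun t => res α (φ t) - ∫ s in (0 : ℝ)..t, evolRate α β γ (φ s) (G s))
    isOpen_Ioo ordConnected_Ioo ((hRc.sub hP).locallyIntegrable.locallyIntegrableOn _) (by
      intro η hη hc hs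
      have hs0 : tsupport η ⊆ Ioi 0 := hs.trans Ioo_subset_Ioi_self
      have hdc : Continuous (deriv η) := hη.continuous_deriv (by simp)
      have i1 : Integrable fun t => deriv η t • φ t :=
        (hdc.smul hφ).integrable_of_hasCompactSupport hc.deriv.smul_right
      have i2 : IntegrableOn (fun t => η t • m t) (Ioi 0) := by
        have : MemLp η 2 (volume.restrict (Ioi (0 : ℝ))) :=
          (hη.continuous.memLp_of_hasCompactSupport hc)
        exact memLp_one_iff_integrable.1 (hm.smul this)
      have j1 : Integrable fun t => deriv η t • res α (φ t) :=
        (hdc.smul hRc).integrable_of_hasCompactSupport hc.deriv.smul_right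
      have j2 : Integrable fun t => deriv η t • ∫ s in (0 : ℝ)..t, evolRate α β γ (φ s) (G s) :=
        (hdc.smul hP).integrable_of_hasCompactSupport hc.deriv.smul_right
      have k1 := congrArg (res α) (hd η hη hc hs0)
      rw [integral_Ioi_smul ((tsupport_deriv_subset' η).trans hs0), map_neg,
        ← ContinuousLinearMap.integral_comp_comm _ i1,
        ← ContinuousLinearMap.integral_comp_comm _ i2] at k1
      have k2 : ∫ t in Ioi (0 : ℝ), res α (η t • m t) =
          ∫ t in Ioi (0 : ℝ), η t • evolRate α β γ (φ t) (G t) := by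
        refine integral_congr_ae ?_
        filter_upwards [hmr] with t ht
        rw [map_smul]
        by_cases h : t ≤ T
        · rw [ht h]
        · rw [image_eq_zero_of_notMem_tsupport fun h' => h (hs h').2.le, zero_smul, zero_smul]
      have k3 := integral_deriv_smul_add hη hc hN 0
      simp only [zero_add] at k3
      simp only [map_smul] at k1 k2
      simp only [smul_sub]
      rw [integral_sub j1 j2, k1, k2, k3, integral_Ioi_smul hs0, sub_self])
  have hE : EqOn (fun t => res α (φ t) - ∫ s in (0 : ℝ)..t, evolRate α β γ (φ s) (G s))
      (fun _ => Z) (Icc 0 T) := by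
    refine Measure.eqOn_Icc_of_ae_eq (μ := volume) hT.ne ?_ (hRc.sub hP).continuousOn
      continuousOn_const
    rw [← restrict_Ioo_eq_restrict_Icc, EventuallyEq, ae_restrict_iff' measurableSet_Ioo]
    exact hZ
  have h1 := hE ht
  have h2 := hE ⟨le_rfl, hT.le⟩
  simp only [intervalIntegral.integral_same, sub_zero] at h1 h2
  rw [h2, ← h1, sub_add_cancel]

theorem IsStrongEvolution.sub (h : IsStrongEvolution α β γ T φ φ₁ φ₂ φ₃ G S)
    (k : IsStrongEvolution α β γ T ψ ψ₁ ψ₂ ψ₃ H S') :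
    IsStrongEvolution α β γ T (fun t => φ t - ψ t) (fun t => φ₁ t - ψ₁ t) (fun t => φ₂ t - ψ₂ t)
      (fun t => φ₃ t - ψ₃ t) (fun t => G t - H t) (fun t => S t - S' t) :=
  ⟨h.evol.sub k.evol, h.cont₁.sub k.cont₁, h.cont₂.sub k.cont₂, h.cont₃.sub k.cont₃,
    fun t => (h.hasDx₀ t).sub (k.hasDx₀ t), fun t => (h.hasDx₁ t).sub (k.hasDx₁ t),
    fun t => (h.hasDx₂ t).sub (k.hasDx₂ t), fun t => (h.hasDxG t).sub (k.hasDxG t)⟩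

/-- For a Lipschitz flux the energy of the difference of two solutions satisfies a Gronwall
inequality. -/
theorem IsStrongEvolution.eqOn (hα : 0 < α) (hβ : 0 < β) (hγ : 0 < γ) {g : ℝ → ℝ} {C : NNReal}
    (hL : LipschitzWith C g) (g0 : g 0 = 0)
    (h : IsStrongEvolution α β γ T φ φ₁ φ₂ φ₃ (fun t => hL.compLp g0 (φ t)) S)
    (k : IsStrongEvolution α β γ T ψ ψ₁ ψ₂ ψ₃ (fun t => hL.compLp g0 (ψ t)) S')
    (h0 : φ 0 = ψ 0) : EqOn φ ψ (Icc 0 T) := by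
  have hw := h.sub k
  have h1 : φ₁ 0 = ψ₁ 0 := by
    have := h.hasDx₀ 0
    rw [h0] at this
    exact this.unique (k.hasDx₀ 0)
  set e : ℝ → ℝ := fun t => ‖φ t - ψ t‖ ^ 2 + α * ‖φ₁ t - ψ₁ t‖ ^ 2 with he
  have c0 := hw.evol.continuous_fst
  have c1 := hw.cont₁
  have c2 := hw.cont₂
  have cG := hw.evol.continuous_snd
  have hec : Continuous e := by fun_prop
  set K : ℝ := C * (1 + α⁻¹) with hK
  have hK0 : 0 ≤ K := by positivity
  have hE : ∀ t, HasDerivAt (fun t => ∫ s in (0 : ℝ)..t, K * e s) (K * e t) t := fun t =>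
    intervalIntegral.integral_hasDerivAt_right ((hec.const_mul K).intervalIntegrable _ _)
      (hec.const_mul K).aestronglyMeasurable.stronglyMeasurableAtFilter
      (hec.const_mul K).continuousAt
  have hle : ∀ t ∈ Icc 0 T, e t ≤ ∫ s in (0 : ℝ)..t, K * e s := by
    intro t ht
    have hid := hw.energy_zero hα ht
    simp only [h0, h1, sub_self, norm_zero] at hid
    have hmono : ∫ s in (0 : ℝ)..t, -(K * e s) ≤ ∫ s in (0 : ℝ)..t,
        2 * (β * ‖φ₁ s - ψ₁ s‖ ^ 2 + γ * ‖φ₂ s - ψ₂ s‖ ^ 2 -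
          inner ℝ ((hL.compLp g0 (φ s) : L2) - hL.compLp g0 (ψ s)) (φ₁ s - ψ₁ s)) := by
      refine intervalIntegral.integral_mono_on ht.1
        ((hec.const_mul K).neg.intervalIntegrable _ _) ?_ fun s _ => ?_
      · have := cG.inner (𝕜 := ℝ) c1
        exact (by fun_prop : Continuous _).intervalIntegrable _ _
      · have b1 := real_inner_le_norm ((hL.compLp g0 (φ s) : L2) - hL.compLp g0 (ψ s))
          (φ₁ s - ψ₁ s)
        have b2 := mul_le_mul_of_nonneg_right (hL.norm_compLp_sub_le g0 (φ s) (ψ s))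
          (norm_nonneg (φ₁ s - ψ₁ s))
        have b3 : 0 ≤ β * ‖φ₁ s - ψ₁ s‖ ^ 2 := by positivity
        have b4 : 0 ≤ γ * ‖φ₂ s - ψ₂ s‖ ^ 2 := by positivity
        have b5 : 0 ≤ (C : ℝ) * (‖φ s - ψ s‖ - ‖φ₁ s - ψ₁ s‖) ^ 2 := by positivity
        have b6 : K * e s = C * (‖φ s - ψ s‖ ^ 2 + ‖φ₁ s - ψ₁ s‖ ^ 2)
            + C * (α⁻¹ * ‖φ s - ψ s‖ ^ 2 + α * ‖φ₁ s - ψ₁ s‖ ^ 2) := by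
          simp only [hK, he]
          field_simp
          ring
        have b7 : 0 ≤ (C : ℝ) * (α⁻¹ * ‖φ s - ψ s‖ ^ 2 + α * ‖φ₁ s - ψ₁ s‖ ^ 2) := by
          positivity
        nlinarith
    rw [intervalIntegral.integral_neg, intervalIntegral.integral_const_mul 2] at hmono
    simp only [he] at hmono ⊢
    linarith
  intro t ht
  have hGr := le_exp_mul_of_deriv_le hK0 le_rfl hE (T := T) (fun t ht => by
    rw [add_zero]
    exact mul_le_mul_of_nonneg_left (hle t ht) hK0) ht
  simp only [intervalIntegral.integral_same, zero_mul, add_zero, mul_zero] at hGr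
  have h2 := (hle t ht).trans hGr
  have h3 : ‖φ t - ψ t‖ ^ 2 ≤ 0 := by
    have : 0 ≤ α * ‖φ₁ t - ψ₁ t‖ ^ 2 := by positivity
    simp only [he] at h2
    linarith
  exact sub_eq_zero.1 (norm_eq_zero.1 (pow_eq_zero_iff (two_ne_zero) |>.1
    (le_antisymm h3 (sq_nonneg _))))

end

section
variable {α β γ : ℝ} {f : ℝ → ℝ} {c : ℝ} {u₀ : ℝ → ℝ} {u : ℝ → ℝ → ℝ}
  {Φ ux : ℝ → SobolevH 3} {ut : ℝ → SobolevH 2}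

namespace IsSolutionWith

theorem continuous_dx (h : IsSolutionWith α β γ f c u₀ u Φ ux ut) (j : Fin 4) :
    Continuous fun t => dx (Φ (max t 0)) j := by
  have : Continuous fun t : ℝ => Φ (max t 0) :=
    h.dev_continuous.comp_continuous (by fun_prop) fun t => le_max_right t 0
  exact (dxL 3 j).continuous.comp this

theorem isPrimitive (h : IsSolutionWith α β γ f c u₀ u Φ ux ut) {t : ℝ} (ht : 0 ≤ t) :
    IsPrimitive (fun x => u t x - c) (dx (Φ t) 1) :=
  (dx_hasDx (Φ t) 0).isPrimitive ((h.continuous_space t ht).sub continuous_const) (h.dev_eq t ht)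

theorem exists_bound (h : IsSolutionWith α β γ f c u₀ u Φ ux ut) (T : ℝ) :
    ∃ R, ∀ t ∈ Icc 0 T, ∀ x, |u t x - c| ≤ R := by
  have hc : Continuous fun t => 2 * (‖dx (Φ (max t 0)) 0‖ * ‖dx (Φ (max t 0)) 1‖) :=
    continuous_const.mul ((h.continuous_dx 0).norm.mul (h.continuous_dx 1).norm)
  obtain ⟨B, hB⟩ := (isCompact_Icc (a := (0 : ℝ)) (b := T)).exists_bound_of_continuousOn
    hc.continuousOn
  refine ⟨√B, fun t ht x => Real.abs_le_sqrt ?_⟩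
  have h1 := (h.isPrimitive ht.1).sq_le (h.dev_eq t ht.1) x
  have h2 := (le_abs_self _).trans (hB t ht)
  rw [max_eq_left ht.1] at h2
  exact h1.trans h2

/-- As long as its values stay in the region where the flux is not truncated, a solution of the
Cauchy problem is a strong evolution for the truncated flux. -/
theorem isStrongEvolution (h : IsSolutionWith α β γ f c u₀ u Φ ux ut) (hα : 0 < α) {g : ℝ → ℝ}
    {C : NNReal} (hg : ContDiff ℝ 1 g) (hL : LipschitzWith C g) (g0 : g 0 = 0) {R T : ℝ}
    (hfg : ∀ s, |s| ≤ R → g s = f (c + s) - f c) (hR : ∀ t ∈ Icc 0 T, ∀ x, |u t x - c| ≤ R) :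
    ∃ S, IsStrongEvolution α β γ T (fun t => dx (Φ (max t 0)) 0) (fun t => dx (Φ (max t 0)) 1)
      (fun t => dx (Φ (max t 0)) 2) (fun t => dx (Φ (max t 0)) 3)
      (fun t => hL.compLp g0 (dx (Φ (max t 0)) 0)) S := by
  have d0 : ∀ t, HasDx (dx (Φ t) 0) (dx (Φ t) 1) := fun t => dx_hasDx (Φ t) 0
  have d1 : ∀ t, HasDx (dx (Φ t) 1) (dx (Φ t) 2) := fun t => dx_hasDx (Φ t) 1
  have d2 : ∀ t, HasDx (dx (Φ t) 2) (dx (Φ t) 3) := fun t => dx_hasDx (Φ t) 2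
  choose S hS _ using fun t => exists_hasDx_compLp hg hL g0 (d0 (max t 0))
  refine ⟨S, ?_, h.continuous_dx 1, h.continuous_dx 2, h.continuous_dx 3, fun t => d0 _,
    fun t => d1 _, fun t => d2 _, hS⟩
  refine IsEvolution.of_isTimeDeriv (m := fun t => dx (ut t) 0) (h.continuous_dx 0)
    ((hL.continuous_compLp g0).comp (h.continuous_dx 0)) ((dxL 2 0).comp_memLp' h.ut_memLp) ?_ ?_
  · intro η hη hc hs
    rw [← h.ut_eq η hη hc hs]
    refine setIntegral_congr_fun measurableSet_Ioi fun t ht => ?_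
    simp only [max_eq_left (mem_Ioi.1 ht).le]
  · filter_upwards [h.ux_eq, h.equation, ae_restrict_mem measurableSet_Ioi] with t h1 h2 ht htT
    have ht0 : 0 ≤ t := (mem_Ioi.1 ht).le
    have hSt := hS t
    rw [max_eq_left ht0] at hSt ⊢
    have x0 : HasDx (dx (ux t) 0) (dx (ux t) 1) := dx_hasDx (ux t) 0
    have x1 : HasDx (dx (ux t) 1) (dx (ux t) 2) := dx_hasDx (ux t) 1
    have x2 : HasDx (dx (ux t) 2) (dx (ux t) 3) := dx_hasDx (ux t) 2
    have hP := (h.isPrimitive ht0).const_add c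
    simp only [add_sub_cancel] at hP
    -- the derivatives of the component `∂ₓu` are those of the component `u - c`
    have e0 : dx (ux t) 0 = dx (Φ t) 1 := Lp.ext (h1.ae_unique hP.isWeakDeriv)
    rw [e0] at x0
    have e1 : dx (ux t) 1 = dx (Φ t) 2 := x0.unique (d1 t)
    rw [e1] at x1
    have e2 : dx (ux t) 2 = dx (Φ t) 3 := x1.unique (d2 t)
    rw [e2] at x2
    have m0 : HasDx (dx (ut t) 0) (dx (ut t) 1) := dx_hasDx (ut t) 0
    have m1 : HasDx (dx (ut t) 1) (dx (ut t) 2) := dx_hasDx (ut t) 1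
    refine res_eq_evolRate hα (d0 t) (d1 t) (d2 t) x2 hSt m0 m1 (Lp.ext ?_)
    have hfl := deriv_flux_ae (V := fun x => u t x - c) hL g0 hfg
      ((h.continuous_space t ht0).sub continuous_const) (h.dev_eq t ht0) (hR t ⟨ht0, htT⟩) hSt
    simp only [add_sub_cancel] at hfl
    filter_upwards [coeFn_lp_combination α β γ (dx (ut t) 0) (S t) (dx (ut t) 2) (dx (Φ t) 2)
      (dx (ux t) 3), h2, hfl, Lp.coeFn_zero ℝ 2 (volume : Measure ℝ)] with x k1 k2 k3 k4
    rw [k1, k4, Pi.zero_apply, ← k3, ← e1]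
    exact k2

end IsSolutionWith

/-- Two solutions of the Cauchy problem coincide. -/
theorem IsGlobalSolution.unique (hα : 0 < α) (hβ : 0 < β) (hγ : 0 < γ) (hf : ContDiff ℝ 1 f)
    {v : ℝ → ℝ → ℝ} (hu : IsGlobalSolution α β γ f c u₀ u) (hv : IsGlobalSolution α β γ f c u₀ v)
    {t : ℝ} (ht : 0 ≤ t) (x : ℝ) : v t x = u t x := by
  obtain ⟨Φ, ux, ut, hu⟩ := hu
  obtain ⟨Ψ, vx, vt, hv⟩ := hv
  obtain ⟨R₁, hR₁⟩ := hu.exists_bound t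
  obtain ⟨R₂, hR₂⟩ := hv.exists_bound t
  have hR : 0 ≤ max R₁ R₂ :=
    le_max_of_le_left ((abs_nonneg _).trans (hR₁ t ⟨ht, le_rfl⟩ 0))
  obtain ⟨g, C, hg, hL, g0, hfg⟩ := exists_truncation hf c hR
  obtain ⟨S₁, h₁⟩ := hu.isStrongEvolution hα hg hL g0 hfg fun s hs y =>
    (hR₁ s hs y).trans (le_max_left _ _)
  obtain ⟨S₂, h₂⟩ := hv.isStrongEvolution hα hg hL g0 hfg fun s hs y =>
    (hR₂ s hs y).trans (le_max_right _ _)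
  have h0 : dx (Ψ (max 0 0)) 0 = dx (Φ (max 0 0)) 0 := by
    rw [max_self]
    refine Lp.ext ?_
    filter_upwards [hu.dev_eq 0 le_rfl, hv.dev_eq 0 le_rfl, hu.initial, hv.initial]
      with y k1 k2 k3 k4
    rw [k1, k2, k3, k4]
  have heq := h₂.eqOn hα hβ hγ hL g0 h₁ h0 (⟨ht, le_rfl⟩ : t ∈ Icc 0 t)
  simp only [max_eq_left ht] at heq
  have hae : v t =ᵐ[volume] u t := by
    filter_upwards [hu.dev_eq t ht, hv.dev_eq t ht] with y k1 k2
    rw [heq, k1] at k2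
    linarith
  exact congrFun ((Continuous.ae_eq_iff_eq volume (hv.continuous_space t ht)
    (hu.continuous_space t ht)).1 hae) x

end

/-! ### Global existence, uniqueness and decay -/

theorem iSup_enorm_le_of_sq_le {ι : Type*} {h : ι → ℝ} {B : ℝ} (hB : ∀ x, h x ^ 2 ≤ B) :
    ⨆ x, ‖h x‖ₑ ≤ ENNReal.ofReal (√B) :=
  iSup_le fun x => by
    rw [Real.enorm_eq_ofReal_abs]
    exact ENNReal.ofReal_le_ofReal (Real.abs_le_sqrt (hB x))

end BBMB

theorem theorem1p1 (α β γ : ℝ) (hα : 0 < α) (hβ : 0 < β) (hγ : 0 < γ)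
    (f : ℝ → ℝ) (hf : ContDiff ℝ 2 f) (c : ℝ) (u₀ : ℝ → ℝ)
    (hu₀ : MemLp (fun x => u₀ x - c) 2 (volume : Measure ℝ))
    (hu₀' : ∃ h : BBMB.SobolevH 2, BBMB.IsWeakDeriv u₀ (BBMB.dx h 0)) :
    ∃ u : ℝ → ℝ → ℝ,
      BBMB.IsGlobalSolution α β γ f c u₀ u ∧
      (∀ v : ℝ → ℝ → ℝ, BBMB.IsGlobalSolution α β γ f c u₀ v →
        ∀ t, 0 ≤ t → ∀ x, v t x = u t x) ∧
      (∀ t, 0 ≤ t → ContDiff ℝ 2 (u t)) ∧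
      Tendsto (fun t : ℝ => (⨆ x : ℝ, ‖u t x - c‖ₑ) + (⨆ x : ℝ, ‖deriv (u t) x‖ₑ)
        + ⨆ x : ℝ, ‖iteratedDeriv 2 (u t) x‖ₑ) atTop (𝓝 0) := by
  open BBMB in
  obtain ⟨h, hh⟩ := hu₀'
  have hf1 : ContDiff ℝ 1 f := hf.of_le (by norm_num)
  set v₀ : L2 := hu₀.toLp _ with hv₀
  have h01 : HasDx v₀ (dx h 0) := by
    obtain ⟨U, hU, eU⟩ := hh.exists_isPrimitive
    refine (hU.const_add (-c)).isWeakDeriv.congr ?_ EventuallyEq.rfl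
    filter_upwards [eU, hu₀.coeFn_toLp] with x h1 h2
    rw [h2, h1]
    ring
  have h12 : HasDx (dx h 0) (dx h 1) := dx_hasDx h 0
  have h23 : HasDx (dx h 1) (dx h 2) := dx_hasDx h 1
  set E : ℝ := ‖v₀‖ ^ 2 + α * ‖dx h 0‖ ^ 2 with hE
  have hE0 : 0 ≤ E := by positivity
  obtain ⟨g, C, hg, hL, g0, hfg⟩ := exists_truncation hf1 c (Real.sqrt_nonneg (E + E / α))
  obtain ⟨φ, φ₁, φ₂, φ₃, S, hφ0, hS, hev⟩ := exists_strong (β := β) hα hβ hγ hg hL g0 h01 h12 h23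
  have hG : ∀ t, inner ℝ (hL.compLp g0 (φ t)) (φ₁ t) = 0 := fun t =>
    inner_compLp_eq_zero hL g0 ((hev 0).hasDx₀ t)
  have hφ₁0 : φ₁ 0 = dx h 0 := by
    have := (hev 0).hasDx₀ 0
    rw [hφ0] at this
    exact this.unique h01
  -- the energy does not increase, and bounds the solution independently of the truncation
  have hen : ∀ t, 0 ≤ t → ‖φ t‖ ^ 2 + α * ‖φ₁ t‖ ^ 2 ≤ E := fun t ht => by
    have h1 := IsStrongEvolution.energy_zero_eq hα hev hG ht
    have h2 : 0 ≤ ∫ s in (0 : ℝ)..t, (β * ‖φ₁ s‖ ^ 2 + γ * ‖φ₂ s‖ ^ 2) :=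
      intervalIntegral.integral_nonneg ht fun s _ => by positivity
    rw [hφ0, hφ₁0] at h1
    linarith
  have hn0 : ∀ t, 0 ≤ t → ‖φ t‖ ^ 2 ≤ E := fun t ht => by
    have : 0 ≤ α * ‖φ₁ t‖ ^ 2 := by positivity
    linarith [hen t ht]
  have hn1 : ∀ t, 0 ≤ t → ‖φ₁ t‖ ^ 2 ≤ E / α := fun t ht => by
    rw [le_div_iff₀' hα]
    linarith [hen t ht, sq_nonneg ‖φ t‖]
  choose V hV eV using fun t => ((hev 0).hasDx₀ t).exists_rep
  have hM : ∀ t, 0 ≤ t → ∀ x, |V t x| ≤ √(E + E / α) := fun t ht x => by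
    refine Real.abs_le_sqrt (((hV t).sq_le (eV t) x).trans ?_)
    nlinarith [hn0 t ht, hn1 t ht, sq_nonneg (‖φ t‖ - ‖φ₁ t‖)]
  have hsol : IsGlobalSolution α β γ f c u₀ (fun t x => c + V t x) := by
    refine isGlobalSolution_of_strong hα hβ hγ hL g0 hfg hev hS hV eV hM ?_
    rw [hφ0]
    exact hu₀.coeFn_toLp
  have hcl := fun t => classical_of_hasDx ((hev 0).hasDx₁ t) ((hev 0).hasDx₂ t)
    ((hV t).const_add c)
  refine ⟨_, hsol, fun v hv t ht x => hsol.unique hα hβ hγ hf1 hv ht x, fun t _ => (hcl t).1, ?_⟩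
  -- in the Sobolev inequalities for `u - c`, `∂ₓu` and `∂ₓ²u` one factor tends to zero and the
  -- other one is bounded
  obtain ⟨R, hR⟩ := IsStrongEvolution.exists_bound₃ hα hβ hγ hev hG hS
  have hdec := IsStrongEvolution.tendsto_energy_one hα hβ hγ hev hG hS
  have t1 : Tendsto (fun t => ‖φ₁ t‖) atTop (𝓝 0) := by
    have : Tendsto (fun t => ‖φ₁ t‖ ^ 2) atTop (𝓝 0) :=
      squeeze_zero (fun t => sq_nonneg _)
        (fun t => le_add_of_nonneg_right (by positivity)) hdec
    simpa using this.sqrt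
  have t2 : Tendsto (fun t => ‖φ₂ t‖) atTop (𝓝 0) := by
    have : Tendsto (fun t => ‖φ₂ t‖ ^ 2) atTop (𝓝 0) := by
      refine squeeze_zero (fun t => sq_nonneg _) (fun t => ?_)
        (by simpa using hdec.const_mul α⁻¹)
      rw [mul_add, inv_mul_cancel_left₀ hα.ne']
      exact le_add_of_nonneg_left (by positivity)
    simpa using this.sqrt
  have b0 : Tendsto (fun t => 2 * (√E * ‖φ₁ t‖)) atTop (𝓝 0) := by
    simpa using (t1.const_mul √E).const_mul 2
  have b1 : Tendsto (fun t => 2 * (‖φ₁ t‖ * ‖φ₂ t‖)) atTop (𝓝 0) := by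
    simpa using (t1.mul t2).const_mul 2
  have b2 : Tendsto (fun t => 2 * (‖φ₂ t‖ * √R)) atTop (𝓝 0) := by
    simpa using (t2.mul_const √R).const_mul 2
  have hlim : ∀ {b : ℝ → ℝ}, Tendsto b atTop (𝓝 0) →
      Tendsto (fun t => ENNReal.ofReal √(b t)) atTop (𝓝 0) := fun hb => by
    simpa using ENNReal.tendsto_ofReal hb.sqrt
  refine tendsto_of_tendsto_of_tendsto_of_le_of_le' tendsto_const_nhds
    (by simpa only [add_zero] using ((hlim b0).add (hlim b1)).add (hlim b2))
    (Eventually.of_forall fun _ => zero_le) ?_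
  filter_upwards [eventually_ge_atTop 0] with t ht
  refine add_le_add (add_le_add ?_ ?_) ?_
  · refine iSup_enorm_le_of_sq_le fun x => ?_
    rw [add_sub_cancel_left]
    refine ((hV t).sq_le (eV t) x).trans ?_
    gcongr
    exact Real.le_sqrt_of_sq_le (hn0 t ht)
  · exact iSup_enorm_le_of_sq_le (hcl t).2.1
  · refine iSup_enorm_le_of_sq_le fun x => ((hcl t).2.2 x).trans ?_
    gcongr
    exact Real.le_sqrt_of_sq_le (hR t ht)
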